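/- Let $\Gamma=\mu_m\subset\mathbb{C}^*$ ($m\ge 1$) be the group of $m$-th roots of unity, $\epsilon:\Gamma\to\mathbb{C}^*$ a primitive (that is, injective) character, $\tau\in\mathbb{C}\Gamma$ an arbitrary element of the group algebra, and $W$ a finite-dimensional $\Gamma$-module. Let $Q$ be the $\mathbb{C}$-algebra generated by $\Gamma$ and $x,z,y,w$ with the relations of $\Gamma$ and $\gamma x\gamma^{-1}=\epsilon(\gamma)x$, $\gamma y\gamma^{-1}=\epsilon(\gamma)^{-1}y$, $\gamma z=z\gamma$, $\gamma w=w\gamma$ for $\gamma\in\Gamma$, $[x,z]=[y,z]=[z,w]=[y,w]=[x,w]=0$, $[y,x]=\tau zw$. It is $\mathbb{Z}^2$-graded by $\deg x=\deg z=(1,0)$, $\deg y=\deg w=(0,1)$, $\deg\gamma=0$. Let $B=Q/(z-1,w-1)$, that is, the algebra generated by $\Gamma,x,y$ with the same relations between $\Gamma$ and $x,y$, and $[y,x]=\tau$. For a right noetherian $\mathbb{Z}^2$-graded algebra $A$ let $\mathrm{gr}^2(A)$ be the category of finitely generated $\mathbb{Z}^2$-graded right $A$-modules, $\mathrm{tor}^2(A)$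 its Serre subcategory of the modules $M$ such that, for some $(i_0,j_0)$, $M_{i,j}=0$ for all $i>i_0$, $j>j_0$, and let $\pi:\mathrm{gr}^2(A)\to\mathrm{qgr}^2(A)=\mathrm{gr}^2(A)/\mathrm{tor}^2(A)$ be the quotient functor. The algebra $Q$ and its quotients $Q/zQ$, $Q/wQ$ by the central elements $z,w$ are right noetherian. Put $\mathrm{coh}(\mathbb{P})=\mathrm{qgr}^2(Q)$, $\mathrm{coh}(\mathbb{P}^1_z)=\mathrm{qgr}^2(Q/zQ)$, $\mathrm{coh}(\mathbb{P}^1_w)=\mathrm{qgr}^2(Q/wQ)$. For $c\in\{z,w\}$ the functor $M\mapsto M/Mc$ induces $i_c^*:\mathrm{coh}(\mathbb{P})\to\mathrm{coh}(\mathbb{P}^1_c)$; $L^1i_c^*$ is its first left derived functor, so that $L^1i_c^*(\pi M)$ is the image under $\pi$ of the value at $M$ of the first left derived functor of $M\mapsto M/Mc$ on $\mathrm{gr}^2(Q)$. The functor $\pi M\mapsto M/(M(z-1)+M(w-1))$ from $\mathrm{coh}(\mathbb{P})$ to right $B$-modules is denoted by $j^*$. Put $W\otimes\mathcal{O}=\pi(W\otimes_\Gamma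 Q)$ and $W\otimes B=W\otimes_\Gamma B$; there is a canonical identification $j^*(W\otimes\mathcal{O})=W\otimes B$. Let $\mathrm{Quot}(W)$ be the category of surjections $W\otimes\mathcal{O}\twoheadrightarrow F$ in $\mathrm{coh}(\mathbb{P})$ with $i_z^*F=L^1i_z^*F=0$ and $L^1i_w^*F=0$, and let $\mathrm{BQuot}(W)$ be the category of surjections $W\otimes B\twoheadrightarrow\mathcal{M}$ of right $B$-modules such that $\mathcal{M}$, viewed as a module over $\mathbb{C}[x]\subset B$, has support of dimension at most zero; morphisms are the morphisms $F\to F'$ (resp. $\mathcal{M}\to\mathcal{M}'$) compatible with the surjections. For $\psi:W\otimes B\to\mathcal{M}$ let $j_{!*}\psi$ be the surjection $W\otimes\mathcal{O}\to\pi\bigl(\bigoplus_{k,l}\psi(W\otimes B_{k,l})\bigr)$ induced by $\psi$, where $B_{k,l}\subset B$ is the image of the component $Q_{k,l}$ of $Q$, the generators $x,y$ and the group $\Gamma$ act by multiplication, and $z,w$ act by the inclusions $\psi(W\otimes B_{k,l})\subset\psi(W\otimes B_{k+1,l})$ and $\psi(W\otimes B_{k,l})\subset\psi(W\otimes B_{k,l+1})$.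 **Theorem.** The functor $j^*$ takes every object of $\mathrm{Quot}(W)$ to an object of $\mathrm{BQuot}(W)$ and gives an equivalence of categories $\mathrm{Quot}(W)\to\mathrm{BQuot}(W)$. The functor $j_{!*}$ takes every object of $\mathrm{BQuot}(W)$ to an object of $\mathrm{Quot}(W)$, and is a quasi-inverse of $j^*$. -/

import Mathlib

open CategoryTheory Limits MulOpposite
open scoped TensorProduct

namespace NCQuadric

/-! ### Bigraded abelian groups -/

section Internal

variable {M N : Type*} [AddCommGroup M] [AddCommGroup N]

theorem isInternal_of_proj (gr : ℤ × ℤ → AddSubgroup M) (pr : ℤ × ℤ → M →+ M)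
    (h1 : ∀ p, ∀ m ∈ gr p, pr p m = m) (h2 : ∀ p q, p ≠ q → ∀ m ∈ gr q, pr p m = 0)
    (h3 : ∀ m, m ∈ ⨆ p, gr p) : DirectSum.IsInternal gr := by
  have key : ∀ (v : DirectSum (ℤ × ℤ) fun p => gr p) (p : ℤ × ℤ),
      pr p (DirectSum.coeAddMonoidHom gr v) = v p := by
    intro v p
    induction v using DirectSum.induction_on with
    | zero => simp
    | of q x =>
      rw [DirectSum.coeAddMonoidHom_of]
      by_cases h : p = q
      · subst h
        rw [h1 p _ x.2, DirectSum.of_eq_same]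
      · rw [h2 p q h _ x.2, DirectSum.of_eq_of_ne _ _ _ h]
        rfl
    | add x y hx hy => rw [map_add, map_add, hx, hy, DirectSum.add_apply]; rfl
  refine ⟨fun v w hvw => ?_, fun m => ?_⟩
  · refine DFinsupp.ext fun p => Subtype.ext ?_
    have a := key v p
    rw [hvw, key w p] at a
    exact a.symm
  · have := h3 m
    induction this using AddSubgroup.iSup_induction' with
    | hp p x hx => exact ⟨DirectSum.of (fun p => gr p) p ⟨x, hx⟩, by simp⟩
    | h1 => exact ⟨0, map_zero _⟩
    | hadd x y _ _ hx hy =>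
      obtain ⟨a, ha⟩ := hx
      obtain ⟨b, hb⟩ := hy
      exact ⟨a + b, by rw [map_add, ha, hb]⟩

/-- A bigraded group is the direct sum of its components. -/
noncomputable def grEquiv (gr : ℤ × ℤ → AddSubgroup M) (h : DirectSum.IsInternal gr) :
    (DirectSum (ℤ × ℤ) fun p => gr p) ≃+ M :=
  AddEquiv.ofBijective (DirectSum.coeAddMonoidHom gr) (show Function.Bijective _ from h)

theorem grEquiv_of (gr : ℤ × ℤ → AddSubgroup M) (h : DirectSum.IsInternal gr) (q : ℤ × ℤ)
    (x : gr q) : grEquiv gr h (DirectSum.of (fun p => gr p) q x) = x :=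
  DirectSum.coeAddMonoidHom_of gr q x

/-- The projection of a bigraded group onto its component of bidegree `p`. -/
noncomputable def grProj (gr : ℤ × ℤ → AddSubgroup M) (h : DirectSum.IsInternal gr)
    (p : ℤ × ℤ) : M →+ M where
  toFun m := ((grEquiv gr h).symm m) p
  map_zero' := by rw [map_zero]; rfl
  map_add' a b := by rw [map_add]; rfl

variable (gr : ℤ × ℤ → AddSubgroup M) (h : DirectSum.IsInternal gr)

theorem grProj_mem (p : ℤ × ℤ) (m : M) : grProj gr h p m ∈ gr p :=
  (((grEquiv gr h).symm m) p).2

theorem grProj_aux (q : ℤ × ℤ) (m : M) (hm : m ∈ gr q) :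
    (grEquiv gr h).symm m
      = DirectSum.of (fun p => gr p) q ⟨m, hm⟩ := by
  rw [AddEquiv.symm_apply_eq, grEquiv_of]

theorem grProj_of_mem {p : ℤ × ℤ} {m : M} (hm : m ∈ gr p) : grProj gr h p m = m := by
  change (((grEquiv gr h).symm m) p : M) = m
  rw [grProj_aux gr h p m hm, DirectSum.of_eq_same]

theorem grProj_of_mem_ne {p q : ℤ × ℤ} (hpq : p ≠ q) {m : M} (hm : m ∈ gr q) :
    grProj gr h p m = 0 := by
  change (((grEquiv gr h).symm m) p : M) = 0
  rw [grProj_aux gr h q m hm, DirectSum.of_eq_of_ne _ _ _ hpq]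
  rfl

theorem mem_iSup_of_isInternal (h : DirectSum.IsInternal gr) (m : M) : m ∈ ⨆ p, gr p := by
  obtain ⟨v, rfl⟩ := h.2 m
  induction v using DirectSum.induction_on with
  | zero => rw [map_zero]; exact zero_mem _
  | of q x =>
    rw [DirectSum.coeAddMonoidHom_of]
    exact AddSubgroup.mem_iSup_of_mem q x.2
  | add x y hx hy => rw [map_add]; exact add_mem hx hy

theorem gr_induction (h : DirectSum.IsInternal gr) {C : M → Prop} (m : M) (h0 : C 0) (hadd : ∀ a b, C a → C b → C (a + b))
    (hom : ∀ p, ∀ m ∈ gr p, C m) : C m := by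
  have := mem_iSup_of_isInternal gr h m
  induction this using AddSubgroup.iSup_induction' with
  | hp p x hx => exact hom p x hx
  | h1 => exact h0
  | hadd x y _ _ hx hy => exact hadd _ _ hx hy

theorem eq_sum_grProj (m : M) : ∃ s : Finset (ℤ × ℤ), m = ∑ p ∈ s, grProj gr h p m ∧
    ∀ p ∉ s, grProj gr h p m = 0 := by
  classical
  refine gr_induction gr h (C := fun m => ∃ s : Finset (ℤ × ℤ), m = ∑ p ∈ s, grProj gr h p m ∧
    ∀ p ∉ s, grProj gr h p m = 0) m ⟨∅, by simp⟩ ?_ ?_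
  · rintro a b ⟨s, hs, hs'⟩ ⟨t, ht, ht'⟩
    have ea : a = ∑ p ∈ s ∪ t, grProj gr h p a := by
      conv_lhs => rw [hs]
      exact Finset.sum_subset Finset.subset_union_left fun p _ hp => hs' p hp
    have eb : b = ∑ p ∈ s ∪ t, grProj gr h p b := by
      conv_lhs => rw [ht]
      exact Finset.sum_subset Finset.subset_union_right fun p _ hp => ht' p hp
    refine ⟨s ∪ t, ?_, fun p hp => ?_⟩
    · simp only [map_add, Finset.sum_add_distrib]
      rw [← ea, ← eb]
    · rw [Finset.mem_union, not_or] at hp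
      rw [map_add, hs' p hp.1, ht' p hp.2, add_zero]
  · intro p m hm
    refine ⟨{p}, by rw [Finset.sum_singleton, grProj_of_mem gr h hm], fun q hq => ?_⟩
    rw [Finset.mem_singleton] at hq
    exact grProj_of_mem_ne gr h hq hm

/-- A map of bigraded groups commutes with the projections. -/
theorem map_grProj {grN : ℤ × ℤ → AddSubgroup N} (hN : DirectSum.IsInternal grN) (f : M →+ N)
    (d : ℤ × ℤ) (hf : ∀ p, ∀ m ∈ gr p, f m ∈ grN (p + d)) (p : ℤ × ℤ) (m : M) :
    f (grProj gr h p m) = grProj grN hN (p + d) (f m) := by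
  refine gr_induction gr h (C := fun m => f (grProj gr h p m) = grProj grN hN (p + d) (f m)) m
    (by simp) (fun a b ha hb => by simp [ha, hb]) ?_
  intro q m hm
  by_cases hpq : p = q
  · subst hpq
    rw [grProj_of_mem gr h hm, grProj_of_mem grN hN (hf _ _ hm)]
  · rw [grProj_of_mem_ne gr h hpq hm, map_zero,
      grProj_of_mem_ne grN hN (fun e => hpq (add_right_cancel e)) (hf _ _ hm)]

/-- The image of a grading under a surjection with homogeneous kernel is a grading. -/
theorem isInternal_map (h : DirectSum.IsInternal gr) (f : M →+ N) (hf : Function.Surjective f)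
    (hker : ∀ p m, f m = 0 → f (grProj gr h p m) = 0) :
    DirectSum.IsInternal fun p => (gr p).map f := by
  obtain ⟨g, hg⟩ := hf.hasRightInverse
  have key : ∀ p m, f (grProj gr h p (g (f m))) = f (grProj gr h p m) := by
    intro p m
    rw [← sub_eq_zero, ← map_sub, ← map_sub]
    exact hker _ _ (by rw [map_sub, hg, sub_self])
  let pr : ℤ × ℤ → N →+ N := fun p =>
    { toFun := fun n => f (grProj gr h p (g n))
      map_zero' := by
        have := key p 0
        rw [map_zero f] at this
        rw [this]; simp
      map_add' := fun a b => by
        obtain ⟨a, rfl⟩ := hf a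
        obtain ⟨b, rfl⟩ := hf b
        rw [← map_add, key, key, key]; simp }
  have hpr : ∀ p m, pr p (f m) = f (grProj gr h p m) := key
  refine isInternal_of_proj _ pr ?_ ?_ ?_
  · rintro p _ ⟨m, hm, rfl⟩
    rw [hpr, grProj_of_mem gr h hm]
  · rintro p q hpq _ ⟨m, hm, rfl⟩
    rw [hpr, grProj_of_mem_ne gr h hpq hm, map_zero]
  · intro n
    obtain ⟨m, rfl⟩ := hf n
    refine gr_induction gr h (C := fun m => f m ∈ ⨆ p, (gr p).map f) m
      (by rw [map_zero]; exact zero_mem _)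
      (fun a b ha hb => by rw [map_add]; exact add_mem ha hb) ?_
    intro p m hm
    exact AddSubgroup.mem_iSup_of_mem p ⟨m, hm, rfl⟩

end Internal

/-! ### Finitely generated bigraded right modules -/

section GrMod

variable {A : Type} [Ring A] (𝒜 : ℤ × ℤ → AddSubgroup A)

/-- `𝒜` makes `A` a `ℤ²`-graded ring. -/
class IsBigraded : Prop where
  isInternal : DirectSum.IsInternal 𝒜
  one_mem : (1 : A) ∈ 𝒜 0
  mul_mem : ∀ {p q : ℤ × ℤ} {a b : A}, a ∈ 𝒜 p → b ∈ 𝒜 q → a * b ∈ 𝒜 (p + q)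

/-- A finitely generated bigraded right `A`-module `M = ⨁_{p ∈ ℤ²} M_p`. -/
structure GrMod where
  carrier : Type
  [addCommGroup : AddCommGroup carrier]
  [module : Module Aᵐᵒᵖ carrier]
  /-- the component of bidegree `p` -/
  gr : ℤ × ℤ → AddSubgroup carrier
  isInternal : DirectSum.IsInternal gr
  smul_mem : ∀ {p q : ℤ × ℤ} {a : A} {m : carrier}, a ∈ 𝒜 p → m ∈ gr q → op a • m ∈ gr (q + p)
  finite : Module.Finite Aᵐᵒᵖ carrier

attribute [instance] GrMod.addCommGroup GrMod.module GrMod.finite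

variable {𝒜}

namespace GrMod

/-- Morphisms: `A`-linear maps preserving the bidegree. -/
@[ext]
structure Hom (M N : GrMod 𝒜) where
  toLin : M.carrier →ₗ[Aᵐᵒᵖ] N.carrier
  map_gr : ∀ p, ∀ m ∈ M.gr p, toLin m ∈ N.gr p

instance : Category (GrMod 𝒜) where
  Hom := Hom
  id M := ⟨LinearMap.id, fun _ _ h => h⟩
  comp f g := ⟨g.toLin ∘ₗ f.toLin, fun p m h => g.map_gr p _ (f.map_gr p m h)⟩

/-- The underlying linear map of a morphism. -/
def lin {M N : GrMod 𝒜} (f : M ⟶ N) : M.carrier →ₗ[Aᵐᵒᵖ] N.carrier := Hom.toLin f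

theorem lin_mem {M N : GrMod 𝒜} (f : M ⟶ N) {p : ℤ × ℤ} {m : M.carrier} (h : m ∈ M.gr p) :
    lin f m ∈ N.gr p := Hom.map_gr f p m h

/-- A degree-preserving linear map as a morphism. -/
def mk' {M N : GrMod 𝒜} (f : M.carrier →ₗ[Aᵐᵒᵖ] N.carrier)
    (h : ∀ p, ∀ m ∈ M.gr p, f m ∈ N.gr p) : M ⟶ N := Hom.mk f h

@[simp] theorem lin_mk' {M N : GrMod 𝒜} (f : M.carrier →ₗ[Aᵐᵒᵖ] N.carrier)
    (h : ∀ p, ∀ m ∈ M.gr p, f m ∈ N.gr p) : lin (mk' f h) = f := rfl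
@[simp] theorem lin_id (M : GrMod 𝒜) : lin (𝟙 M) = LinearMap.id := rfl
@[simp] theorem lin_comp {M N P : GrMod 𝒜} (f : M ⟶ N) (g : N ⟶ P) :
    lin (f ≫ g) = lin g ∘ₗ lin f := rfl

theorem hom_ext {M N : GrMod 𝒜} {f g : M ⟶ N} (h : ∀ m, lin f m = lin g m) : f = g :=
  Hom.ext (LinearMap.ext h)

instance (M N : GrMod 𝒜) : Zero (M ⟶ N) := ⟨mk' 0 fun p _ _ => zero_mem (N.gr p)⟩
instance (M N : GrMod 𝒜) : Add (M ⟶ N) :=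
  ⟨fun f g => mk' (lin f + lin g) fun _ _ h => add_mem (lin_mem f h) (lin_mem g h)⟩
instance (M N : GrMod 𝒜) : Neg (M ⟶ N) :=
  ⟨fun f => mk' (-lin f) fun _ _ h => neg_mem (lin_mem f h)⟩

@[simp] theorem lin_zero {M N : GrMod 𝒜} : lin (0 : M ⟶ N) = 0 := rfl
@[simp] theorem lin_add {M N : GrMod 𝒜} (f g : M ⟶ N) : lin (f + g) = lin f + lin g := rfl
@[simp] theorem lin_neg {M N : GrMod 𝒜} (f : M ⟶ N) : lin (-f) = -lin f := rfl

instance (M N : GrMod 𝒜) : AddCommGroup (M ⟶ N) where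
  add_assoc a b c := hom_ext fun m => by simp [add_assoc]
  zero_add a := hom_ext fun m => by simp
  add_zero a := hom_ext fun m => by simp
  nsmul := nsmulRec
  zsmul := zsmulRec
  neg_add_cancel a := hom_ext fun m => by simp
  add_comm a b := hom_ext fun m => by simp [add_comm]

instance : Preadditive (GrMod 𝒜) where
  add_comp _ _ _ f g k := hom_ext fun m => by simp
  comp_add _ _ _ f g k := hom_ext fun m => by simp

/-- The projection onto the component of bidegree `p`. -/
noncomputable abbrev proj (M : GrMod 𝒜) (p : ℤ × ℤ) : M.carrier →+ M.carrier :=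
  grProj M.gr M.isInternal p

theorem lin_proj {M N : GrMod 𝒜} (f : M ⟶ N) (p : ℤ × ℤ) (m : M.carrier) :
    lin f (M.proj p m) = N.proj p (lin f m) := by
  have := map_grProj M.gr M.isInternal N.isInternal (lin f).toAddMonoidHom 0
    (fun p m hm => by rw [add_zero]; exact lin_mem f hm) p m
  rw [add_zero] at this
  exact this

/-- The quotient of a bigraded module by a homogeneous submodule. -/
def quot (M : GrMod 𝒜) (K : Submodule Aᵐᵒᵖ M.carrier)
    (hK : ∀ p, ∀ m ∈ K, M.proj p m ∈ K) : GrMod 𝒜 where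
  carrier := M.carrier ⧸ K
  gr p := (M.gr p).map K.mkQ.toAddMonoidHom
  isInternal := isInternal_map M.gr M.isInternal K.mkQ.toAddMonoidHom K.mkQ_surjective
    fun p m hm => by
      have hm' : K.mkQ m = 0 := hm
      change K.mkQ _ = 0
      rw [Submodule.mkQ_apply, Submodule.Quotient.mk_eq_zero] at hm' ⊢
      exact hK p m hm'
  smul_mem := by
    rintro p q a _ ha ⟨m, hm, rfl⟩
    exact ⟨op a • m, M.smul_mem ha hm, map_smul K.mkQ _ _⟩
  finite := inferInstance

/-- The projection to the quotient. -/
def quotπ (M : GrMod 𝒜) (K : Submodule Aᵐᵒᵖ M.carrier)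
    (hK : ∀ p, ∀ m ∈ K, M.proj p m ∈ K) : M ⟶ M.quot K hK :=
  mk' K.mkQ fun _ m hm => ⟨m, hm, rfl⟩

/-- The morphism from the quotient induced by a morphism that kills the submodule. -/
def quotDesc {M N : GrMod 𝒜} (K : Submodule Aᵐᵒᵖ M.carrier)
    (hK : ∀ p, ∀ m ∈ K, M.proj p m ∈ K) (f : M ⟶ N) (hf : ∀ m ∈ K, lin f m = 0) :
    M.quot K hK ⟶ N :=
  mk' (K.liftQ (lin f) hf) (by
    rintro p _ ⟨m, hm, rfl⟩
    exact lin_mem f hm)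

/-- The zero module. -/
def zero : GrMod 𝒜 where
  carrier := PUnit
  gr _ := ⊥
  isInternal := isInternal_of_proj _ (fun _ => 0) (fun _ _ _ => rfl) (fun _ _ _ _ _ => rfl)
    fun m => by
      have : m = 0 := rfl
      rw [this]; exact zero_mem _
  smul_mem _ _ := by simp
  finite := inferInstance

theorem isZero_iff {M : GrMod 𝒜} : IsZero M ↔ ∀ m : M.carrier, m = 0 := by
  constructor
  · intro h m
    have := (IsZero.iff_id_eq_zero M).1 h
    have h2 : lin (𝟙 M) m = lin (0 : M ⟶ M) m := by rw [this]
    simpa using h2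
  · intro h
    rw [IsZero.iff_id_eq_zero]
    exact hom_ext fun m => by rw [h (lin (𝟙 M) m), h (lin 0 m)]

instance : HasZeroObject (GrMod 𝒜) := ⟨zero, isZero_iff.2 fun _ => rfl⟩

/-- The direct sum of two bigraded modules. -/
def prod (M N : GrMod 𝒜) : GrMod 𝒜 where
  carrier := M.carrier × N.carrier
  gr p := (M.gr p).prod (N.gr p)
  isInternal := isInternal_of_proj _ (fun p => (M.proj p).prodMap (N.proj p))
    (by
      rintro p ⟨m, n⟩ ⟨hm, hn⟩
      exact Prod.ext (grProj_of_mem _ _ hm) (grProj_of_mem _ _ hn))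
    (by
      rintro p q hpq ⟨m, n⟩ ⟨hm, hn⟩
      exact Prod.ext (grProj_of_mem_ne _ _ hpq hm) (grProj_of_mem_ne _ _ hpq hn))
    (by
      rintro ⟨m, n⟩
      have : ((m, n) : M.carrier × N.carrier) = (m, 0) + (0, n) := by simp
      rw [this]
      refine add_mem ?_ ?_
      · refine gr_induction M.gr M.isInternal (C := fun m => ((m, 0) : M.carrier × N.carrier) ∈ _)
          m (zero_mem _) (fun a b ha hb => ?_) fun p m hm => ?_
        · simpa using add_mem ha hb
        · exact AddSubgroup.mem_iSup_of_mem p ⟨hm, zero_mem _⟩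
      · refine gr_induction N.gr N.isInternal (C := fun n => ((0, n) : M.carrier × N.carrier) ∈ _)
          n (zero_mem _) (fun a b ha hb => ?_) fun p m hm => ?_
        · simpa using add_mem ha hb
        · exact AddSubgroup.mem_iSup_of_mem p ⟨zero_mem _, hm⟩)
  smul_mem ha hm := ⟨M.smul_mem ha hm.1, N.smul_mem ha hm.2⟩
  finite := inferInstance

instance : HasBinaryBiproducts (GrMod 𝒜) where
  has_binary_biproduct M N := HasBinaryBiproduct.mk
    { bicone :=
        { pt := prod M N
          fst := mk' (LinearMap.fst _ _ _) fun _ _ h => h.1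
          snd := mk' (LinearMap.snd _ _ _) fun _ _ h => h.2
          inl := mk' (LinearMap.inl _ _ _) fun _ _ h => ⟨h, zero_mem _⟩
          inr := mk' (LinearMap.inr _ _ _) fun _ _ h => ⟨zero_mem _, h⟩
          inl_fst := hom_ext fun _ => rfl
          inl_snd := hom_ext fun _ => rfl
          inr_fst := hom_ext fun _ => rfl
          inr_snd := hom_ext fun _ => rfl }
      isBilimit := isBinaryBilimitOfTotal _ (hom_ext fun m =>
        Prod.ext (add_zero m.1) (zero_add m.2)) }

instance : HasFiniteProducts (GrMod 𝒜) :=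
  hasFiniteProducts_of_has_binary_and_terminal

/-- The cokernel of a morphism. -/
def coker {M N : GrMod 𝒜} (f : M ⟶ N) : GrMod 𝒜 :=
  N.quot (LinearMap.range (lin f)) (by
    rintro p _ ⟨m, rfl⟩
    exact ⟨M.proj p m, lin_proj f p m⟩)

/-- The projection to the cokernel. -/
def cokerπ {M N : GrMod 𝒜} (f : M ⟶ N) : N ⟶ coker f := N.quotπ _ _

theorem comp_cokerπ {M N : GrMod 𝒜} (f : M ⟶ N) : f ≫ cokerπ f = 0 :=
  hom_ext fun m => (Submodule.Quotient.mk_eq_zero _).2 ⟨m, rfl⟩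

theorem cokerπ_eq_zero {M N : GrMod 𝒜} (f : M ⟶ N) (n : N.carrier) :
    lin (cokerπ f) n = 0 ↔ ∃ m, lin f m = n :=
  Submodule.Quotient.mk_eq_zero _

theorem cokerπ_surjective {M N : GrMod 𝒜} (f : M ⟶ N) : Function.Surjective (lin (cokerπ f)) :=
  Submodule.mkQ_surjective _

/-- A surjective morphism is the cokernel of every morphism onto its kernel. -/
noncomputable def isColimitOfSurjective {M N P : GrMod 𝒜} (f : M ⟶ N) (g : N ⟶ P) (w : f ≫ g = 0)
    (hg : Function.Surjective (lin g)) (hk : ∀ n, lin g n = 0 → ∃ m, lin f m = n) :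
    IsColimit (CokernelCofork.ofπ g w) := by
  have ex : ∀ {Z : GrMod 𝒜} (k : N ⟶ Z) (_ : f ≫ k = 0), ∃ l : P ⟶ Z, g ≫ l = k := by
    intro Z k hfk
    have hker : LinearMap.ker (lin g) ≤ LinearMap.ker (lin k) := by
      intro n hn
      obtain ⟨m, rfl⟩ := hk n hn
      exact congrArg (fun φ => lin φ m) hfk
    obtain ⟨s, hs⟩ := hg.hasRightInverse
    have key : ∀ n, lin k (s (lin g n)) = lin k n := by
      intro n
      rw [← sub_eq_zero, ← map_sub]
      exact hker (by rw [LinearMap.mem_ker, map_sub, hs, sub_self])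
    let L : P.carrier →ₗ[Aᵐᵒᵖ] Z.carrier :=
      { toFun := fun p => lin k (s p)
        map_add' := fun a b => by
          obtain ⟨a, rfl⟩ := hg a
          obtain ⟨b, rfl⟩ := hg b
          rw [← map_add, key, key, key, map_add]
        map_smul' := fun r a => by
          obtain ⟨a, rfl⟩ := hg a
          rw [← map_smul, key, key, map_smul, RingHom.id_apply] }
    refine ⟨mk' L fun q p hp => ?_, hom_ext fun n => key n⟩
    obtain ⟨n, rfl⟩ := hg p
    change lin k (s (lin g n)) ∈ _
    have h1 : lin g (N.proj q n) = lin g n := by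
      rw [lin_proj]
      exact grProj_of_mem _ _ hp
    rw [← h1, key]
    exact lin_mem k (grProj_mem _ _ _ _)
  have epi : Epi g := ⟨fun a b hab => hom_ext fun p => by
    obtain ⟨n, rfl⟩ := hg p
    exact congrArg (fun φ => lin φ n) hab⟩
  exact CokernelCofork.IsColimit.ofπ g w (fun k hk => (ex k hk).choose)
    (fun k hk => (ex k hk).choose_spec) fun k hk m hm => by
      rw [← cancel_epi g, hm, (ex k hk).choose_spec]

instance : HasCokernels (GrMod 𝒜) where
  has_colimit f := ⟨⟨⟨_, isColimitOfSurjective f (cokerπ f) (comp_cokerπ f) (cokerπ_surjective f)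
    fun n h => (cokerπ_eq_zero f n).1 h⟩⟩⟩

theorem epi_iff {M N : GrMod 𝒜} (f : M ⟶ N) : Epi f ↔ Function.Surjective (lin f) := by
  constructor
  · intro _ n
    have h : cokerπ f = 0 := by rw [← cancel_epi f, comp_cokerπ, comp_zero]
    exact (cokerπ_eq_zero f n).1 (by rw [h]; rfl)
  · intro hf
    exact ⟨fun a b hab => hom_ext fun p => by
      obtain ⟨n, rfl⟩ := hf p
      exact congrArg (fun φ => lin φ n) hab⟩

theorem exists_lift {K M Z : GrMod 𝒜} (i : K ⟶ M) (hi : Function.Injective (lin i)) (k : Z ⟶ M)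
    (hk : ∀ z, ∃ x, lin i x = lin k z) : ∃ l : Z ⟶ K, l ≫ i = k := by
  choose s hs using hk
  let L : Z.carrier →ₗ[Aᵐᵒᵖ] K.carrier :=
    { toFun := s
      map_add' := fun a b => hi (by rw [map_add, hs, hs, hs, map_add])
      map_smul' := fun r a => hi (by rw [RingHom.id_apply, map_smul, hs, hs, map_smul]) }
  refine ⟨mk' L fun q z hz => ?_, hom_ext hs⟩
  have : K.proj q (s z) = s z := hi (by
    rw [lin_proj, hs]
    exact grProj_of_mem _ _ (lin_mem k hz))
  change s z ∈ _
  rw [← this]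
  exact grProj_mem _ _ _ _

/-- An injective morphism is the kernel of every morphism whose kernel is its image. -/
noncomputable def isLimitOfInjective {K M N : GrMod 𝒜} (i : K ⟶ M) (f : M ⟶ N) (w : i ≫ f = 0)
    (hi : Function.Injective (lin i)) (hf : ∀ m, lin f m = 0 → ∃ x, lin i x = m) :
    IsLimit (KernelFork.ofι i w) := by
  have ex : ∀ {Z : GrMod 𝒜} (k : Z ⟶ M) (_ : k ≫ f = 0), ∃ l : Z ⟶ K, l ≫ i = k :=
    fun k hk => exists_lift i hi k fun z => hf _ (congrArg (fun φ => lin φ z) hk)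
  have mono : Mono i := ⟨fun a b hab => hom_ext fun p => hi (congrArg (fun φ => lin φ p) hab)⟩
  exact KernelFork.IsLimit.ofι i w (fun k hk => (ex k hk).choose)
    (fun k hk => (ex k hk).choose_spec) fun k hk m hm => by
      rw [← cancel_mono i, hm, (ex k hk).choose_spec]

/-- Torsion modules: `M_{i,j} = 0` for all `i > i₀`, `j > j₀`, for some `(i₀, j₀)`. -/
def tor : ObjectProperty (GrMod 𝒜) := fun M =>
  ∃ i₀ j₀ : ℤ, ∀ i j : ℤ, i₀ < i → j₀ < j → M.gr (i, j) = ⊥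

theorem tor_iff (M : GrMod 𝒜) : tor M ↔
    ∃ i₀ j₀ : ℤ, ∀ i j : ℤ, i₀ < i → j₀ < j → ∀ m ∈ M.gr (i, j), m = 0 := by
  simp only [tor, AddSubgroup.eq_bot_iff_forall]

variable [IsNoetherianRing Aᵐᵒᵖ]

/-- The kernel of a morphism; it is finitely generated as `A` is right noetherian. -/
def ker {M N : GrMod 𝒜} (f : M ⟶ N) : GrMod 𝒜 where
  carrier := LinearMap.ker (lin f)
  gr p := (M.gr p).comap (LinearMap.ker (lin f)).subtype.toAddMonoidHom
  isInternal := by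
    have hp : ∀ p, ∀ m ∈ LinearMap.ker (lin f), M.proj p m ∈ LinearMap.ker (lin f) := by
      intro p m hm
      rw [LinearMap.mem_ker] at hm ⊢
      rw [lin_proj, hm, map_zero]
    refine isInternal_of_proj _ (fun p =>
      { toFun := fun m => ⟨M.proj p m.1, hp p m.1 m.2⟩
        map_zero' := Subtype.ext (map_zero (M.proj p))
        map_add' := fun a b => Subtype.ext (map_add (M.proj p) a.1 b.1) }) ?_ ?_ ?_
    · intro p m hm
      exact Subtype.ext (grProj_of_mem M.gr M.isInternal hm)
    · intro p q hpq m hm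
      exact Subtype.ext (grProj_of_mem_ne M.gr M.isInternal hpq hm)
    · rintro ⟨m, hm⟩
      obtain ⟨s, hs, -⟩ := eq_sum_grProj M.gr M.isInternal m
      have : (⟨m, hm⟩ : LinearMap.ker (lin f)) = ∑ p ∈ s, ⟨M.proj p m, hp p m hm⟩ := by
        refine Subtype.ext ?_
        rw [AddSubmonoidClass.coe_finsetSum]
        exact hs
      rw [this]
      exact sum_mem fun p _ => AddSubgroup.mem_iSup_of_mem p (grProj_mem M.gr M.isInternal p m)
  smul_mem ha hm := M.smul_mem ha hm
  finite := Module.Finite.of_fg (IsNoetherian.noetherian _)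

/-- The inclusion of the kernel. -/
def kerι {M N : GrMod 𝒜} (f : M ⟶ N) : ker f ⟶ M :=
  mk' (LinearMap.ker (lin f)).subtype fun _ _ h => h

theorem kerι_comp {M N : GrMod 𝒜} (f : M ⟶ N) : kerι f ≫ f = 0 := hom_ext fun m => m.2

theorem kerι_injective {M N : GrMod 𝒜} (f : M ⟶ N) : Function.Injective (lin (kerι f)) :=
  Subtype.val_injective

theorem exists_kerι {M N : GrMod 𝒜} (f : M ⟶ N) (m : M.carrier) (h : lin f m = 0) :
    ∃ k, lin (kerι f) k = m := ⟨⟨m, h⟩, rfl⟩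

instance : HasKernels (GrMod 𝒜) where
  has_limit f := ⟨⟨⟨_, isLimitOfInjective (kerι f) f (kerι_comp f) (kerι_injective f)
    fun m h => exists_kerι f m h⟩⟩⟩

theorem mono_iff {M N : GrMod 𝒜} (f : M ⟶ N) : Mono f ↔ Function.Injective (lin f) := by
  constructor
  · intro _
    have h : kerι f = 0 := by rw [← cancel_mono f, kerι_comp, zero_comp]
    rw [injective_iff_map_eq_zero]
    intro m hm
    obtain ⟨k, rfl⟩ := exists_kerι f m hm
    rw [h]; rfl
  · intro hi
    exact ⟨fun a b hab => hom_ext fun p => hi (congrArg (fun φ => lin φ p) hab)⟩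

noncomputable instance : Abelian (GrMod 𝒜) where
  normalMonoOfMono f _ := ⟨
    { Z := coker f
      g := cokerπ f
      w := comp_cokerπ f
      isLimit := isLimitOfInjective f (cokerπ f) (comp_cokerπ f) ((mono_iff f).1 inferInstance)
        fun n h => (cokerπ_eq_zero f n).1 h }⟩
  normalEpiOfEpi f _ := ⟨
    { W := ker f
      g := kerι f
      w := kerι_comp f
      isColimit := isColimitOfSurjective (kerι f) f (kerι_comp f) ((epi_iff f).1 inferInstance)
        fun m h => exists_kerι f m h }⟩

theorem exact_elem {S : ShortComplex (GrMod 𝒜)} (hS : S.Exact) (m : S.X₂.carrier)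
    (hm : lin S.g m = 0) : ∃ x, lin S.f x = m := by
  obtain ⟨A', π, hπ, x₁, h⟩ := hS.exact_up_to_refinements (kerι S.g) (kerι_comp S.g)
  rw [epi_iff] at hπ
  obtain ⟨k, rfl⟩ := exists_kerι S.g m hm
  obtain ⟨a, rfl⟩ := hπ k
  exact ⟨lin x₁ a, (congrArg (fun φ => lin φ a) h).symm⟩

/-- Torsion modules form a Serre subcategory. -/
instance : (tor (𝒜 := 𝒜)).IsSerreClass where
  exists_zero := ⟨zero, isZero_iff.2 fun _ => rfl, 0, 0, fun _ _ _ _ => rfl⟩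
  prop_of_mono {X Y} f hf hY := by
    rw [tor_iff] at hY ⊢
    obtain ⟨i₀, j₀, h⟩ := hY
    refine ⟨i₀, j₀, fun i j hi hj m hm => (mono_iff f).1 hf ?_⟩
    rw [h i j hi hj _ (lin_mem f hm), map_zero]
  prop_of_epi {X Y} f hf hX := by
    rw [tor_iff] at hX ⊢
    obtain ⟨i₀, j₀, h⟩ := hX
    refine ⟨i₀, j₀, fun i j hi hj n hn => ?_⟩
    obtain ⟨m, rfl⟩ := (epi_iff f).1 hf n
    have h1 : lin f (X.proj (i, j) m) = lin f m := by
      rw [lin_proj]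
      exact grProj_of_mem _ _ hn
    rw [← h1, h i j hi hj _ (grProj_mem _ _ _ _), map_zero]
  prop_X₂_of_shortExact {S} hS h₁ h₃ := by
    rw [tor_iff] at h₁ h₃ ⊢
    obtain ⟨i₁, j₁, h₁⟩ := h₁
    obtain ⟨i₃, j₃, h₃⟩ := h₃
    refine ⟨max i₁ i₃, max j₁ j₃, fun i j hi hj m hm => ?_⟩
    rw [max_lt_iff] at hi hj
    obtain ⟨x, rfl⟩ := exact_elem hS.exact m (h₃ i j hi.2 hj.2 _ (lin_mem S.g hm))
    have h2 : lin S.f (S.X₁.proj (i, j) x) = lin S.f x := by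
      rw [lin_proj]
      exact grProj_of_mem _ _ hm
    rw [← h2, h₁ i j hi.1 hj.1 _ (grProj_mem _ _ _ _), map_zero]

/-- The morphisms whose kernel and cokernel are torsion, in terms of elements. -/
theorem isoModTor_iff {M N : GrMod 𝒜} (f : M ⟶ N) : (tor (𝒜 := 𝒜)).isoModSerre f ↔
    (∃ i₀ j₀ : ℤ, ∀ i j : ℤ, i₀ < i → j₀ < j → ∀ m ∈ M.gr (i, j), lin f m = 0 → m = 0) ∧
    (∃ i₀ j₀ : ℤ, ∀ i j : ℤ, i₀ < i → j₀ < j → ∀ n ∈ N.gr (i, j), ∃ m, lin f m = n) := by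
  have e1 : kernel f ≅ ker f := limit.isoLimitCone ⟨_, isLimitOfInjective (kerι f) f (kerι_comp f)
    (kerι_injective f) fun m h => exists_kerι f m h⟩
  have e2 : cokernel f ≅ coker f := colimit.isoColimitCocone ⟨_, isColimitOfSurjective f (cokerπ f)
    (comp_cokerπ f) (cokerπ_surjective f) fun n h => (cokerπ_eq_zero f n).1 h⟩
  rw [ObjectProperty.isoModSerre_iff, ObjectProperty.monoModSerre_iff,
    ObjectProperty.epiModSerre_iff, tor.prop_iff_of_iso e1, tor.prop_iff_of_iso e2, tor_iff,
    tor_iff]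
  refine and_congr ?_ ?_
  · refine exists_congr fun i₀ => exists_congr fun j₀ => forall_congr' fun i => forall_congr' fun j =>
      forall_congr' fun _ => forall_congr' fun _ => ?_
    constructor
    · intro h m hm h0
      exact congrArg Subtype.val (h ⟨m, h0⟩ hm)
    · rintro h ⟨m, h0⟩ hm
      exact Subtype.ext (h m hm h0)
  · refine exists_congr fun i₀ => exists_congr fun j₀ => forall_congr' fun i => forall_congr' fun j =>
      forall_congr' fun _ => forall_congr' fun _ => ?_
    constructor
    · intro h n hn
      exact (cokerπ_eq_zero f n).1 (h _ (lin_mem (cokerπ f) hn))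
    · rintro h _ ⟨n, hn, rfl⟩
      exact (cokerπ_eq_zero f n).2 (h n hn)

end GrMod

/-- The quotient category `qgr²(A) = gr²(A) / tor²(A)`. -/
abbrev QGr (𝒜 : ℤ × ℤ → AddSubgroup A) [IsNoetherianRing Aᵐᵒᵖ] :=
  (GrMod.tor (𝒜 := 𝒜)).isoModSerre.Localization

/-- The projection `π : gr²(A) ⥤ qgr²(A)`. -/
abbrev QGr.π (𝒜 : ℤ × ℤ → AddSubgroup A) [IsNoetherianRing Aᵐᵒᵖ] : GrMod 𝒜 ⥤ QGr 𝒜 :=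
  (GrMod.tor (𝒜 := 𝒜)).isoModSerre.Q

/-! ### Free bigraded modules -/

namespace GrMod

variable (𝒜) in
/-- The free module `⨁_k A(-d_k)`. -/
def free [IsBigraded 𝒜] {n : ℕ} (d : Fin n → ℤ × ℤ) : GrMod 𝒜 where
  carrier := Fin n → A
  gr p :=
    { carrier := {v | ∀ k, v k ∈ 𝒜 (p - d k)}
      zero_mem' := fun _ => zero_mem _
      add_mem' := fun ha hb k => add_mem (ha k) (hb k)
      neg_mem' := fun ha k => neg_mem (ha k) }
  isInternal := by
    have hA : DirectSum.IsInternal 𝒜 := IsBigraded.isInternal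
    refine isInternal_of_proj _ (fun p =>
      { toFun := fun v k => grProj 𝒜 hA (p - d k) (v k)
        map_zero' := funext fun k => map_zero _
        map_add' := fun a b => funext fun k => map_add _ _ _ }) ?_ ?_ ?_
    · intro p v hv
      exact funext fun k => grProj_of_mem 𝒜 hA (hv k)
    · intro p q hpq v hv
      exact funext fun k => grProj_of_mem_ne 𝒜 hA (fun e => hpq (sub_left_injective e)) (hv k)
    · intro v
      rw [← Finset.univ_sum_single v]
      refine sum_mem fun k _ => ?_
      refine gr_induction 𝒜 hA (C := fun a => (Pi.single k a : Fin n → A) ∈ _) (v k) ?_ ?_ ?_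
      · rw [Pi.single_zero]; exact zero_mem _
      · intro a b ha hb
        rw [Pi.single_add]; exact add_mem ha hb
      · intro p a ha
        refine AddSubgroup.mem_iSup_of_mem (p + d k) fun l => ?_
        by_cases h : l = k
        · subst h
          simpa using ha
        · rw [Pi.single_eq_of_ne h]; exact zero_mem _
  smul_mem {p q a v} ha hv k := by
    have := IsBigraded.mul_mem (hv k) ha
    rwa [show q - d k + p = q + p - d k by abel] at this
  finite := by
    have : Module.Finite Aᵐᵒᵖ A := by
      refine ⟨{1}, ?_⟩
      rw [eq_top_iff]
      intro a _
      rw [Finset.coe_singleton, Submodule.mem_span_singleton]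
      exact ⟨op a, one_mul a⟩
    infer_instance

variable [IsBigraded 𝒜]

/-- The linear map out of a free module with prescribed values on the generators. -/
def freeLin {n : ℕ} {M : Type} [AddCommGroup M] [Module Aᵐᵒᵖ M] (x : Fin n → M) :
    (Fin n → A) →ₗ[Aᵐᵒᵖ] M where
  toFun v := ∑ k, op (v k) • x k
  map_add' a b := by
    rw [← Finset.sum_add_distrib]
    exact Finset.sum_congr rfl fun k _ => add_smul _ _ _
  map_smul' r a := by
    rw [RingHom.id_apply, Finset.smul_sum]
    exact Finset.sum_congr rfl fun k _ => mul_smul r _ _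

/-- The morphism out of a free module with prescribed values on the generators. -/
def freeDesc {n : ℕ} {d : Fin n → ℤ × ℤ} {M : GrMod 𝒜} (x : Fin n → M.carrier)
    (hx : ∀ k, x k ∈ M.gr (d k)) : free 𝒜 d ⟶ M :=
  mk' (M := free 𝒜 d) (freeLin x) fun p v hv => by
    change ∑ k, op ((v : Fin n → A) k) • x k ∈ M.gr p
    refine sum_mem fun k _ => ?_
    have := M.smul_mem (hv k) (hx k)
    rwa [show d k + (p - d k) = p by abel] at this

/-- The generators of a free module. -/
def freeGen {n : ℕ} (d : Fin n → ℤ × ℤ) (k : Fin n) : (free 𝒜 d).carrier :=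
  (Pi.single k 1 : Fin n → A)

theorem freeGen_mem {n : ℕ} (d : Fin n → ℤ × ℤ) (k : Fin n) :
    freeGen d k ∈ (free 𝒜 d).gr (d k) := by
  intro l
  change (Pi.single k 1 : Fin n → A) l ∈ _
  by_cases h : l = k
  · subst h
    rw [Pi.single_eq_same, sub_self]; exact IsBigraded.one_mem
  · rw [Pi.single_eq_of_ne h]; exact zero_mem _

theorem freeDesc_gen {n : ℕ} {d : Fin n → ℤ × ℤ} {M : GrMod 𝒜} (x : Fin n → M.carrier)
    (hx : ∀ k, x k ∈ M.gr (d k)) (k : Fin n) : lin (freeDesc x hx) (freeGen d k) = x k := by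
  change ∑ l, op ((Pi.single k 1 : Fin n → A) l) • x l = x k
  rw [Finset.sum_eq_single k]
  · rw [Pi.single_eq_same, op_one, one_smul]
  · intro l _ hl
    rw [Pi.single_eq_of_ne hl, MulOpposite.op_zero, zero_smul]
  · intro h
    exact absurd (Finset.mem_univ k) h

theorem free_hom_ext {n : ℕ} {d : Fin n → ℤ × ℤ} {M : GrMod 𝒜} {f g : free 𝒜 d ⟶ M}
    (h : ∀ k, lin f (freeGen d k) = lin g (freeGen d k)) : f = g := by
  refine hom_ext fun v => ?_
  have hv : v = ∑ k, op ((v : Fin n → A) k) • freeGen (𝒜 := 𝒜) d k := by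
    change (v : Fin n → A) = ∑ k, op ((v : Fin n → A) k) • (Pi.single k 1 : Fin n → A)
    conv_lhs => rw [← Finset.univ_sum_single (v : Fin n → A)]
    refine Finset.sum_congr rfl fun k _ => ?_
    rw [← Pi.single_smul', op_smul_eq_mul, one_mul]
  rw [hv, map_sum, map_sum]
  exact Finset.sum_congr rfl fun k _ => by rw [map_smul, map_smul, h]

variable [IsNoetherianRing Aᵐᵒᵖ]

instance {n : ℕ} (d : Fin n → ℤ × ℤ) : Projective (free 𝒜 d) where
  factors {E X} f e he := by
    rw [epi_iff] at he
    choose s hs using he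
    refine ⟨freeDesc (fun k => E.proj (d k) (s (lin f (freeGen d k)))) fun k =>
      grProj_mem _ _ _ _, free_hom_ext fun k => ?_⟩
    rw [lin_comp, LinearMap.comp_apply, freeDesc_gen, lin_proj, hs]
    exact grProj_of_mem _ _ (lin_mem f (freeGen_mem d k))

instance : EnoughProjectives (GrMod 𝒜) where
  presentation M := by
    classical
    obtain ⟨S, hS⟩ := M.finite
    choose t ht _ using fun m => eq_sum_grProj M.gr M.isInternal m
    let T : Finset (M.carrier × (ℤ × ℤ)) := S.biUnion fun m => (t m).image fun p => (m, p)
    let e := T.equivFin.symm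
    let d : Fin T.card → ℤ × ℤ := fun k => (e k).1.2
    let x : Fin T.card → M.carrier := fun k => M.proj (e k).1.2 (e k).1.1
    have hx : ∀ k, x k ∈ M.gr (d k) := fun k => grProj_mem _ _ _ _
    refine ⟨{ p := free 𝒜 d, f := freeDesc x hx, epi := ?_ }⟩
    refine (epi_iff _).2 (LinearMap.range_eq_top.1 ?_)
    rw [eq_top_iff, ← hS, Submodule.span_le]
    intro m hm
    rw [ht m]
    refine sum_mem fun p hp => ?_
    have hT : (m, p) ∈ T := Finset.mem_biUnion.2 ⟨m, hm, Finset.mem_image.2 ⟨p, hp, rfl⟩⟩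
    refine ⟨freeGen d (T.equivFin ⟨_, hT⟩), ?_⟩
    rw [freeDesc_gen]
    change M.proj (e _).1.2 (e _).1.1 = _
    simp [e]

end GrMod
end GrMod

/-! ### A Hilbert basis theorem -/

section Noetherian

variable {T R : Type} [Ring T] [Ring R] (φ : R →+* T) (t : T)

/-- The elements `∑_{i < n} tⁱ rᵢ`. -/
def lowDeg (n : ℕ) : AddSubgroup T :=
  AddSubgroup.closure {s | ∃ i < n, ∃ r, s = t ^ i * φ r}

theorem mem_lowDeg {i n : ℕ} (h : i < n) (r : R) : t ^ i * φ r ∈ lowDeg φ t n :=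
  AddSubgroup.subset_closure ⟨i, h, r, rfl⟩

theorem lowDeg_induction {n : ℕ} {C : T → Prop} (h0 : C 0) (hadd : ∀ a b, C a → C b → C (a + b))
    (hneg : ∀ a, C a → C (-a)) (hm : ∀ i < n, ∀ r, C (t ^ i * φ r)) (s : T)
    (hs : s ∈ lowDeg φ t n) : C s := by
  induction hs using AddSubgroup.closure_induction with
  | mem x hx => obtain ⟨i, hi, r, rfl⟩ := hx; exact hm i hi r
  | zero => exact h0
  | add x y _ _ hx hy => exact hadd _ _ hx hy
  | neg x _ hx => exact hneg _ hx

theorem lowDeg_mono {n k : ℕ} (h : n ≤ k) : lowDeg φ t n ≤ lowDeg φ t k :=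
  AddSubgroup.closure_mono fun _ ⟨i, hi, r, e⟩ => ⟨i, hi.trans_le h, r, e⟩

theorem lowDeg_mul_right {n : ℕ} {s : T} (hs : s ∈ lowDeg φ t n) (r : R) :
    s * φ r ∈ lowDeg φ t n := by
  refine lowDeg_induction φ t (C := fun s => s * φ r ∈ lowDeg φ t n) (by simp)
    (fun a b ha hb => by rw [add_mul]; exact add_mem ha hb)
    (fun a ha => by rw [neg_mul]; exact neg_mem ha) (fun i hi r' => ?_) s hs
  rw [mul_assoc, ← map_mul]
  exact mem_lowDeg φ t hi _

theorem lowDeg_t_mul {n : ℕ} {s : T} (hs : s ∈ lowDeg φ t n) : t * s ∈ lowDeg φ t (n + 1) := by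
  refine lowDeg_induction φ t (C := fun s => t * s ∈ lowDeg φ t (n + 1)) (by simp)
    (fun a b ha hb => by rw [mul_add]; exact add_mem ha hb)
    (fun a ha => by rw [mul_neg]; exact neg_mem ha) (fun i hi r' => ?_) s hs
  rw [← mul_assoc, ← pow_succ']
  exact mem_lowDeg φ t (Nat.succ_lt_succ hi) _

theorem lowDeg_mul_t (H1 : ∀ r, ∃ r' s, φ r * t = t * φ r' + φ s) {n : ℕ} {s : T}
    (hs : s ∈ lowDeg φ t n) : s * t ∈ lowDeg φ t (n + 1) := by
  refine lowDeg_induction φ t (C := fun s => s * t ∈ lowDeg φ t (n + 1)) (by simp)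
    (fun a b ha hb => by rw [add_mul]; exact add_mem ha hb)
    (fun a ha => by rw [neg_mul]; exact neg_mem ha) (fun i hi r => ?_) s hs
  obtain ⟨r', s', e⟩ := H1 r
  rw [mul_assoc, e, mul_add, ← mul_assoc, ← pow_succ]
  exact add_mem (mem_lowDeg φ t (by omega) _) (mem_lowDeg φ t (by omega) _)

theorem mul_pow_mem_lowDeg (H1 : ∀ r, ∃ r' s, φ r * t = t * φ r' + φ s) (a : R) (i : ℕ) :
    φ a * t ^ i ∈ lowDeg φ t (i + 1) := by
  induction i with
  | zero =>
    have := mem_lowDeg φ t (i := 0) (n := 1) (by omega) a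
    simpa using this
  | succ i ih => rw [pow_succ, ← mul_assoc]; exact lowDeg_mul_t φ t H1 ih

theorem lowDeg_mul_left (H1 : ∀ r, ∃ r' s, φ r * t = t * φ r' + φ s) (a : R) {n : ℕ} {s : T}
    (hs : s ∈ lowDeg φ t n) : φ a * s ∈ lowDeg φ t n := by
  refine lowDeg_induction φ t (C := fun s => φ a * s ∈ lowDeg φ t n) (by simp)
    (fun a b ha hb => by rw [mul_add]; exact add_mem ha hb)
    (fun a ha => by rw [mul_neg]; exact neg_mem ha) (fun i hi r => ?_) s hs
  rw [← mul_assoc]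
  exact lowDeg_mul_right φ t (lowDeg_mono φ t (by omega) (mul_pow_mem_lowDeg φ t H1 a i)) r

theorem exists_comm_pow (H1 : ∀ r, ∃ r' s, φ r * t = t * φ r' + φ s)
    (H2 : ∀ r, ∃ r' s, t * φ r = φ r' * t + φ s) (n : ℕ) :
    ∀ a, ∃ b, φ b * t ^ n - t ^ n * φ a ∈ lowDeg φ t n := by
  induction n with
  | zero => exact fun a => ⟨a, by simp⟩
  | succ n ih =>
    intro a
    obtain ⟨b₁, s, e⟩ := H2 a
    obtain ⟨b, hb⟩ := ih b₁
    refine ⟨b, ?_⟩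
    have : φ b * t ^ (n + 1) - t ^ (n + 1) * φ a
        = (φ b * t ^ n - t ^ n * φ b₁) * t - t ^ n * φ s := by
      rw [pow_succ, mul_assoc (t ^ n), e]
      noncomm_ring
    rw [this]
    exact sub_mem (lowDeg_mul_t φ t H1 hb) (mem_lowDeg φ t (by omega) _)

theorem lowDeg_succ {n : ℕ} (s : T) (hs : s ∈ lowDeg φ t (n + 1)) :
    ∃ r, ∃ f ∈ lowDeg φ t n, s = t ^ n * φ r + f := by
  refine lowDeg_induction φ t (C := fun s => ∃ r, ∃ f ∈ lowDeg φ t n, s = t ^ n * φ r + f)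
    ⟨0, 0, zero_mem _, by simp⟩ ?_ ?_ ?_ s hs
  · rintro _ _ ⟨r, f, hf, rfl⟩ ⟨r', f', hf', rfl⟩
    exact ⟨r + r', f + f', add_mem hf hf', by rw [map_add, mul_add]; abel⟩
  · rintro _ ⟨r, f, hf, rfl⟩
    exact ⟨-r, -f, neg_mem hf, by rw [map_neg, mul_neg]; abel⟩
  · intro i hi r
    by_cases h : i = n
    · subst h
      exact ⟨r, 0, zero_mem _, by rw [add_zero]⟩
    · exact ⟨0, _, mem_lowDeg φ t (i := i) (by omega) r, by simp⟩

/-- The ideal of leading coefficients of the elements of degree at most `n` of a left ideal. -/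
def leadCoeff (H1 : ∀ r, ∃ r' s, φ r * t = t * φ r' + φ s)
    (H2 : ∀ r, ∃ r' s, t * φ r = φ r' * t + φ s) (I : Ideal T) (n : ℕ) : Ideal R where
  carrier := {r | ∃ f ∈ lowDeg φ t n, t ^ n * φ r + f ∈ I}
  zero_mem' := ⟨0, zero_mem _, by simp⟩
  add_mem' := by
    rintro r r' ⟨f, hf, h⟩ ⟨f', hf', h'⟩
    refine ⟨f + f', add_mem hf hf', ?_⟩
    have := add_mem h h'
    rwa [show t ^ n * φ r + f + (t ^ n * φ r' + f') = t ^ n * φ (r + r') + (f + f') by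
      rw [map_add, mul_add]; abel] at this
  smul_mem' := by
    rintro a r ⟨f, hf, h⟩
    obtain ⟨b, hb⟩ := exists_comm_pow φ t H1 H2 n a
    refine ⟨(φ b * t ^ n - t ^ n * φ a) * φ r + φ b * f,
      add_mem (lowDeg_mul_right φ t hb r) (lowDeg_mul_left φ t H1 b hf), ?_⟩
    have := I.mul_mem_left (φ b) h
    rwa [show φ b * (t ^ n * φ r + f) = t ^ n * φ (a • r)
      + ((φ b * t ^ n - t ^ n * φ a) * φ r + φ b * f) by
        rw [smul_eq_mul, map_mul]; noncomm_ring] at this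

/-- If `T = ∑ tⁱ R` with `R` left noetherian and `R + tR = R + Rt`, then `T` is left
noetherian. -/
theorem isNoetherianRing_of_extension [IsNoetherianRing R]
    (H1 : ∀ r, ∃ r' s, φ r * t = t * φ r' + φ s)
    (H2 : ∀ r, ∃ r' s, t * φ r = φ r' * t + φ s)
    (hgen : ∀ s, ∃ n, s ∈ lowDeg φ t n) : IsNoetherianRing T := by
  classical
  have mono : ∀ I : Ideal T, Monotone (leadCoeff φ t H1 H2 I) := by
    intro I
    refine monotone_nat_of_le_succ fun n r => ?_
    rintro ⟨f, hf, h⟩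
    refine ⟨t * f, lowDeg_t_mul φ t hf, ?_⟩
    have := I.mul_mem_left t h
    rwa [mul_add, ← mul_assoc, ← pow_succ'] at this
  rw [isNoetherianRing_iff_ideal_fg]
  intro I
  obtain ⟨N, hN⟩ := monotone_stabilizes_iff_noetherian.2 (inferInstance : IsNoetherian R R)
    ⟨leadCoeff φ t H1 H2 I, mono I⟩
  have fg : ∀ n, ∃ S : Finset R, Ideal.span (S : Set R) = leadCoeff φ t H1 H2 I n := fun n =>
    (isNoetherianRing_iff_ideal_fg R).1 inferInstance _
  choose S hS using fg
  have lift : ∀ n r, ∃ x ∈ I, r ∈ S n → ∃ f ∈ lowDeg φ t n, x = t ^ n * φ r + f := by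
    intro n r
    by_cases hr : r ∈ S n
    · have : r ∈ leadCoeff φ t H1 H2 I n := by rw [← hS]; exact Ideal.subset_span hr
      obtain ⟨f, hf, h⟩ := this
      exact ⟨_, h, fun _ => ⟨f, hf, rfl⟩⟩
    · exact ⟨0, zero_mem _, fun h => absurd h hr⟩
  choose x hxI hx using lift
  let G : Finset T := (Finset.range (N + 1)).biUnion fun n => (S n).image (x n)
  refine ⟨G, le_antisymm ?_ ?_⟩
  · rw [Ideal.span_le]
    intro y hy
    obtain ⟨n, -, hy⟩ := Finset.mem_biUnion.1 hy
    obtain ⟨r, -, rfl⟩ := Finset.mem_image.1 hy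
    exact hxI n r
  · set J := Ideal.span (G : Set T) with hJ
    have hJI : J ≤ I := by
      rw [hJ, Ideal.span_le]
      intro y hy
      obtain ⟨n, -, hy⟩ := Finset.mem_biUnion.1 hy
      obtain ⟨r, -, rfl⟩ := Finset.mem_image.1 hy
      exact hxI n r
    have le1 : ∀ n ≤ N, leadCoeff φ t H1 H2 I n ≤ leadCoeff φ t H1 H2 J n := by
      intro n hn
      rw [← hS, Ideal.span_le]
      intro r hr
      obtain ⟨f, hf, e⟩ := hx n r hr
      refine ⟨f, hf, ?_⟩
      rw [← e]
      exact Ideal.subset_span (Finset.mem_biUnion.2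
        ⟨n, Finset.mem_range.2 (by omega), Finset.mem_image.2 ⟨r, hr, rfl⟩⟩)
    have le2 : ∀ n, leadCoeff φ t H1 H2 I n ≤ leadCoeff φ t H1 H2 J n := by
      intro n
      by_cases hn : n ≤ N
      · exact le1 n hn
      · have h1 : leadCoeff φ t H1 H2 I N = leadCoeff φ t H1 H2 I n := hN n (by omega)
        rw [← h1]
        exact (le1 N le_rfl).trans (mono J (by omega))
    have main : ∀ n, ∀ s ∈ lowDeg φ t n, s ∈ I → s ∈ J := by
      intro n
      induction n with
      | zero =>
        intro s hs _
        have : s = 0 := lowDeg_induction φ t (C := fun s => s = 0) rfl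
          (fun a b ha hb => by rw [ha, hb, add_zero]) (fun a ha => by rw [ha, neg_zero])
          (fun i hi => absurd hi (Nat.not_lt_zero i)) s hs
        rw [this]; exact zero_mem _
      | succ n ih =>
        intro s hs hsI
        obtain ⟨r, f, hf, rfl⟩ := lowDeg_succ φ t s hs
        obtain ⟨f', hf', h'⟩ := le2 n (show r ∈ leadCoeff φ t H1 H2 I n from ⟨f, hf, hsI⟩)
        have h3 : f - f' ∈ I := by
          have := sub_mem hsI (hJI h')
          rwa [add_sub_add_left_eq_sub] at this
        have := add_mem h' (ih _ (sub_mem hf hf') h3)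
        rwa [show t ^ n * φ r + f' + (f - f') = t ^ n * φ r + f by abel] at this
    intro s hs
    obtain ⟨n, hn⟩ := hgen s
    exact main n s hn hs

open scoped IsMulCommutative

/-- An algebra generated by a finite set `S` of commuting elements together with the image of a
finite group that normalizes `S` up to scalars is left noetherian. -/
theorem isNoetherianRing_adjoin {T Γ : Type} [Ring T] [Algebra ℂ T] [Group Γ] [Finite Γ]
    (S : Set T) (hfin : S.Finite) (hS : ∀ a ∈ S, ∀ b ∈ S, a * b = b * a) (G : Γ →* T)
    (hG : ∀ γ, ∀ a ∈ S, ∃ c : ℂ, G γ * a = c • (a * G γ)) :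
    IsNoetherianRing (Algebra.adjoin ℂ (S ∪ Set.range G)) := by
  have hcomm : IsMulCommutative (Algebra.adjoin ℂ S) := Algebra.isMulCommutative_adjoin ℂ hS
  have hno : IsNoetherianRing (Algebra.adjoin ℂ S) := by
    have hft : Algebra.FiniteType ℂ (Algebra.adjoin ℂ S) :=
      (Subalgebra.fg_iff_finiteType _).1 (Subalgebra.fg_def.2 ⟨S, hfin, rfl⟩)
    exact Algebra.FiniteType.isNoetherianRing ℂ _
  set S₀ := Algebra.adjoin ℂ S
  set R := Algebra.adjoin ℂ (S ∪ Set.range G)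
  let P : Submodule S₀ T := Submodule.span S₀ (Set.range G)
  have hP : IsNoetherian S₀ P := isNoetherian_span_of_finite S₀ (Set.finite_range G)
  have hGS : ∀ γ, ∀ s ∈ S₀, ∃ s' ∈ S₀, G γ * s = s' * G γ := by
    intro γ s hs
    induction hs using Algebra.adjoin_induction with
    | mem a ha =>
      obtain ⟨c, hc⟩ := hG γ a ha
      exact ⟨c • a, Subalgebra.smul_mem _ (Algebra.subset_adjoin ha) c, by rw [hc, smul_mul_assoc]⟩
    | algebraMap c => exact ⟨_, Subalgebra.algebraMap_mem _ c, (Algebra.commutes c _).symm⟩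
    | add a b _ _ ha hb =>
      obtain ⟨a', ha', ea⟩ := ha
      obtain ⟨b', hb', eb⟩ := hb
      exact ⟨a' + b', add_mem ha' hb', by rw [mul_add, add_mul, ea, eb]⟩
    | mul a b _ _ ha hb =>
      obtain ⟨a', ha', ea⟩ := ha
      obtain ⟨b', hb', eb⟩ := hb
      exact ⟨a' * b', mul_mem ha' hb', by rw [← mul_assoc, ea, mul_assoc, eb, mul_assoc]⟩
  have hstep : ∀ r ∈ R, ∀ p ∈ P, r * p ∈ P := by
    intro r hr
    induction hr using Algebra.adjoin_induction with
    | mem a ha =>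
      intro p hp
      rcases ha with ha | ⟨γ, rfl⟩
      · exact P.smul_mem (⟨a, Algebra.subset_adjoin ha⟩ : S₀) hp
      · induction hp using Submodule.span_induction with
        | mem x hx =>
          obtain ⟨γ', rfl⟩ := hx
          rw [← map_mul]
          exact Submodule.subset_span ⟨_, rfl⟩
        | zero => rw [mul_zero]; exact zero_mem _
        | add x y _ _ hx hy => rw [mul_add]; exact add_mem hx hy
        | smul s x _ hx =>
          obtain ⟨s', hs', e⟩ := hGS γ s s.2
          have : G γ * (s • x) = (⟨s', hs'⟩ : S₀) • (G γ * x) := by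
            change G γ * ((s : T) * x) = s' * (G γ * x)
            rw [← mul_assoc, e, mul_assoc]
          rw [this]
          exact P.smul_mem _ hx
    | algebraMap c =>
      intro p hp
      exact P.smul_mem (algebraMap ℂ S₀ c) hp
    | add a b _ _ ha hb => intro p hp; rw [add_mul]; exact add_mem (ha p hp) (hb p hp)
    | mul a b _ _ ha hb => intro p hp; rw [mul_assoc]; exact ha _ (hb p hp)
  have hRP : ∀ r ∈ R, r ∈ P := by
    intro r hr
    have := hstep r hr 1 (Submodule.subset_span ⟨1, map_one G⟩)
    rwa [mul_one] at this
  have hSR : S₀ ≤ R := Algebra.adjoin_mono Set.subset_union_left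
  let _ : Module S₀ R := Module.compHom R (Subalgebra.inclusion hSR).toRingHom
  have htower : IsScalarTower S₀ R R := ⟨fun a b c => mul_assoc _ _ _⟩
  let j : R →ₗ[S₀] P :=
    { toFun := fun r => ⟨r, hRP r r.2⟩
      map_add' := fun _ _ => rfl
      map_smul' := fun _ _ => rfl }
  have hj : Function.Injective j := fun a b h => Subtype.ext (congrArg (fun p : P => (p : T)) h)
  have : IsNoetherian S₀ R := isNoetherian_of_injective j hj
  exact isNoetherian_of_tower S₀ this

end Noetherian

/-! ### The algebras `Q` and `B` -/

section Algebras

variable {Γ : Type} [CommGroup Γ]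

/-- The generators `x, z, y, w` and `γ ∈ Γ` of `Q`. -/
inductive QGen (Γ : Type) : Type
  | x | z | y | w
  | g (γ : Γ)

/-- The bidegrees of the generators. -/
def QGen.deg : QGen Γ → ℤ × ℤ
  | x => (1, 0)
  | z => (1, 0)
  | y => (0, 1)
  | w => (0, 1)
  | g _ => 0

/-- The defining relations of `Q`; the last one is `[y, x] = τ z w`. -/
inductive QRel (ε : Γ →* ℂˣ) (τ : MonoidAlgebra ℂ Γ) :
    FreeAlgebra ℂ (QGen Γ) → FreeAlgebra ℂ (QGen Γ) → Prop
  | one : QRel ε τ (FreeAlgebra.ι ℂ (QGen.g 1)) 1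
  | mul (γ δ : Γ) : QRel ε τ (FreeAlgebra.ι ℂ (QGen.g (γ * δ)))
      (FreeAlgebra.ι ℂ (QGen.g γ) * FreeAlgebra.ι ℂ (QGen.g δ))
  | gx (γ : Γ) : QRel ε τ (FreeAlgebra.ι ℂ (QGen.g γ) * FreeAlgebra.ι ℂ QGen.x)
      ((ε γ : ℂ) • (FreeAlgebra.ι ℂ QGen.x * FreeAlgebra.ι ℂ (QGen.g γ)))
  | gy (γ : Γ) : QRel ε τ (FreeAlgebra.ι ℂ (QGen.g γ) * FreeAlgebra.ι ℂ QGen.y)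
      (((ε γ)⁻¹ : ℂ) • (FreeAlgebra.ι ℂ QGen.y * FreeAlgebra.ι ℂ (QGen.g γ)))
  | gz (γ : Γ) : QRel ε τ (FreeAlgebra.ι ℂ (QGen.g γ) * FreeAlgebra.ι ℂ QGen.z)
      (FreeAlgebra.ι ℂ QGen.z * FreeAlgebra.ι ℂ (QGen.g γ))
  | gw (γ : Γ) : QRel ε τ (FreeAlgebra.ι ℂ (QGen.g γ) * FreeAlgebra.ι ℂ QGen.w)
      (FreeAlgebra.ι ℂ QGen.w * FreeAlgebra.ι ℂ (QGen.g γ))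
  | xz : QRel ε τ (FreeAlgebra.ι ℂ QGen.x * FreeAlgebra.ι ℂ QGen.z)
      (FreeAlgebra.ι ℂ QGen.z * FreeAlgebra.ι ℂ QGen.x)
  | yz : QRel ε τ (FreeAlgebra.ι ℂ QGen.y * FreeAlgebra.ι ℂ QGen.z)
      (FreeAlgebra.ι ℂ QGen.z * FreeAlgebra.ι ℂ QGen.y)
  | zw : QRel ε τ (FreeAlgebra.ι ℂ QGen.z * FreeAlgebra.ι ℂ QGen.w)
      (FreeAlgebra.ι ℂ QGen.w * FreeAlgebra.ι ℂ QGen.z)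
  | yw : QRel ε τ (FreeAlgebra.ι ℂ QGen.y * FreeAlgebra.ι ℂ QGen.w)
      (FreeAlgebra.ι ℂ QGen.w * FreeAlgebra.ι ℂ QGen.y)
  | xw : QRel ε τ (FreeAlgebra.ι ℂ QGen.x * FreeAlgebra.ι ℂ QGen.w)
      (FreeAlgebra.ι ℂ QGen.w * FreeAlgebra.ι ℂ QGen.x)
  | yx : QRel ε τ (FreeAlgebra.ι ℂ QGen.y * FreeAlgebra.ι ℂ QGen.x)
      (FreeAlgebra.ι ℂ QGen.x * FreeAlgebra.ι ℂ QGen.y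
        + (τ.coeff.sum fun γ c => c • FreeAlgebra.ι ℂ (QGen.g γ))
          * FreeAlgebra.ι ℂ QGen.z * FreeAlgebra.ι ℂ QGen.w)

/-- The bigraded algebra `Q`, the homogeneous coordinate ring of the noncommutative quadric. -/
def Q (ε : Γ →* ℂˣ) (τ : MonoidAlgebra ℂ Γ) : Type := RingQuot (QRel ε τ)

variable (ε : Γ →* ℂˣ) (τ : MonoidAlgebra ℂ Γ)

noncomputable instance : Ring (Q ε τ) := inferInstanceAs (Ring (RingQuot (QRel ε τ)))
noncomputable instance : Algebra ℂ (Q ε τ) := inferInstanceAs (Algebra ℂ (RingQuot (QRel ε τ)))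

namespace Q

/-- The quotient map from the free algebra. -/
noncomputable def mk : FreeAlgebra ℂ (QGen Γ) →ₐ[ℂ] Q ε τ := RingQuot.mkAlgHom ℂ (QRel ε τ)

theorem mk_rel {a b : FreeAlgebra ℂ (QGen Γ)} (h : QRel ε τ a b) : mk ε τ a = mk ε τ b :=
  RingQuot.mkAlgHom_rel ℂ h

theorem mk_surjective : Function.Surjective (mk ε τ) := RingQuot.mkAlgHom_surjective ℂ _

/-- The generators as elements of `Q`. -/
noncomputable def gen (a : QGen Γ) : Q ε τ := mk ε τ (FreeAlgebra.ι ℂ a)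

/-- The map `Γ → Q`. -/
noncomputable def grp : Γ →* Q ε τ where
  toFun γ := gen ε τ (QGen.g γ)
  map_one' := (mk_rel ε τ QRel.one).trans (map_one _)
  map_mul' γ δ := (mk_rel ε τ (QRel.mul γ δ)).trans (map_mul _ _ _)

/-- The map `ℂΓ → Q`. -/
noncomputable def incl : MonoidAlgebra ℂ Γ →ₐ[ℂ] Q ε τ := MonoidAlgebra.lift ℂ (Q ε τ) Γ (grp ε τ)

theorem induction {C : Q ε τ → Prop} (h0 : ∀ c : ℂ, C (algebraMap ℂ _ c))
    (h1 : ∀ a, C (gen ε τ a)) (hadd : ∀ a b, C a → C b → C (a + b))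
    (hmul : ∀ a b, C a → C b → C (a * b)) (q : Q ε τ) : C q := by
  obtain ⟨a, rfl⟩ := mk_surjective ε τ q
  induction a using FreeAlgebra.induction with
  | grade0 c => rw [AlgHom.commutes]; exact h0 c
  | grade1 a => exact h1 a
  | mul a b ha hb => rw [map_mul]; exact hmul _ _ ha hb
  | add a b ha hb => rw [map_add]; exact hadd _ _ ha hb

theorem grp_x (γ : Γ) : grp ε τ γ * gen ε τ .x = (ε γ : ℂ) • (gen ε τ .x * grp ε τ γ) := by
  have := mk_rel ε τ (QRel.gx γ)
  simp only [map_mul, map_smul] at this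
  exact this
theorem grp_y (γ : Γ) : grp ε τ γ * gen ε τ .y = ((ε γ)⁻¹ : ℂ) • (gen ε τ .y * grp ε τ γ) := by
  have := mk_rel ε τ (QRel.gy γ)
  simp only [map_mul, map_smul] at this
  exact this
theorem grp_z (γ : Γ) : grp ε τ γ * gen ε τ .z = gen ε τ .z * grp ε τ γ := by
  have := mk_rel ε τ (QRel.gz γ)
  simp only [map_mul] at this
  exact this
theorem grp_w (γ : Γ) : grp ε τ γ * gen ε τ .w = gen ε τ .w * grp ε τ γ := by
  have := mk_rel ε τ (QRel.gw γ)
  simp only [map_mul] at this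
  exact this
theorem x_z : gen ε τ .x * gen ε τ .z = gen ε τ .z * gen ε τ .x := by
  have := mk_rel ε τ QRel.xz
  simp only [map_mul] at this
  exact this
theorem y_z : gen ε τ .y * gen ε τ .z = gen ε τ .z * gen ε τ .y := by
  have := mk_rel ε τ QRel.yz
  simp only [map_mul] at this
  exact this
theorem z_w : gen ε τ .z * gen ε τ .w = gen ε τ .w * gen ε τ .z := by
  have := mk_rel ε τ QRel.zw
  simp only [map_mul] at this
  exact this
theorem y_w : gen ε τ .y * gen ε τ .w = gen ε τ .w * gen ε τ .y := by
  have := mk_rel ε τ QRel.yw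
  simp only [map_mul] at this
  exact this
theorem x_w : gen ε τ .x * gen ε τ .w = gen ε τ .w * gen ε τ .x := by
  have := mk_rel ε τ QRel.xw
  simp only [map_mul] at this
  exact this
theorem y_x : gen ε τ .y * gen ε τ .x
    = gen ε τ .x * gen ε τ .y + incl ε τ τ * gen ε τ .z * gen ε τ .w := by
  have := mk_rel ε τ QRel.yx
  simp only [map_mul, map_add, Finsupp.sum, map_sum, map_smul] at this
  rw [incl, MonoidAlgebra.lift_apply]
  exact this

/-- The algebra map out of `Q` defined by the images of the generators. -/
noncomputable def lift {A : Type} [Ring A] [Algebra ℂ A] (f : QGen Γ → A)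
    (h : ∀ a b, QRel ε τ a b → FreeAlgebra.lift ℂ f a = FreeAlgebra.lift ℂ f b) :
    Q ε τ →ₐ[ℂ] A :=
  RingQuot.liftAlgHom ℂ ⟨FreeAlgebra.lift ℂ f, fun a b r => h a b r⟩

theorem lift_gen {A : Type} [Ring A] [Algebra ℂ A] (f : QGen Γ → A)
    (h : ∀ a b, QRel ε τ a b → FreeAlgebra.lift ℂ f a = FreeAlgebra.lift ℂ f b) (a : QGen Γ) :
    lift ε τ f h (gen ε τ a) = f a := by
  refine (RingQuot.liftAlgHom_mkAlgHom_apply ℂ _ _ _).trans ?_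
  exact FreeAlgebra.lift_ι_apply f a

theorem z_comm (q : Q ε τ) : q * gen ε τ .z = gen ε τ .z * q := by
  refine induction ε τ (C := fun q => q * gen ε τ .z = gen ε τ .z * q)
    (fun c => Algebra.commutes c _) ?_ (fun a b ha hb => by rw [add_mul, mul_add, ha, hb])
    (fun a b ha hb => by rw [mul_assoc, hb, ← mul_assoc, ha, mul_assoc]) q
  rintro (_ | _ | _ | _ | γ)
  · exact x_z ε τ
  · rfl
  · exact y_z ε τ
  · exact (z_w ε τ).symm
  · exact grp_z ε τ γ

theorem w_comm (q : Q ε τ) : q * gen ε τ .w = gen ε τ .w * q := by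
  refine induction ε τ (C := fun q => q * gen ε τ .w = gen ε τ .w * q)
    (fun c => Algebra.commutes c _) ?_ (fun a b ha hb => by rw [add_mul, mul_add, ha, hb])
    (fun a b ha hb => by rw [mul_assoc, hb, ← mul_assoc, ha, mul_assoc]) q
  rintro (_ | _ | _ | _ | γ)
  · exact x_w ε τ
  · exact z_w ε τ
  · exact y_w ε τ
  · rfl
  · exact grp_w ε τ γ

/-- The component of bidegree `p` of `Q`, spanned by the monomials of bidegree `p`. -/
noncomputable def gr (p : ℤ × ℤ) : AddSubgroup (Q ε τ) :=
  (Submodule.span ℂ {q | ∃ l : List (QGen Γ), (l.map QGen.deg).sum = p ∧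
    q = (l.map (gen ε τ)).prod}).toAddSubgroup

theorem mem_gr_of_list (l : List (QGen Γ)) :
    (l.map (gen ε τ)).prod ∈ gr ε τ (l.map QGen.deg).sum :=
  Submodule.subset_span ⟨l, rfl, rfl⟩

theorem gen_mem (a : QGen Γ) : gen ε τ a ∈ gr ε τ a.deg := by
  simpa using mem_gr_of_list ε τ [a]

theorem gr_smul {p : ℤ × ℤ} (c : ℂ) {a : Q ε τ} (ha : a ∈ gr ε τ p) : c • a ∈ gr ε τ p :=
  Submodule.smul_mem _ c ha

theorem one_mem_gr : (1 : Q ε τ) ∈ gr ε τ 0 := by simpa using mem_gr_of_list ε τ []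

theorem mul_mem_gr {p q : ℤ × ℤ} {a b : Q ε τ} (ha : a ∈ gr ε τ p) (hb : b ∈ gr ε τ q) :
    a * b ∈ gr ε τ (p + q) := by
  induction ha using Submodule.span_induction with
  | mem a ha =>
    obtain ⟨l, rfl, rfl⟩ := ha
    induction hb using Submodule.span_induction with
    | mem b hb =>
      obtain ⟨k, rfl, rfl⟩ := hb
      rw [← List.prod_append, ← List.map_append, ← List.sum_append, ← List.map_append]
      exact mem_gr_of_list ε τ _
    | zero => rw [mul_zero]; exact zero_mem _
    | add x y _ _ hx hy => rw [mul_add]; exact add_mem hx hy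
    | smul c x _ hx => rw [mul_smul_comm]; exact gr_smul ε τ c hx
  | zero => rw [zero_mul]; exact zero_mem _
  | add x y _ _ hx hy => rw [add_mul]; exact add_mem hx hy
  | smul c x _ hx => rw [smul_mul_assoc]; exact gr_smul ε τ c hx

/-- The coaction `q ↦ ∑ q_p T^p` of the bigrading. -/
noncomputable def coact : Q ε τ →ₐ[ℂ] AddMonoidAlgebra (Q ε τ) (ℤ × ℤ) :=
  lift ε τ (fun a => AddMonoidAlgebra.single a.deg (gen ε τ a)) (by
    have hs : ∀ (c : ℂ) (p : ℤ × ℤ) (q : Q ε τ), c • (AddMonoidAlgebra.single p q)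
        = AddMonoidAlgebra.single p (c • q) := fun c p q => by
      simp
    intro a b h
    induction h with
    | one =>
      simp [QGen.deg, AddMonoidAlgebra.one_def]
      exact (grp ε τ).map_one
    | mul γ δ =>
      simp [QGen.deg, AddMonoidAlgebra.single_mul_single]
      exact (grp ε τ).map_mul γ δ
    | gx γ =>
      simp [QGen.deg, AddMonoidAlgebra.single_mul_single]
      exact grp_x ε τ γ
    | gy γ =>
      simp [QGen.deg, AddMonoidAlgebra.single_mul_single]
      exact grp_y ε τ γ
    | gz γ =>
      simp [QGen.deg, AddMonoidAlgebra.single_mul_single]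
      exact grp_z ε τ γ
    | gw γ =>
      simp [QGen.deg, AddMonoidAlgebra.single_mul_single]
      exact grp_w ε τ γ
    | xz => simp [QGen.deg, AddMonoidAlgebra.single_mul_single, x_z]
    | yz => simp [QGen.deg, AddMonoidAlgebra.single_mul_single, y_z]
    | zw => simp [QGen.deg, AddMonoidAlgebra.single_mul_single, z_w]
    | yw => simp [QGen.deg, AddMonoidAlgebra.single_mul_single, y_w]
    | xw => simp [QGen.deg, AddMonoidAlgebra.single_mul_single, x_w]
    | yx =>
      have e : incl ε τ τ = τ.coeff.sum fun γ c => c • gen ε τ (.g γ) := by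
        rw [incl, MonoidAlgebra.lift_apply]; rfl
      have h0 : ∑ γ ∈ τ.coeff.support, τ.coeff γ • AddMonoidAlgebra.single (0 : ℤ × ℤ) (gen ε τ (.g γ))
          = AddMonoidAlgebra.single 0 (incl ε τ τ) := by
        rw [e, Finsupp.sum]
        simp only [hs]
        exact (map_sum (AddMonoidAlgebra.singleAddHom (0 : ℤ × ℤ)) _ _).symm
      simp only [map_mul, map_add, Finsupp.sum, map_sum, map_smul, FreeAlgebra.lift_ι_apply,
        QGen.deg]
      rw [h0]
      simp [AddMonoidAlgebra.single_mul_single, y_x])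

theorem coact_of_mem {p : ℤ × ℤ} {q : Q ε τ} (hq : q ∈ gr ε τ p) :
    coact ε τ q = AddMonoidAlgebra.single p q := by
  induction hq using Submodule.span_induction with
  | mem a ha =>
    obtain ⟨l, rfl, rfl⟩ := ha
    induction l with
    | nil => simp [AddMonoidAlgebra.one_def]
    | cons a l ih =>
      rw [List.map_cons, List.prod_cons, map_mul, ih, coact, lift_gen,
        AddMonoidAlgebra.single_mul_single, List.map_cons, List.sum_cons]
  | zero => simp
  | add x y _ _ hx hy => rw [map_add, hx, hy]; simp
  | smul c x _ hx => rw [map_smul, hx]; simp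

theorem mem_iSup_gr (q : Q ε τ) : q ∈ ⨆ p, gr ε τ p := by
  have h1 : (1 : Q ε τ) ∈ ⨆ p, gr ε τ p := AddSubgroup.mem_iSup_of_mem 0 (one_mem_gr ε τ)
  have hs : ∀ (c : ℂ) (a : Q ε τ), a ∈ ⨆ p, gr ε τ p → c • a ∈ ⨆ p, gr ε τ p := by
    intro c a ha
    induction ha using AddSubgroup.iSup_induction' with
    | hp p x hx => exact AddSubgroup.mem_iSup_of_mem p (gr_smul ε τ c hx)
    | h1 => rw [smul_zero]; exact zero_mem _
    | hadd x y _ _ hx hy => rw [smul_add]; exact add_mem hx hy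
  refine induction ε τ (C := fun q => q ∈ ⨆ p, gr ε τ p) (fun c => ?_)
    (fun a => AddSubgroup.mem_iSup_of_mem _ (gen_mem ε τ a)) (fun a b => add_mem) ?_ q
  · rw [Algebra.algebraMap_eq_smul_one]; exact hs c _ h1
  · intro a b ha hb
    induction ha using AddSubgroup.iSup_induction' with
    | hp p x hx =>
      induction hb using AddSubgroup.iSup_induction' with
      | hp q y hy => exact AddSubgroup.mem_iSup_of_mem _ (mul_mem_gr ε τ hx hy)
      | h1 => rw [mul_zero]; exact zero_mem _
      | hadd x y _ _ hx hy => rw [mul_add]; exact add_mem hx hy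
    | h1 => rw [zero_mul]; exact zero_mem _
    | hadd x y _ _ hx hy => rw [add_mul]; exact add_mem hx hy

instance : IsBigraded (gr ε τ) where
  isInternal := isInternal_of_proj _ (fun p =>
      { toFun := fun q => (coact ε τ q).coeff p
        map_zero' := by simp
        map_add' := fun a b => by simp })
    (fun p q hq => by
      change (coact ε τ q).coeff p = q
      rw [coact_of_mem ε τ hq]; simp)
    (fun p p' hp q hq => by
      change (coact ε τ q).coeff p = 0
      rw [coact_of_mem ε τ hq]; simp [hp.symm])
    (mem_iSup_gr ε τ)
  one_mem := one_mem_gr ε τ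
  mul_mem := mul_mem_gr ε τ

end Q

namespace Q

/-- The subalgebra of `Qᵐᵒᵖ` generated by `x`, `z`, `w` and `Γ`. -/
noncomputable def base : Subalgebra ℂ (Q ε τ)ᵐᵒᵖ :=
  Algebra.adjoin ℂ ({op (gen ε τ .x), op (gen ε τ .z), op (gen ε τ .w)} ∪
    Set.range fun γ => op (grp ε τ γ))

theorem x_mem : op (gen ε τ .x) ∈ base ε τ := Algebra.subset_adjoin (by simp)
theorem z_mem : op (gen ε τ .z) ∈ base ε τ := Algebra.subset_adjoin (by simp)
theorem w_mem : op (gen ε τ .w) ∈ base ε τ := Algebra.subset_adjoin (by simp)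
theorem g_mem (γ : Γ) : op (grp ε τ γ) ∈ base ε τ := Algebra.subset_adjoin (Or.inr ⟨γ, rfl⟩)

theorem incl_mem (a : MonoidAlgebra ℂ Γ) : op (incl ε τ a) ∈ base ε τ := by
  rw [incl, MonoidAlgebra.lift_apply, Finsupp.sum, Finset.op_sum]
  refine sum_mem fun γ _ => ?_
  rw [op_smul]
  exact Subalgebra.smul_mem _ (g_mem ε τ γ) _

theorem tail_mem : op (incl ε τ τ * gen ε τ .z * gen ε τ .w) ∈ base ε τ := by
  rw [op_mul, op_mul]
  exact mul_mem (w_mem ε τ) (mul_mem (z_mem ε τ) (incl_mem ε τ τ))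

theorem y_grp (γ : Γ) : gen ε τ .y * grp ε τ γ = (ε γ : ℂ) • (grp ε τ γ * gen ε τ .y) := by
  rw [grp_y, smul_smul, mul_inv_cancel₀ (Units.ne_zero _), one_smul]

theorem x_grp (γ : Γ) : gen ε τ .x * grp ε τ γ = ((ε γ)⁻¹ : ℂ) • (grp ε τ γ * gen ε τ .x) := by
  rw [grp_x, smul_smul, inv_mul_cancel₀ (Units.ne_zero _), one_smul]

theorem base_mul_y (r : base ε τ) : ∃ r' s : base ε τ,
    (r : (Q ε τ)ᵐᵒᵖ) * op (gen ε τ .y) = op (gen ε τ .y) * r' + s := by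
  obtain ⟨r, hr⟩ := r
  suffices ∃ r' ∈ base ε τ, ∃ s ∈ base ε τ, r * op (gen ε τ .y) = op (gen ε τ .y) * r' + s by
    obtain ⟨r', hr', s, hs, e⟩ := this
    exact ⟨⟨r', hr'⟩, ⟨s, hs⟩, e⟩
  induction hr using Algebra.adjoin_induction with
  | mem a ha =>
    rcases ha with (rfl | rfl | rfl) | ⟨γ, rfl⟩
    · refine ⟨_, x_mem ε τ, _, tail_mem ε τ, ?_⟩
      rw [← op_mul, y_x, MulOpposite.op_add, op_mul]
    · exact ⟨_, z_mem ε τ, 0, zero_mem _, by rw [← op_mul, ← op_mul, y_z, add_zero]⟩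
    · exact ⟨_, w_mem ε τ, 0, zero_mem _, by rw [← op_mul, ← op_mul, y_w, add_zero]⟩
    · refine ⟨_, Subalgebra.smul_mem _ (g_mem ε τ γ) (ε γ : ℂ), 0, zero_mem _, ?_⟩
      rw [← op_mul, y_grp, op_smul, op_mul, add_zero, mul_smul_comm]
  | algebraMap c =>
    exact ⟨_, Subalgebra.algebraMap_mem _ c, 0, zero_mem _, by rw [Algebra.commutes, add_zero]⟩
  | add a b _ _ ha hb =>
    obtain ⟨a', ha', s, hs, ea⟩ := ha
    obtain ⟨b', hb', s', hs', eb⟩ := hb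
    exact ⟨_, add_mem ha' hb', _, add_mem hs hs', by rw [add_mul, ea, eb, mul_add]; abel⟩
  | mul a b ha0 _ ha hb =>
    obtain ⟨a', ha', s, hs, ea⟩ := ha
    obtain ⟨b', hb', s', hs', eb⟩ := hb
    refine ⟨_, mul_mem ha' hb', _, add_mem (mul_mem hs hb') (mul_mem ha0 hs'), ?_⟩
    rw [mul_assoc, eb, mul_add, ← mul_assoc, ea, add_mul, mul_assoc, add_assoc]

theorem y_mul_base (r : base ε τ) : ∃ r' s : base ε τ,
    op (gen ε τ .y) * (r : (Q ε τ)ᵐᵒᵖ) = r' * op (gen ε τ .y) + s := by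
  obtain ⟨r, hr⟩ := r
  suffices ∃ r' ∈ base ε τ, ∃ s ∈ base ε τ, op (gen ε τ .y) * r = r' * op (gen ε τ .y) + s by
    obtain ⟨r', hr', s, hs, e⟩ := this
    exact ⟨⟨r', hr'⟩, ⟨s, hs⟩, e⟩
  induction hr using Algebra.adjoin_induction with
  | mem a ha =>
    rcases ha with (rfl | rfl | rfl) | ⟨γ, rfl⟩
    · refine ⟨_, x_mem ε τ, _, neg_mem (tail_mem ε τ), ?_⟩
      rw [← op_mul, ← op_mul, y_x, MulOpposite.op_add, add_neg_cancel_right]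
    · exact ⟨_, z_mem ε τ, 0, zero_mem _, by rw [← op_mul, ← op_mul, y_z, add_zero]⟩
    · exact ⟨_, w_mem ε τ, 0, zero_mem _, by rw [← op_mul, ← op_mul, y_w, add_zero]⟩
    · refine ⟨_, Subalgebra.smul_mem _ (g_mem ε τ γ) ((ε γ)⁻¹ : ℂ), 0, zero_mem _, ?_⟩
      rw [← op_mul, grp_y, op_smul, op_mul, add_zero, smul_mul_assoc]
  | algebraMap c =>
    exact ⟨_, Subalgebra.algebraMap_mem _ c, 0, zero_mem _, by rw [Algebra.commutes, add_zero]⟩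
  | add a b _ _ ha hb =>
    obtain ⟨a', ha', s, hs, ea⟩ := ha
    obtain ⟨b', hb', s', hs', eb⟩ := hb
    exact ⟨_, add_mem ha' hb', _, add_mem hs hs', by rw [mul_add, ea, eb, add_mul]; abel⟩
  | mul a b _ hb0 ha hb =>
    obtain ⟨a', ha', s, hs, ea⟩ := ha
    obtain ⟨b', hb', s', hs', eb⟩ := hb
    refine ⟨_, mul_mem ha' hb', _, add_mem (mul_mem ha' hs') (mul_mem hs hb0), ?_⟩
    rw [← mul_assoc, ea, add_mul, mul_assoc, eb, mul_add, ← mul_assoc, add_assoc]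

theorem exists_lowDeg (s : (Q ε τ)ᵐᵒᵖ) :
    ∃ n, s ∈ lowDeg (base ε τ).val.toRingHom (op (gen ε τ .y)) n := by
  have left : ∀ r ∈ base ε τ, ∀ s,
      (∃ n, s ∈ lowDeg (base ε τ).val.toRingHom (op (gen ε τ .y)) n) →
      ∃ n, r * s ∈ lowDeg (base ε τ).val.toRingHom (op (gen ε τ .y)) n := by
    rintro r hr s ⟨n, hn⟩
    exact ⟨n, lowDeg_mul_left (base ε τ).val.toRingHom _ (base_mul_y ε τ) ⟨r, hr⟩ hn⟩
  have key : ∀ q : Q ε τ, ∀ s,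
      (∃ n, s ∈ lowDeg (base ε τ).val.toRingHom (op (gen ε τ .y)) n) →
      ∃ n, op q * s ∈ lowDeg (base ε τ).val.toRingHom (op (gen ε τ .y)) n := by
    intro q
    refine induction ε τ (C := fun q => ∀ s,
      (∃ n, s ∈ lowDeg (base ε τ).val.toRingHom (op (gen ε τ .y)) n) →
      ∃ n, op q * s ∈ lowDeg (base ε τ).val.toRingHom (op (gen ε τ .y)) n) ?_ ?_ ?_ ?_ q
    · exact fun c => left _ (Subalgebra.algebraMap_mem _ c)
    · rintro (_ | _ | _ | _ | γ)
      · exact left _ (x_mem ε τ)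
      · exact left _ (z_mem ε τ)
      · rintro s ⟨n, hn⟩
        exact ⟨n + 1, lowDeg_t_mul _ _ hn⟩
      · exact left _ (w_mem ε τ)
      · exact left _ (g_mem ε τ γ)
    · intro a b ha hb s hs
      obtain ⟨n, hn⟩ := ha s hs
      obtain ⟨k, hk⟩ := hb s hs
      exact ⟨max n k, by
        rw [MulOpposite.op_add, add_mul]
        exact add_mem (lowDeg_mono _ _ (le_max_left _ _) hn) (lowDeg_mono _ _ (le_max_right _ _) hk)⟩
    · intro a b ha hb s hs
      rw [op_mul, mul_assoc]
      exact hb _ (ha s hs)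
  have h1 : ∃ n, (1 : (Q ε τ)ᵐᵒᵖ) ∈ lowDeg (base ε τ).val.toRingHom (op (gen ε τ .y)) n := by
    refine ⟨1, ?_⟩
    have := mem_lowDeg (base ε τ).val.toRingHom (op (gen ε τ .y)) (i := 0) (n := 1) one_pos 1
    rwa [pow_zero, map_one, one_mul] at this
  have := key s.unop 1 h1
  rwa [mul_one, op_unop] at this

/-- `Q` is right noetherian. -/
instance [Finite Γ] : IsNoetherianRing (Q ε τ)ᵐᵒᵖ := by
  let G : Γ →* (Q ε τ)ᵐᵒᵖ :=
    { toFun := fun γ => op (grp ε τ γ)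
      map_one' := by rw [map_one, op_one]
      map_mul' := fun γ δ => by rw [mul_comm γ δ, map_mul, op_mul] }
  have : IsNoetherianRing (base ε τ) := by
    refine isNoetherianRing_adjoin {op (gen ε τ .x), op (gen ε τ .z), op (gen ε τ .w)}
      (Set.toFinite _) ?_ G ?_
    · rintro _ (rfl | rfl | rfl) _ (rfl | rfl | rfl) <;> simp only [← op_mul, x_z, x_w, z_w]
    · rintro γ _ (rfl | rfl | rfl)
      · refine ⟨((ε γ)⁻¹ : ℂ), ?_⟩
        change op _ * op _ = _ • (op _ * op _)
        rw [← op_mul, ← op_mul, x_grp, op_smul]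
      · refine ⟨1, ?_⟩
        change op _ * op _ = _ • (op _ * op _)
        rw [← op_mul, ← op_mul, grp_z, one_smul]
      · refine ⟨1, ?_⟩
        change op _ * op _ = _ • (op _ * op _)
        rw [← op_mul, ← op_mul, grp_w, one_smul]
  exact isNoetherianRing_of_extension (base ε τ).val.toRingHom (op (gen ε τ .y))
    (base_mul_y ε τ) (y_mul_base ε τ) (exists_lowDeg ε τ)

end Q

end Algebras

/-! ### Restriction to the divisor of a central element -/

section Restr

/-- The right action on a right module as an (anti)homomorphism. -/
def rightAct {A N : Type} [Ring A] [AddCommGroup N] [Module Aᵐᵒᵖ N] :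
    A →+* (AddMonoid.End N)ᵐᵒᵖ where
  toFun a := op (Module.toAddMonoidEnd Aᵐᵒᵖ N (op a))
  map_one' := by rw [op_one, map_one, op_one]
  map_mul' a b := by rw [op_mul, map_mul, op_mul]
  map_zero' := by rw [MulOpposite.op_zero, map_zero, MulOpposite.op_zero]
  map_add' a b := by rw [MulOpposite.op_add, map_add, MulOpposite.op_add]

/-- The right module defined by an action. -/
abbrev rightModule {C N : Type} [Ring C] [AddCommGroup N] (f : C →+* (AddMonoid.End N)ᵐᵒᵖ) :
    Module Cᵐᵒᵖ N where
  smul c n := (f c.unop).unop n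
  one_smul n := by change (f 1).unop n = n; rw [map_one]; rfl
  mul_smul a b n := by
    change (f (b.unop * a.unop)).unop n = _
    rw [map_mul]; rfl
  smul_zero a := map_zero (f a.unop).unop
  smul_add a := map_add (f a.unop).unop
  add_smul a b n := by
    change (f (a.unop + b.unop)).unop n = _
    rw [map_add]; rfl
  zero_smul n := by
    change (f 0).unop n = _
    rw [map_zero]; rfl

variable {A : Type} [Ring A] {𝒜 : ℤ × ℤ → AddSubgroup A}

variable (𝒜) in
/-- A homogeneous central element. -/
structure CentralElt where
  elt : A
  deg : ℤ × ℤ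
  mem : elt ∈ 𝒜 deg
  comm : ∀ a, a * elt = elt * a

variable (c : CentralElt 𝒜)

instance : (Ideal.span {c.elt}).IsTwoSided where
  mul_mem_of_left {a} b ha := by
    obtain ⟨r, rfl⟩ := Ideal.mem_span_singleton'.1 ha
    exact Ideal.mem_span_singleton'.2 ⟨r * b, by rw [mul_assoc, mul_assoc, c.comm]⟩

/-- The quotient ring `A / cA`. -/
def QuotBy : Type := A ⧸ Ideal.span {c.elt}

noncomputable instance : Ring (QuotBy c) := inferInstanceAs (Ring (A ⧸ Ideal.span {c.elt}))

/-- The quotient map. -/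
def QuotBy.mk : A →+* QuotBy c := Ideal.Quotient.mk (Ideal.span {c.elt})

theorem QuotBy.mk_surjective : Function.Surjective (QuotBy.mk c) := Ideal.Quotient.mk_surjective

theorem QuotBy.mk_eq_zero (a : A) : QuotBy.mk c a = 0 ↔ ∃ b, b * c.elt = a :=
  Ideal.Quotient.eq_zero_iff_mem.trans Ideal.mem_span_singleton'

/-- The induced bigrading of `A / cA`. -/
noncomputable def QuotBy.gr (p : ℤ × ℤ) : AddSubgroup (QuotBy c) := (𝒜 p).map (QuotBy.mk c).toAddMonoidHom

instance [IsNoetherianRing Aᵐᵒᵖ] : IsNoetherianRing (QuotBy c)ᵐᵒᵖ :=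
  isNoetherianRing_of_surjective Aᵐᵒᵖ (QuotBy c)ᵐᵒᵖ (QuotBy.mk c).op fun b => by
    obtain ⟨a, ha⟩ := QuotBy.mk_surjective c b.unop
    exact ⟨op a, congrArg op ha⟩

namespace GrMod

variable {c} in
/-- Multiplication by `c`. -/
def mulC (M : GrMod 𝒜) : M.carrier →ₗ[Aᵐᵒᵖ] M.carrier where
  toFun m := op c.elt • m
  map_add' := smul_add _
  map_smul' a m := by
    rw [RingHom.id_apply, smul_smul, smul_smul]
    exact congrArg (· • m) (congrArg op (c.comm a.unop))

theorem proj_mulC (M : GrMod 𝒜) (p : ℤ × ℤ) (m : M.carrier) :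
    M.proj p (mulC (c := c) M m) = mulC (c := c) M (M.proj (p - c.deg) m) := by
  have := map_grProj M.gr M.isInternal M.isInternal (mulC (c := c) M).toAddMonoidHom c.deg
    (fun p m hm => M.smul_mem c.mem hm) (p - c.deg) m
  rw [sub_add_cancel] at this
  exact this.symm

/-- The bigraded `A`-module `M / Mc`. -/
def modC (M : GrMod 𝒜) : GrMod 𝒜 := M.quot (LinearMap.range (mulC (c := c) M)) (by
  rintro p _ ⟨m, rfl⟩
  exact ⟨_, (proj_mulC c M p m).symm⟩)

/-- The projection `M → M / Mc`. -/
def modCπ (M : GrMod 𝒜) : M ⟶ modC c M := M.quotπ _ _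

theorem modCπ_surjective (M : GrMod 𝒜) : Function.Surjective (lin (modCπ c M)) :=
  Submodule.mkQ_surjective _

theorem modCπ_eq_zero (M : GrMod 𝒜) (m : M.carrier) :
    lin (modCπ c M) m = 0 ↔ ∃ n, op c.elt • n = m :=
  Submodule.Quotient.mk_eq_zero _

theorem smul_modC (M : GrMod 𝒜) (n : (modC c M).carrier) : op c.elt • n = 0 := by
  obtain ⟨m, rfl⟩ := modCπ_surjective c M n
  rw [← map_smul]
  exact (modCπ_eq_zero c M _).2 ⟨m, rfl⟩

/-- The action of `A / cA` on `M / Mc`. -/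
noncomputable def actC (M : GrMod 𝒜) :
    QuotBy c →+* (AddMonoid.End (modC c M).carrier)ᵐᵒᵖ :=
  Ideal.Quotient.lift _ rightAct fun a ha => by
    obtain ⟨r, rfl⟩ := Ideal.mem_span_singleton'.1 ha
    refine congrArg op (AddMonoidHom.ext fun n => ?_)
    change op (r * c.elt) • n = 0
    rw [op_mul, mul_smul, smul_modC]

/-- The bigraded `A / cA`-module `M / Mc`. -/
noncomputable def restrObj (M : GrMod 𝒜) : GrMod (QuotBy.gr c) :=
  let _ : Module (QuotBy c)ᵐᵒᵖ (modC c M).carrier := rightModule (actC c M)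
  { carrier := (modC c M).carrier
    gr := (modC c M).gr
    isInternal := (modC c M).isInternal
    smul_mem := by
      rintro p q _ m ⟨a, ha, rfl⟩ hm
      exact (modC c M).smul_mem ha hm
    finite := by
      obtain ⟨S, hS⟩ := (modC c M).finite
      refine ⟨S, ?_⟩
      rw [eq_top_iff]
      intro m _
      have hm : m ∈ Submodule.span Aᵐᵒᵖ (S : Set (modC c M).carrier) := by rw [hS]; trivial
      induction hm using Submodule.span_induction with
      | mem x hx => exact Submodule.subset_span hx
      | zero => exact zero_mem _
      | add x y _ _ hx hy => exact add_mem (hx trivial) (hy trivial)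
      | smul a x _ hx => exact Submodule.smul_mem _ (op (QuotBy.mk c a.unop)) (hx trivial) }

/-- The map `M / Mc → N / Nc` induced by `f : M → N`. -/
def modCMap {M N : GrMod 𝒜} (f : M ⟶ N) : modC c M ⟶ modC c N :=
  quotDesc _ _ (f ≫ modCπ c N) (by
    rintro _ ⟨m, rfl⟩
    exact (modCπ_eq_zero c N _).2 ⟨lin f m, (map_smul (lin f) _ _).symm⟩)

theorem modCMap_π {M N : GrMod 𝒜} (f : M ⟶ N) (m : M.carrier) :
    lin (modCMap c f) (lin (modCπ c M) m) = lin (modCπ c N) (lin f m) := rfl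

/-- The functor `M ↦ M / Mc` from bigraded `A`-modules to bigraded `A / cA`-modules. -/
noncomputable def restr : GrMod 𝒜 ⥤ GrMod (QuotBy.gr c) where
  obj := restrObj c
  map {M N} f := mk' (M := restrObj c M) (N := restrObj c N)
    { toFun := lin (modCMap c f)
      map_add' := map_add (lin (modCMap c f))
      map_smul' := by
        intro r n
        obtain ⟨a, ha⟩ := QuotBy.mk_surjective c r.unop
        obtain rfl : op (QuotBy.mk c a) = r := congrArg op ha
        exact (lin (modCMap c f)).map_smul (op a) n }
    fun p m hm => lin_mem (modCMap c f) hm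
  map_id M := hom_ext fun n => by
    obtain ⟨m, rfl⟩ := modCπ_surjective c M n
    rfl
  map_comp f g := hom_ext fun n => by
    obtain ⟨m, rfl⟩ := modCπ_surjective c _ n
    rfl

theorem restr_π {M N : GrMod 𝒜} (f : M ⟶ N) (m : M.carrier) :
    lin ((restr c).map f) (show (restrObj c M).carrier from lin (modCπ c M) m)
      = lin (modCπ c N) (lin f m) := rfl

instance : (restr c).Additive where
  map_add {M N f g} := hom_ext fun n => by
    obtain ⟨m, rfl⟩ := modCπ_surjective c _ n
    rfl

variable [IsNoetherianRing Aᵐᵒᵖ]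

theorem restr_isoModTor {M N : GrMod 𝒜} (f : M ⟶ N) (hf : (tor (𝒜 := 𝒜)).isoModSerre f) :
    (tor (𝒜 := QuotBy.gr c)).isoModSerre ((restr c).map f) := by
  rw [isoModTor_iff] at hf ⊢
  obtain ⟨⟨i₀, j₀, h⟩, ⟨i₁, j₁, h'⟩⟩ := hf
  constructor
  · refine ⟨max i₀ (i₁ + c.deg.1), max j₀ (j₁ + c.deg.2), ?_⟩
    rintro i j hi hj _ ⟨m, hm, rfl⟩ h0
    rw [max_lt_iff] at hi hj
    have h1 : lin (modCπ c N) (lin f m) = 0 := h0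
    obtain ⟨n, hn⟩ := (modCπ_eq_zero c N _).1 h1
    have h2 : op c.elt • N.proj ((i, j) - c.deg) n = lin f m := by
      have := proj_mulC c N (i, j) n
      change N.proj (i, j) (op c.elt • n) = op c.elt • N.proj ((i, j) - c.deg) n at this
      rw [← this, hn]
      exact grProj_of_mem _ _ (lin_mem f hm)
    obtain ⟨m', hm'⟩ := h' (i - c.deg.1) (j - c.deg.2) (by omega) (by omega) _
      (grProj_mem N.gr N.isInternal ((i, j) - c.deg) n)
    have h3 : lin f (m - op c.elt • M.proj ((i, j) - c.deg) m') = 0 := by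
      rw [map_sub, map_smul, lin_proj, hm', sub_eq_zero, ← h2]
      congr 1
      exact (grProj_of_mem N.gr N.isInternal (grProj_mem N.gr N.isInternal _ n)).symm
    have hmem : op c.elt • M.proj ((i, j) - c.deg) m' ∈ M.gr (i, j) := by
      have := M.smul_mem c.mem (grProj_mem M.gr M.isInternal ((i, j) - c.deg) m')
      rwa [sub_add_cancel] at this
    have h4 := h i j hi.1 hj.1 _ (sub_mem hm hmem) h3
    exact (modCπ_eq_zero c M m).2 ⟨_, (sub_eq_zero.1 h4).symm⟩
  · refine ⟨i₁, j₁, ?_⟩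
    rintro i j hi hj _ ⟨n, hn, rfl⟩
    obtain ⟨m, rfl⟩ := h' i j hi hj n hn
    exact ⟨lin (modCπ c M) m, rfl⟩

/-- The restriction functor `i_c^*` on the quotient categories. -/
noncomputable def iStar : QGr 𝒜 ⥤ QGr (QuotBy.gr c) :=
  Localization.lift (restr c ⋙ QGr.π (QuotBy.gr c))
    (fun _ _ f hf => Localization.inverts (QGr.π (QuotBy.gr c)) (tor (𝒜 := QuotBy.gr c)).isoModSerre _
      (restr_isoModTor c f hf)) (QGr.π 𝒜)

/-- The bigraded module representing an object of the quotient category. -/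
def repr (F : QGr 𝒜) : GrMod 𝒜 := (Localization.Construction.objEquiv _).symm F

theorem π_repr (F : QGr 𝒜) : (QGr.π 𝒜).obj (repr F) = F :=
  (Localization.Construction.objEquiv _).apply_symm_apply F

/-- The first derived functor `L¹i_c^*` on objects: the image in the quotient category of the
first left derived functor of `M ↦ M / Mc`. -/
noncomputable def derivedIStar [IsBigraded 𝒜] (F : QGr 𝒜) : QGr (QuotBy.gr c) :=
  (QGr.π _).obj (((restr c).leftDerived 1).obj (repr F))

end GrMod
end Restr

section Affine

variable {Γ : Type} [CommGroup Γ]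

/-- The generators `x, y` and `γ ∈ Γ` of `B`. -/
inductive BGen (Γ : Type) : Type
  | x | y
  | g (γ : Γ)

/-- The defining relations of `B`; the last one is `[y, x] = τ`. -/
inductive BRel (ε : Γ →* ℂˣ) (τ : MonoidAlgebra ℂ Γ) :
    FreeAlgebra ℂ (BGen Γ) → FreeAlgebra ℂ (BGen Γ) → Prop
  | one : BRel ε τ (FreeAlgebra.ι ℂ (BGen.g 1)) 1
  | mul (γ δ : Γ) : BRel ε τ (FreeAlgebra.ι ℂ (BGen.g (γ * δ)))
      (FreeAlgebra.ι ℂ (BGen.g γ) * FreeAlgebra.ι ℂ (BGen.g δ))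
  | gx (γ : Γ) : BRel ε τ (FreeAlgebra.ι ℂ (BGen.g γ) * FreeAlgebra.ι ℂ BGen.x)
      ((ε γ : ℂ) • (FreeAlgebra.ι ℂ BGen.x * FreeAlgebra.ι ℂ (BGen.g γ)))
  | gy (γ : Γ) : BRel ε τ (FreeAlgebra.ι ℂ (BGen.g γ) * FreeAlgebra.ι ℂ BGen.y)
      (((ε γ)⁻¹ : ℂ) • (FreeAlgebra.ι ℂ BGen.y * FreeAlgebra.ι ℂ (BGen.g γ)))
  | yx : BRel ε τ (FreeAlgebra.ι ℂ BGen.y * FreeAlgebra.ι ℂ BGen.x)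
      (FreeAlgebra.ι ℂ BGen.x * FreeAlgebra.ι ℂ BGen.y
        + τ.coeff.sum fun γ c => c • FreeAlgebra.ι ℂ (BGen.g γ))

/-- The algebra `B`. -/
def B (ε : Γ →* ℂˣ) (τ : MonoidAlgebra ℂ Γ) : Type := RingQuot (BRel ε τ)

variable (ε : Γ →* ℂˣ) (τ : MonoidAlgebra ℂ Γ)

noncomputable instance : Ring (B ε τ) := inferInstanceAs (Ring (RingQuot (BRel ε τ)))
noncomputable instance : Algebra ℂ (B ε τ) := inferInstanceAs (Algebra ℂ (RingQuot (BRel ε τ)))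

namespace B

/-- The quotient map from the free algebra. -/
noncomputable def mk : FreeAlgebra ℂ (BGen Γ) →ₐ[ℂ] B ε τ := RingQuot.mkAlgHom ℂ (BRel ε τ)

theorem mk_rel {a b : FreeAlgebra ℂ (BGen Γ)} (h : BRel ε τ a b) : mk ε τ a = mk ε τ b :=
  RingQuot.mkAlgHom_rel ℂ h

theorem mk_surjective : Function.Surjective (mk ε τ) := RingQuot.mkAlgHom_surjective ℂ _

/-- The generators as elements of `B`. -/
noncomputable def gen (a : BGen Γ) : B ε τ := mk ε τ (FreeAlgebra.ι ℂ a)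

/-- The map `Γ → B`. -/
noncomputable def grp : Γ →* B ε τ where
  toFun γ := gen ε τ (BGen.g γ)
  map_one' := (mk_rel ε τ BRel.one).trans (map_one _)
  map_mul' γ δ := (mk_rel ε τ (BRel.mul γ δ)).trans (map_mul _ _ _)

/-- The map `ℂΓ → B`. -/
noncomputable def incl : MonoidAlgebra ℂ Γ →ₐ[ℂ] B ε τ := MonoidAlgebra.lift ℂ (B ε τ) Γ (grp ε τ)

/-- The algebra map out of `B` defined by the images of the generators. -/
noncomputable def lift {A : Type} [Ring A] [Algebra ℂ A] (f : BGen Γ → A)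
    (h : ∀ a b, BRel ε τ a b → FreeAlgebra.lift ℂ f a = FreeAlgebra.lift ℂ f b) :
    B ε τ →ₐ[ℂ] A :=
  RingQuot.liftAlgHom ℂ ⟨FreeAlgebra.lift ℂ f, fun a b r => h a b r⟩

theorem lift_gen {A : Type} [Ring A] [Algebra ℂ A] (f : BGen Γ → A)
    (h : ∀ a b, BRel ε τ a b → FreeAlgebra.lift ℂ f a = FreeAlgebra.lift ℂ f b) (a : BGen Γ) :
    lift ε τ f h (gen ε τ a) = f a := by
  refine (RingQuot.liftAlgHom_mkAlgHom_apply ℂ _ _ _).trans ?_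
  exact FreeAlgebra.lift_ι_apply f a

theorem grp_x (γ : Γ) : grp ε τ γ * gen ε τ .x = (ε γ : ℂ) • (gen ε τ .x * grp ε τ γ) := by
  have := mk_rel ε τ (BRel.gx γ)
  simp only [map_mul, map_smul] at this
  exact this
theorem grp_y (γ : Γ) : grp ε τ γ * gen ε τ .y = ((ε γ)⁻¹ : ℂ) • (gen ε τ .y * grp ε τ γ) := by
  have := mk_rel ε τ (BRel.gy γ)
  simp only [map_mul, map_smul] at this
  exact this
theorem y_x : gen ε τ .y * gen ε τ .x = gen ε τ .x * gen ε τ .y + incl ε τ τ := by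
  have := mk_rel ε τ BRel.yx
  simp only [map_mul, map_add, Finsupp.sum, map_sum, map_smul] at this
  rw [incl, MonoidAlgebra.lift_apply]
  exact this

/-- The images of the generators of `Q` under `Q → B`, `z, w ↦ 1`. -/
noncomputable def ofQGen : QGen Γ → B ε τ
  | .x => gen ε τ .x
  | .y => gen ε τ .y
  | .z => 1
  | .w => 1
  | .g γ => grp ε τ γ

/-- The algebra map `Q → B`, `z, w ↦ 1`. -/
noncomputable def ofQ : Q ε τ →ₐ[ℂ] B ε τ :=
  Q.lift ε τ (ofQGen ε τ) (by
    intro a b h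
    induction h with
    | one => simp [ofQGen]
    | mul γ δ => simp [ofQGen]
    | gx γ => simpa [ofQGen] using grp_x ε τ γ
    | gy γ => simpa [ofQGen] using grp_y ε τ γ
    | gz γ => simp [ofQGen]
    | gw γ => simp [ofQGen]
    | xz => simp [ofQGen]
    | yz => simp [ofQGen]
    | zw => simp [ofQGen]
    | yw => simp [ofQGen]
    | xw => simp [ofQGen]
    | yx =>
      have e := y_x ε τ
      rw [incl, MonoidAlgebra.lift_apply] at e
      simpa [ofQGen, Finsupp.sum] using e)

theorem ofQ_gen (a : QGen Γ) : ofQ ε τ (Q.gen ε τ a) = ofQGen ε τ a := Q.lift_gen ε τ _ _ _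

theorem ofQ_incl (a : MonoidAlgebra ℂ Γ) : ofQ ε τ (Q.incl ε τ a) = incl ε τ a := by
  rw [Q.incl, incl, MonoidAlgebra.lift_apply, MonoidAlgebra.lift_apply, Finsupp.sum, map_sum]
  refine Finset.sum_congr rfl fun γ _ => ?_
  rw [map_smul]
  exact congrArg _ (ofQ_gen ε τ (.g γ))

theorem ofQ_surjective : Function.Surjective (ofQ ε τ) := by
  intro b
  obtain ⟨a, rfl⟩ := mk_surjective ε τ b
  induction a using FreeAlgebra.induction with
  | grade0 c => exact ⟨algebraMap ℂ _ c, by rw [AlgHom.commutes, AlgHom.commutes]⟩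
  | grade1 a =>
    cases a with
    | x => exact ⟨_, ofQ_gen ε τ .x⟩
    | y => exact ⟨_, ofQ_gen ε τ .y⟩
    | g γ => exact ⟨_, ofQ_gen ε τ (.g γ)⟩
  | mul a b ha hb =>
    obtain ⟨p, hp⟩ := ha
    obtain ⟨q, hq⟩ := hb
    exact ⟨p * q, by rw [map_mul, map_mul, hp, hq]⟩
  | add a b ha hb =>
    obtain ⟨p, hp⟩ := ha
    obtain ⟨q, hq⟩ := hb
    exact ⟨p + q, by rw [map_add, map_add, hp, hq]⟩

end B

/-! ### The functor `j^*` -/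

namespace Q

/-- The central element `z` of bidegree `(1, 0)`. -/
noncomputable def zElt : CentralElt (gr ε τ) := ⟨gen ε τ .z, (1, 0), gen_mem ε τ .z, z_comm ε τ⟩

/-- The central element `w` of bidegree `(0, 1)`. -/
noncomputable def wElt : CentralElt (gr ε τ) := ⟨gen ε τ .w, (0, 1), gen_mem ε τ .w, w_comm ε τ⟩

instance : (Ideal.span {gen ε τ .z - 1, gen ε τ .w - 1}).IsTwoSided where
  mul_mem_of_left {a} b ha := by
    obtain ⟨r, s, rfl⟩ := Ideal.mem_span_pair.1 ha
    refine Ideal.mem_span_pair.2 ⟨r * b, s * b, ?_⟩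
    have h1 := z_comm ε τ b
    have h2 := w_comm ε τ b
    rw [add_mul, mul_assoc, mul_assoc, mul_assoc, mul_assoc, mul_sub b, sub_mul _ _ b, h1,
      mul_sub b, sub_mul _ _ b, h2, mul_one, one_mul]

/-- The algebra `Q / (z - 1, w - 1)`. -/
abbrev Loc := Q ε τ ⧸ Ideal.span {gen ε τ .z - 1, gen ε τ .w - 1}

/-- The quotient map. -/
noncomputable def toLoc : Q ε τ →ₐ[ℂ] Loc ε τ := Ideal.Quotient.mkₐ ℂ _

theorem toLoc_z : toLoc ε τ (gen ε τ .z) = 1 := by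
  rw [← sub_eq_zero, ← map_one (toLoc ε τ), ← map_sub]
  exact Ideal.Quotient.eq_zero_iff_mem.2 (Ideal.subset_span (by simp))

theorem toLoc_w : toLoc ε τ (gen ε τ .w) = 1 := by
  rw [← sub_eq_zero, ← map_one (toLoc ε τ), ← map_sub]
  exact Ideal.Quotient.eq_zero_iff_mem.2 (Ideal.subset_span (by simp))

end Q

namespace B

/-- The images of the generators of `B` under `B → Q / (z - 1, w - 1)`. -/
noncomputable def toLocGen : BGen Γ → Q.Loc ε τ
  | .x => Q.toLoc ε τ (Q.gen ε τ .x)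
  | .y => Q.toLoc ε τ (Q.gen ε τ .y)
  | .g γ => Q.toLoc ε τ (Q.grp ε τ γ)

/-- The algebra map `B → Q / (z - 1, w - 1)`. -/
noncomputable def toLoc : B ε τ →ₐ[ℂ] Q.Loc ε τ :=
  lift ε τ (toLocGen ε τ) (by
    intro a b h
    induction h with
    | one => simp [toLocGen]
    | mul γ δ => simp [toLocGen]
    | gx γ => simpa [toLocGen] using congrArg (Q.toLoc ε τ) (Q.grp_x ε τ γ)
    | gy γ => simpa [toLocGen] using congrArg (Q.toLoc ε τ) (Q.grp_y ε τ γ)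
    | yx =>
      have e := congrArg (Q.toLoc ε τ) (Q.y_x ε τ)
      rw [Q.incl, MonoidAlgebra.lift_apply, map_add, map_mul, map_mul, map_mul, map_mul,
        Q.toLoc_z, Q.toLoc_w] at e
      simpa [toLocGen, Finsupp.sum] using e)

theorem toLoc_gen (a : BGen Γ) : toLoc ε τ (gen ε τ a) = toLocGen ε τ a := lift_gen ε τ _ _ _

theorem toLoc_ofQ (q : Q ε τ) : toLoc ε τ (ofQ ε τ q) = Q.toLoc ε τ q := by
  refine Q.induction ε τ (C := fun q => toLoc ε τ (ofQ ε τ q) = Q.toLoc ε τ q) (fun c => by simp)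
    ?_ (fun a b ha hb => by simp [ha, hb]) (fun a b ha hb => by simp [ha, hb]) q
  rintro (_ | _ | _ | _ | γ)
  · rw [ofQ_gen]; exact toLoc_gen ε τ .x
  · rw [ofQ_gen, Q.toLoc_z]; exact map_one _
  · rw [ofQ_gen]; exact toLoc_gen ε τ .y
  · rw [ofQ_gen, Q.toLoc_w]; exact map_one _
  · rw [ofQ_gen]; exact toLoc_gen ε τ (.g γ)

end B

namespace GrMod

variable {ε τ}

/-- The submodule `M(z - 1) + M(w - 1)`. -/
noncomputable def jSub (M : GrMod (Q.gr ε τ)) : Submodule (Q ε τ)ᵐᵒᵖ M.carrier :=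
  LinearMap.range (mulC (c := Q.zElt ε τ) M - LinearMap.id) ⊔
    LinearMap.range (mulC (c := Q.wElt ε τ) M - LinearMap.id)

theorem mem_jSub (M : GrMod (Q.gr ε τ)) (m : M.carrier) : m ∈ jSub M ↔
    ∃ a b, (op (Q.gen ε τ .z) • a - a) + (op (Q.gen ε τ .w) • b - b) = m := by
  rw [jSub, Submodule.mem_sup]
  constructor
  · rintro ⟨_, ⟨a, rfl⟩, _, ⟨b, rfl⟩, rfl⟩
    exact ⟨a, b, rfl⟩
  · rintro ⟨a, b, rfl⟩
    exact ⟨_, ⟨a, rfl⟩, _, ⟨b, rfl⟩, rfl⟩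

/-- The quotient `M / (M(z - 1) + M(w - 1))`. -/
noncomputable def JQuot (M : GrMod (Q.gr ε τ)) : Type := M.carrier ⧸ jSub M

noncomputable instance (M : GrMod (Q.gr ε τ)) : AddCommGroup (JQuot M) :=
  inferInstanceAs (AddCommGroup (M.carrier ⧸ jSub M))
noncomputable instance (M : GrMod (Q.gr ε τ)) : Module (Q ε τ)ᵐᵒᵖ (JQuot M) :=
  inferInstanceAs (Module (Q ε τ)ᵐᵒᵖ (M.carrier ⧸ jSub M))

/-- The projection `M → M / (M(z - 1) + M(w - 1))`. -/
noncomputable def JQuot.mk (M : GrMod (Q.gr ε τ)) : M.carrier →ₗ[(Q ε τ)ᵐᵒᵖ] JQuot M := (jSub M).mkQ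

theorem JQuot.mk_surjective (M : GrMod (Q.gr ε τ)) : Function.Surjective (JQuot.mk M) :=
  Submodule.mkQ_surjective _

theorem JQuot.mk_eq_zero (M : GrMod (Q.gr ε τ)) (m : M.carrier) :
    JQuot.mk M m = 0 ↔ m ∈ jSub M := Submodule.Quotient.mk_eq_zero _

theorem JQuot.z_smul (M : GrMod (Q.gr ε τ)) (n : JQuot M) :
    op (Q.gen ε τ .z) • n = n := by
  obtain ⟨m, rfl⟩ := JQuot.mk_surjective M n
  rw [← map_smul, ← sub_eq_zero, ← map_sub, JQuot.mk_eq_zero, mem_jSub]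
  exact ⟨m, 0, by simp⟩

theorem JQuot.w_smul (M : GrMod (Q.gr ε τ)) (n : JQuot M) :
    op (Q.gen ε τ .w) • n = n := by
  obtain ⟨m, rfl⟩ := JQuot.mk_surjective M n
  rw [← map_smul, ← sub_eq_zero, ← map_sub, JQuot.mk_eq_zero, mem_jSub]
  exact ⟨0, m, by simp⟩

/-- The action of `Q / (z - 1, w - 1)`. -/
noncomputable def actJ (M : GrMod (Q.gr ε τ)) : Q.Loc ε τ →+* (AddMonoid.End (JQuot M))ᵐᵒᵖ :=
  Ideal.Quotient.lift _ rightAct fun a ha => by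
    obtain ⟨r, s, rfl⟩ := Ideal.mem_span_pair.1 ha
    refine congrArg op (AddMonoidHom.ext fun n => ?_)
    change op (r * (Q.gen ε τ .z - 1) + s * (Q.gen ε τ .w - 1)) • n = 0
    rw [MulOpposite.op_add, add_smul, op_mul, op_mul, mul_smul, mul_smul, MulOpposite.op_sub,
      MulOpposite.op_sub, sub_smul, sub_smul, JQuot.z_smul, JQuot.w_smul, op_one, one_smul,
      one_smul, sub_self, sub_self, add_zero]

noncomputable instance (M : GrMod (Q.gr ε τ)) : Module (B ε τ)ᵐᵒᵖ (JQuot M) :=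
  rightModule ((actJ M).comp (B.toLoc ε τ).toRingHom)

/-- The action of `B` is induced by that of `Q`. -/
theorem JQuot.ofQ_smul (M : GrMod (Q.gr ε τ)) (q : Q ε τ) (n : JQuot M) :
    op (B.ofQ ε τ q) • n = op q • n := by
  change (actJ M (B.toLoc ε τ (B.ofQ ε τ q))).unop n = _
  rw [B.toLoc_ofQ]
  rfl

/-- The map induced by a morphism. -/
noncomputable def JQuot.map {M N : GrMod (Q.gr ε τ)} (f : M ⟶ N) :
    JQuot M →ₗ[(B ε τ)ᵐᵒᵖ] JQuot N :=
  let F : JQuot M →ₗ[(Q ε τ)ᵐᵒᵖ] JQuot N := (jSub M).liftQ (JQuot.mk N ∘ₗ lin f) (by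
    intro m hm
    obtain ⟨a, b, rfl⟩ := (mem_jSub M m).1 hm
    simp [JQuot.z_smul, JQuot.w_smul])
  { toFun := F
    map_add' := map_add F
    map_smul' := by
      intro b n
      obtain ⟨q, hq⟩ := B.ofQ_surjective ε τ b.unop
      obtain rfl : op (B.ofQ ε τ q) = b := congrArg op hq
      rw [JQuot.ofQ_smul, RingHom.id_apply, JQuot.ofQ_smul]
      exact map_smul F (op q) n }

theorem JQuot.map_mk {M N : GrMod (Q.gr ε τ)} (f : M ⟶ N) (m : M.carrier) :
    JQuot.map f (JQuot.mk M m) = JQuot.mk N (lin f m) := rfl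

variable (ε τ) in
/-- The functor `M ↦ M / (M(z - 1) + M(w - 1))`. -/
noncomputable def jFun : GrMod (Q.gr ε τ) ⥤ ModuleCat (B ε τ)ᵐᵒᵖ where
  obj M := ModuleCat.of _ (JQuot M)
  map f := ModuleCat.ofHom (JQuot.map f)
  map_id M := ModuleCat.hom_ext (LinearMap.ext fun n => by
    obtain ⟨m, rfl⟩ := JQuot.mk_surjective M n
    rfl)
  map_comp f g := ModuleCat.hom_ext (LinearMap.ext fun n => by
    obtain ⟨m, rfl⟩ := JQuot.mk_surjective _ n
    rfl)

variable (ε τ) in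
/-- The element `(zw)ᵏ`. -/
noncomputable def zw (k : ℕ) : (Q ε τ)ᵐᵒᵖ := op ((Q.gen ε τ .z * Q.gen ε τ .w) ^ k)

theorem zw_add (k l : ℕ) : zw ε τ (k + l) = zw ε τ l * zw ε τ k := by
  rw [zw, pow_add, op_mul]; rfl

theorem zw_mem (k : ℕ) :
    (Q.gen ε τ .z * Q.gen ε τ .w) ^ k ∈ Q.gr ε τ ((k : ℤ), (k : ℤ)) := by
  induction k with
  | zero => rw [pow_zero]; exact Q.one_mem_gr ε τ
  | succ k ih =>
    have := Q.mul_mem_gr ε τ ih (Q.mul_mem_gr ε τ (Q.gen_mem ε τ .z) (Q.gen_mem ε τ .w))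
    rw [pow_succ]
    convert this using 1
    simp [QGen.deg]

theorem zw_smul (M : GrMod (Q.gr ε τ)) (k : ℕ) (n : JQuot M) : zw ε τ k • n = n := by
  induction k with
  | zero => rw [zw, pow_zero, op_one, one_smul]
  | succ k ih =>
    rw [zw_add, mul_smul, ih, zw, pow_one, op_mul, mul_smul, JQuot.z_smul, JQuot.w_smul]

theorem zw_exists {M N : GrMod (Q.gr ε τ)} (f : M ⟶ N) {i₀ j₀ : ℤ}
    (h : ∀ i j : ℤ, i₀ < i → j₀ < j → ∀ n ∈ N.gr (i, j), ∃ m, lin f m = n) (n : N.carrier) :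
    ∃ k m, lin f m = zw ε τ k • n := by
  refine gr_induction N.gr N.isInternal (C := fun n => ∃ k m, lin f m = zw ε τ k • n) n
    ⟨0, 0, by simp⟩ ?_ ?_
  · rintro a b ⟨k, m, hm⟩ ⟨l, m', hm'⟩
    refine ⟨k + l, zw ε τ l • m + zw ε τ k • m', ?_⟩
    rw [map_add, map_smul, map_smul, hm, hm', smul_add, zw_add, mul_smul, ← zw_add, add_comm k l,
      zw_add, mul_smul]
  · rintro ⟨i, j⟩ n hn
    let k := (i₀ - i).natAbs + (j₀ - j).natAbs + 1
    have hk := N.smul_mem (zw_mem k) hn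
    obtain ⟨m, hm⟩ := h (i + k) (j + k) (by omega) (by omega) _ hk
    exact ⟨k, m, hm⟩

theorem zw_ker {M N : GrMod (Q.gr ε τ)} (f : M ⟶ N) {i₀ j₀ : ℤ}
    (h : ∀ i j : ℤ, i₀ < i → j₀ < j → ∀ m ∈ M.gr (i, j), lin f m = 0 → m = 0) (m : M.carrier)
    (hm : lin f m = 0) : ∃ k, zw ε τ k • m = 0 := by
  obtain ⟨s, hs, -⟩ := eq_sum_grProj M.gr M.isInternal m
  have key : ∀ p, ∃ k, zw ε τ k • M.proj p m = 0 := by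
    rintro ⟨i, j⟩
    let k := (i₀ - i).natAbs + (j₀ - j).natAbs + 1
    refine ⟨k, ?_⟩
    have hk := M.smul_mem (zw_mem k) (grProj_mem M.gr M.isInternal (i, j) m)
    refine h (i + k) (j + k) (by omega) (by omega) _ hk ?_
    rw [map_smul, lin_proj, hm, map_zero, smul_zero]
  choose k hk using key
  refine ⟨∑ p ∈ s, k p, ?_⟩
  conv_lhs => rw [hs]
  rw [Finset.smul_sum]
  refine Finset.sum_eq_zero fun p hp => ?_
  rw [← Finset.add_sum_erase s k hp, zw_add, mul_smul, hk, smul_zero]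

variable [Finite Γ]

theorem jFun_isoModTor {M N : GrMod (Q.gr ε τ)} (f : M ⟶ N)
    (hf : (tor (𝒜 := Q.gr ε τ)).isoModSerre f) : IsIso ((jFun ε τ).map f) := by
  rw [isoModTor_iff] at hf
  obtain ⟨⟨i₀, j₀, h⟩, ⟨i₁, j₁, h'⟩⟩ := hf
  rw [ConcreteCategory.isIso_iff_bijective]
  constructor
  · change Function.Injective (JQuot.map f)
    rw [injective_iff_map_eq_zero]
    intro n hn
    obtain ⟨m, rfl⟩ := JQuot.mk_surjective M n
    rw [JQuot.map_mk, JQuot.mk_eq_zero, mem_jSub] at hn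
    obtain ⟨a, b, hab⟩ := hn
    obtain ⟨k, a', ha⟩ := zw_exists f h' a
    obtain ⟨l, b', hb⟩ := zw_exists f h' b
    have cz : ∀ (k : ℕ) (n : N.carrier),
        zw ε τ k • op (Q.gen ε τ .z) • n = op (Q.gen ε τ .z) • zw ε τ k • n := by
      intro k n
      rw [smul_smul, smul_smul]
      exact congrArg (· • n) (congrArg op (Q.z_comm ε τ _).symm)
    have cw : ∀ (k : ℕ) (n : N.carrier),
        zw ε τ k • op (Q.gen ε τ .w) • n = op (Q.gen ε τ .w) • zw ε τ k • n := by
      intro k n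
      rw [smul_smul, smul_smul]
      exact congrArg (· • n) (congrArg op (Q.w_comm ε τ _).symm)
    obtain ⟨a'', ea⟩ : ∃ a'', lin f a'' = zw ε τ (k + l) • a :=
      ⟨zw ε τ l • a', by rw [map_smul, ha, zw_add, mul_smul]⟩
    obtain ⟨b'', eb⟩ : ∃ b'', lin f b'' = zw ε τ (k + l) • b :=
      ⟨zw ε τ k • b', by rw [map_smul, hb, add_comm k l, zw_add, mul_smul]⟩
    let r := zw ε τ (k + l) • m - ((op (Q.gen ε τ .z) • a'' - a'')
      + (op (Q.gen ε τ .w) • b'' - b''))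
    have hr : lin f r = 0 := by
      rw [map_sub, map_smul, ← hab, map_add, map_sub, map_sub, map_smul, map_smul, ea, eb,
        smul_add, smul_sub, smul_sub, cz, cw, sub_self]
    obtain ⟨t, ht⟩ := zw_ker f h r hr
    have h1 : JQuot.mk M r = 0 := by
      rw [← zw_smul M t (JQuot.mk M r), ← map_smul, ht, map_zero]
    have h2 : JQuot.mk M r = JQuot.mk M m := by
      simp [r, zw_smul, JQuot.z_smul, JQuot.w_smul]
    rw [← h2, h1]
  · change Function.Surjective (JQuot.map f)
    intro n
    obtain ⟨n, rfl⟩ := JQuot.mk_surjective N n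
    obtain ⟨k, m, hm⟩ := zw_exists f h' n
    exact ⟨JQuot.mk M m, by rw [JQuot.map_mk, hm, map_smul, zw_smul]⟩

end GrMod

/-- The category of coherent sheaves on the noncommutative quadric. -/
abbrev Coh [Finite Γ] := QGr (Q.gr ε τ)

/-- The functor `j^*` from coherent sheaves to right `B`-modules. -/
noncomputable def jStar [Finite Γ] : Coh ε τ ⥤ ModuleCat (B ε τ)ᵐᵒᵖ :=
  Localization.lift (GrMod.jFun ε τ) (fun _ _ f hf => GrMod.jFun_isoModTor f hf)
    (QGr.π (Q.gr ε τ))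

/-- `j^*(π M) = M / (M(z - 1) + M(w - 1))`. -/
noncomputable def jStarπ [Finite Γ] : QGr.π (Q.gr ε τ) ⋙ jStar ε τ ≅ GrMod.jFun ε τ :=
  Localization.fac _ _ _

end Affine

/-! ### Quotients of `W ⊗ 𝒪` and of `W ⊗ B` -/

section Quot

variable {Γ : Type} [CommGroup Γ] (ε : Γ →* ℂˣ) (τ : MonoidAlgebra ℂ Γ)

noncomputable instance : Module (MonoidAlgebra ℂ Γ) (Q ε τ) :=
  Module.compHom _ (Q.incl ε τ).toRingHom

noncomputable instance : Module (MonoidAlgebra ℂ Γ) (B ε τ) :=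
  Module.compHom _ (B.incl ε τ).toRingHom

theorem Q.smul_def (a : MonoidAlgebra ℂ Γ) (q : Q ε τ) : a • q = Q.incl ε τ a * q := rfl

theorem B.smul_def (a : MonoidAlgebra ℂ Γ) (b : B ε τ) : a • b = B.incl ε τ a * b := rfl

instance : SMulCommClass (MonoidAlgebra ℂ Γ) (Q ε τ)ᵐᵒᵖ (Q ε τ) :=
  ⟨fun _ _ _ => (mul_assoc _ _ _).symm⟩

instance : SMulCommClass (MonoidAlgebra ℂ Γ) (B ε τ)ᵐᵒᵖ (B ε τ) :=
  ⟨fun _ _ _ => (mul_assoc _ _ _).symm⟩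

theorem Q.incl_mem_gr (a : MonoidAlgebra ℂ Γ) : Q.incl ε τ a ∈ Q.gr ε τ 0 := by
  rw [Q.incl, MonoidAlgebra.lift_apply, Finsupp.sum]
  exact sum_mem fun γ _ => Q.gr_smul ε τ _ (Q.gen_mem ε τ (.g γ))

theorem Q.isInternal : DirectSum.IsInternal (Q.gr ε τ) := IsBigraded.isInternal

theorem Q.proj_smul (p : ℤ × ℤ) (a : MonoidAlgebra ℂ Γ) (q : Q ε τ) :
    grProj (Q.gr ε τ) (Q.isInternal ε τ) p (a • q)
      = a • grProj (Q.gr ε τ) (Q.isInternal ε τ) p q := by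
  have h : ∀ p, ∀ q ∈ Q.gr ε τ p, AddMonoidHom.mulLeft (Q.incl ε τ a) q ∈ Q.gr ε τ (p + 0) := by
    intro p q hq
    have := Q.mul_mem_gr ε τ (Q.incl_mem_gr ε τ a) hq
    rw [zero_add] at this
    rw [add_zero]
    exact this
  have h2 := map_grProj (Q.gr ε τ) (Q.isInternal ε τ) (Q.isInternal ε τ)
    (AddMonoidHom.mulLeft (Q.incl ε τ a)) 0 h p q
  rw [add_zero] at h2
  exact h2.symm

/-- The projection of `Q` onto its component of bidegree `p`. -/
noncomputable def Q.projLin (p : ℤ × ℤ) : Q ε τ →ₗ[MonoidAlgebra ℂ Γ] Q ε τ where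
  toFun := grProj (Q.gr ε τ) (Q.isInternal ε τ) p
  map_add' := map_add _
  map_smul' a q := Q.proj_smul ε τ p a q

variable (W : Type) [AddCommGroup W] [Module (MonoidAlgebra ℂ Γ) W]

/-- The right `B`-module `W ⊗_Γ B`. -/
noncomputable def tensorB : ModuleCat (B ε τ)ᵐᵒᵖ :=
  ModuleCat.of _ (B ε τ ⊗[MonoidAlgebra ℂ Γ] W)

/-- The map `W ⊗ Q → W ⊗ B` induced by `Q → B`, `z, w ↦ 1`. -/
noncomputable def tensorMap :
    (Q ε τ ⊗[MonoidAlgebra ℂ Γ] W) →ₗ[MonoidAlgebra ℂ Γ] (B ε τ ⊗[MonoidAlgebra ℂ Γ] W) :=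
  LinearMap.rTensor W
    { toFun := B.ofQ ε τ
      map_add' := map_add _
      map_smul' := fun a q => by
        rw [Q.smul_def, map_mul, B.ofQ_incl, RingHom.id_apply, B.smul_def] }

theorem tensorMap_smul (q : Q ε τ) (u : Q ε τ ⊗[MonoidAlgebra ℂ Γ] W) :
    tensorMap ε τ W (op q • u) = op (B.ofQ ε τ q) • tensorMap ε τ W u := by
  induction u with
  | zero => rw [smul_zero, map_zero, smul_zero]
  | add a b ha hb => rw [smul_add, map_add, map_add, smul_add, ha, hb]
  | tmul a v =>
    rw [TensorProduct.smul_tmul']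
    change B.ofQ ε τ (a * q) ⊗ₜ v = _
    rw [map_mul]
    rfl

variable [Module.Finite (MonoidAlgebra ℂ Γ) W]

/-- The bigraded right `Q`-module `W ⊗_Γ Q`, whose component of bidegree `p` is `W ⊗_Γ Q_p`. -/
noncomputable def tensorQ : GrMod (Q.gr ε τ) where
  carrier := Q ε τ ⊗[MonoidAlgebra ℂ Γ] W
  gr p := AddSubgroup.closure {u | ∃ q ∈ Q.gr ε τ p, ∃ v : W, u = q ⊗ₜ v}
  isInternal := by
    refine isInternal_of_proj _
      (fun p => (LinearMap.rTensor W (Q.projLin ε τ p)).toAddMonoidHom) ?_ ?_ ?_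
    · intro p u hu
      induction hu using AddSubgroup.closure_induction with
      | mem x hx =>
        obtain ⟨q, hq, v, rfl⟩ := hx
        exact congrArg (· ⊗ₜ v) (grProj_of_mem (Q.gr ε τ) (Q.isInternal ε τ) hq)
      | zero => exact map_zero _
      | add x y _ _ hx hy => rw [map_add, hx, hy]
      | neg x _ hx => rw [map_neg, hx]
    · intro p p' hp u hu
      induction hu using AddSubgroup.closure_induction with
      | mem x hx =>
        obtain ⟨q, hq, v, rfl⟩ := hx
        refine (congrArg (· ⊗ₜ v)
          (grProj_of_mem_ne (Q.gr ε τ) (Q.isInternal ε τ) hp hq)).trans ?_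
        exact TensorProduct.zero_tmul _ _
      | zero => exact map_zero _
      | add x y _ _ hx hy => rw [map_add, hx, hy, add_zero]
      | neg x _ hx => rw [map_neg, hx, neg_zero]
    · intro u
      induction u with
      | zero => exact zero_mem _
      | add a b ha hb => exact add_mem ha hb
      | tmul q v =>
        refine gr_induction (Q.gr ε τ) (Q.isInternal ε τ) (C := fun q => q ⊗ₜ v ∈ _) q ?_ ?_ ?_
        · rw [TensorProduct.zero_tmul]; exact zero_mem _
        · intro a b ha hb
          rw [TensorProduct.add_tmul]; exact add_mem ha hb
        · intro p q hq
          exact AddSubgroup.mem_iSup_of_mem p (AddSubgroup.subset_closure ⟨q, hq, v, rfl⟩)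
  smul_mem {p p' a u} ha hu := by
    induction hu using AddSubgroup.closure_induction with
    | mem x hx =>
      obtain ⟨q, hq, v, rfl⟩ := hx
      exact AddSubgroup.subset_closure ⟨q * a, Q.mul_mem_gr ε τ hq ha, v, rfl⟩
    | zero => rw [smul_zero]; exact zero_mem _
    | add x y _ _ hx hy => rw [smul_add]; exact add_mem hx hy
    | neg x _ hx => rw [smul_neg]; exact neg_mem hx
  finite := by
    classical
    obtain ⟨S, hS⟩ := (inferInstance : Module.Finite (MonoidAlgebra ℂ Γ) W)
    refine ⟨S.image fun v => (1 : Q ε τ) ⊗ₜ v, ?_⟩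
    rw [eq_top_iff]
    intro u _
    have key : ∀ v : W, ∀ q : Q ε τ, q ⊗ₜ[MonoidAlgebra ℂ Γ] v ∈
        Submodule.span (Q ε τ)ᵐᵒᵖ
          ((S.image fun v => (1 : Q ε τ) ⊗ₜ[MonoidAlgebra ℂ Γ] v : Finset _) : Set _) := by
      intro v
      have hv : v ∈ Submodule.span (MonoidAlgebra ℂ Γ) (S : Set W) := by rw [hS]; trivial
      induction hv using Submodule.span_induction with
      | mem v hv =>
        intro q
        have h0 : (1 : Q ε τ) ⊗ₜ[MonoidAlgebra ℂ Γ] v ∈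
            ((S.image fun v => (1 : Q ε τ) ⊗ₜ[MonoidAlgebra ℂ Γ] v : Finset _) : Set _) :=
          Finset.mem_coe.2 (Finset.mem_image.2 ⟨v, hv, rfl⟩)
        have h1 := Submodule.smul_mem _ (op q) (Submodule.subset_span (R := (Q ε τ)ᵐᵒᵖ) h0)
        rwa [TensorProduct.smul_tmul', op_smul_eq_mul, one_mul] at h1
      | zero => intro q; rw [TensorProduct.tmul_zero]; exact zero_mem _
      | add a b _ _ ha hb => intro q; rw [TensorProduct.tmul_add]; exact add_mem (ha q) (hb q)
      | smul r a _ ha => intro q; rw [← TensorProduct.smul_tmul]; exact ha _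
    induction u with
    | zero => exact zero_mem _
    | add a b ha hb => exact add_mem (ha trivial) (hb trivial)
    | tmul q v => exact key v q

/-- The map `W ⊗ B → j^*(W ⊗ 𝒪)`, `v ⊗ b ↦ [v ⊗ 1] b`. -/
noncomputable def tensorLin :
    (B ε τ ⊗[MonoidAlgebra ℂ Γ] W) →ₗ[(B ε τ)ᵐᵒᵖ] GrMod.JQuot (tensorQ ε τ W) :=
  let u : W →+ (tensorQ ε τ W).carrier :=
    { toFun := fun v => (1 : Q ε τ) ⊗ₜ[MonoidAlgebra ℂ Γ] v
      map_zero' := TensorProduct.tmul_zero _ _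
      map_add' := fun _ _ => TensorProduct.tmul_add _ _ _ }
  let F : (B ε τ ⊗[MonoidAlgebra ℂ Γ] W) →+ GrMod.JQuot (tensorQ ε τ W) :=
    TensorProduct.liftAddHom
      { toFun := fun b =>
          { toFun := fun v => op b • GrMod.JQuot.mk (tensorQ ε τ W) (u v)
            map_zero' := by rw [map_zero, map_zero, smul_zero]
            map_add' := fun v v' => by rw [map_add, map_add, smul_add] }
        map_zero' := AddMonoidHom.ext fun v => zero_smul _ _
        map_add' := fun a b => AddMonoidHom.ext fun v => add_smul _ _ _ } (by
      intro r b v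
      change op (r • b) • GrMod.JQuot.mk (tensorQ ε τ W) (u v)
        = op b • GrMod.JQuot.mk (tensorQ ε τ W) (u (r • v))
      rw [B.smul_def, op_mul, mul_smul, ← B.ofQ_incl, GrMod.JQuot.ofQ_smul, ← map_smul]
      refine congrArg (fun t => op b • GrMod.JQuot.mk (tensorQ ε τ W) t) ?_
      change ((1 : Q ε τ) * Q.incl ε τ r) ⊗ₜ[MonoidAlgebra ℂ Γ] v
        = (1 : Q ε τ) ⊗ₜ[MonoidAlgebra ℂ Γ] (r • v)
      rw [← TensorProduct.smul_tmul, Q.smul_def, one_mul, mul_one])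
  { toFun := F
    map_add' := map_add F
    map_smul' := by
      intro a t
      rw [RingHom.id_apply]
      induction t with
      | zero => rw [smul_zero, map_zero, smul_zero]
      | add x y hx hy => rw [smul_add, map_add, map_add, hx, hy, smul_add]
      | tmul b v =>
        change (a * op b) • GrMod.JQuot.mk (tensorQ ε τ W) (u v)
          = a • op b • GrMod.JQuot.mk (tensorQ ε τ W) (u v)
        rw [mul_smul] }

/-- The map `W ⊗ Q → W ⊗ B → 𝓜`. -/
noncomputable def evalQ (Y : Under (tensorB ε τ W)) : (tensorQ ε τ W).carrier →+ Y.right :=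
  Y.hom.hom.toAddMonoidHom.comp (tensorMap ε τ W).toAddMonoidHom

theorem evalQ_smul (Y : Under (tensorB ε τ W)) (q : Q ε τ) (u : (tensorQ ε τ W).carrier) :
    evalQ ε τ W Y (op q • u) = op (B.ofQ ε τ q) • evalQ ε τ W Y u :=
  (congrArg Y.hom.hom (tensorMap_smul ε τ W q u)).trans (map_smul Y.hom.hom _ _)

/-- The submodule of `W ⊗ Q` spanned by the elements of `W ⊗ Q_p`, `p ∈ ℤ²`, that are mapped to
zero by `W ⊗ Q_p → W ⊗ B_p → 𝓜`, where `B_p` is the image of `Q_p` in `B`. -/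
noncomputable def jKer (Y : Under (tensorB ε τ W)) :
    Submodule (Q ε τ)ᵐᵒᵖ (tensorQ ε τ W).carrier where
  carrier := {u | ∀ p, evalQ ε τ W Y ((tensorQ ε τ W).proj p u) = 0}
  zero_mem' p := by rw [map_zero, map_zero]
  add_mem' ha hb p := by rw [map_add, map_add, ha p, hb p, add_zero]
  smul_mem' r u hu := by
    obtain ⟨q, rfl⟩ : ∃ q, op q = r := ⟨r.unop, rfl⟩
    refine gr_induction (Q.gr ε τ) (Q.isInternal ε τ)
      (C := fun q => ∀ p, evalQ ε τ W Y ((tensorQ ε τ W).proj p (op q • u)) = 0) q ?_ ?_ ?_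
    · intro p
      rw [MulOpposite.op_zero, zero_smul, map_zero, map_zero]
    · intro a b ha hb p
      rw [MulOpposite.op_add, add_smul, map_add, map_add, ha p, hb p, add_zero]
    · intro d q hq p
      have h := map_grProj (tensorQ ε τ W).gr (tensorQ ε τ W).isInternal
        (tensorQ ε τ W).isInternal (DistribSMul.toAddMonoidHom _ (op q)) d
        (fun p m hm => (tensorQ ε τ W).smul_mem hq hm) (p - d) u
      rw [sub_add_cancel] at h
      refine (congrArg (evalQ ε τ W Y) h.symm).trans ?_
      refine (evalQ_smul ε τ W Y q _).trans ?_
      rw [hu (p - d), smul_zero]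

theorem proj_mem_jKer (Y : Under (tensorB ε τ W)) (p : ℤ × ℤ) (u : (tensorQ ε τ W).carrier)
    (hu : u ∈ jKer ε τ W Y) : (tensorQ ε τ W).proj p u ∈ jKer ε τ W Y := by
  intro q
  by_cases h : q = p
  · subst h
    rw [grProj_of_mem _ _ (grProj_mem _ _ _ _)]
    exact hu q
  · rw [grProj_of_mem_ne _ _ h (grProj_mem _ _ _ _), map_zero]

/-- The bigraded `Q`-module `⨁_p ψ(W ⊗ B_p)` of `ψ : W ⊗ B → 𝓜`, where the bifiltration `B_p` is
the image of `Q_p` in `B`, presented as a quotient of `W ⊗ Q = ⨁_p W ⊗ Q_p`. -/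
noncomputable def jMod (Y : Under (tensorB ε τ W)) : GrMod (Q.gr ε τ) :=
  (tensorQ ε τ W).quot (jKer ε τ W Y) (proj_mem_jKer ε τ W Y)

/-- The class in `jMod` of an element of `W ⊗ Q_p` vanishes iff its image in `ψ(W ⊗ B_p)` does. -/
theorem jMod_eq_zero_iff (Y : Under (tensorB ε τ W)) (p : ℤ × ℤ) (u : (tensorQ ε τ W).carrier)
    (hu : u ∈ (tensorQ ε τ W).gr p) :
    GrMod.lin ((tensorQ ε τ W).quotπ (jKer ε τ W Y) (proj_mem_jKer ε τ W Y)) u = 0 ↔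
      evalQ ε τ W Y u = 0 := by
  refine (Submodule.Quotient.mk_eq_zero _).trans ⟨fun h => ?_, fun h q => ?_⟩
  · have := h p
    rwa [grProj_of_mem _ _ hu] at this
  · by_cases hq : q = p
    · subst hq
      rwa [grProj_of_mem _ _ hu]
    · rw [grProj_of_mem_ne _ _ hq hu, map_zero]

/-- The morphism of bigraded modules induced by a morphism of quotients of `W ⊗ B`. -/
noncomputable def jModMap {Y Y' : Under (tensorB ε τ W)} (f : Y ⟶ Y') :
    jMod ε τ W Y ⟶ jMod ε τ W Y' :=
  GrMod.quotDesc _ _ ((tensorQ ε τ W).quotπ _ (proj_mem_jKer ε τ W Y')) fun u hu => by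
    refine (Submodule.Quotient.mk_eq_zero _).2 fun p => ?_
    have h : Y'.hom = Y.hom ≫ f.right := (Under.w f).symm
    change Y'.hom.hom _ = 0
    rw [h]
    exact (congrArg f.right.hom (hu p)).trans (map_zero f.right.hom)

variable [Finite Γ]

/-- The coherent sheaf `W ⊗_Γ 𝒪`. -/
noncomputable def tensorO : Coh ε τ := (QGr.π (Q.gr ε τ)).obj (tensorQ ε τ W)

/-- The canonical map `W ⊗ B → j^*(W ⊗ 𝒪)`. -/
noncomputable def tensorComparison : tensorB ε τ W ⟶ (jStar ε τ).obj (tensorO ε τ W) :=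
  ModuleCat.ofHom (tensorLin ε τ W) ≫ (jStarπ ε τ).inv.app (tensorQ ε τ W)

/-- The functor `(W ⊗ 𝒪 → F) ↦ (W ⊗ B → j^*(W ⊗ 𝒪) → j^*F)`. -/
noncomputable def jUnder : Under (tensorO ε τ W) ⥤ Under (tensorB ε τ W) :=
  Under.post (jStar ε τ) ⋙ Under.map (tensorComparison ε τ W)

/-- `Quot(W)`: the surjections `W ⊗ 𝒪 → F` with `i_z^*F = 0`, `L¹i_z^*F = 0` and
`L¹i_w^*F = 0`. -/
def IsQuot : ObjectProperty (Under (tensorO ε τ W)) := fun X =>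
  Epi X.hom ∧ IsZero ((GrMod.iStar (Q.zElt ε τ)).obj X.right) ∧
    IsZero (GrMod.derivedIStar (Q.zElt ε τ) X.right) ∧
    IsZero (GrMod.derivedIStar (Q.wElt ε τ) X.right)

/-- `BQuot(W)`: the surjections `W ⊗ B → 𝓜` of right `B`-modules such that `𝓜` has
zero-dimensional support as a module over `ℂ[x] ⊂ B`. -/
def IsBQuot : ObjectProperty (Under (tensorB ε τ W)) := fun Y =>
  Function.Surjective Y.hom.hom ∧
    Module.supportDim (Polynomial ℂ) ((ModuleCat.restrictScalars
      (Polynomial.aeval (R := ℂ) (op (B.gen ε τ .x))).toRingHom).obj Y.right) ≤ 0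

/-- The functor `j_{!*}`, which maps `ψ : W ⊗ B → 𝓜` to `W ⊗ 𝒪 → π(⨁_p ψ(W ⊗ B_p))`. -/
noncomputable def jInv : Under (tensorB ε τ W) ⥤ Under (tensorO ε τ W) where
  obj Y := Under.mk ((QGr.π (Q.gr ε τ)).map
    ((tensorQ ε τ W).quotπ (jKer ε τ W Y) (proj_mem_jKer ε τ W Y)))
  map {Y Y'} f := Under.homMk ((QGr.π (Q.gr ε τ)).map (jModMap ε τ W f)) (by
    refine ((QGr.π (Q.gr ε τ)).map_comp _ _).symm.trans ?_
    rfl)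
  map_id Y := Under.UnderMorphism.ext (by
    refine Eq.trans ?_ ((QGr.π (Q.gr ε τ)).map_id _)
    refine congrArg (QGr.π (Q.gr ε τ)).map (GrMod.hom_ext fun n => ?_)
    obtain ⟨u, rfl⟩ := Submodule.mkQ_surjective _ n
    rfl)
  map_comp f g := Under.UnderMorphism.ext (by
    refine Eq.trans ?_ ((QGr.π (Q.gr ε τ)).map_comp _ _)
    refine congrArg (QGr.π (Q.gr ε τ)).map (GrMod.hom_ext fun n => ?_)
    obtain ⟨u, rfl⟩ := Submodule.mkQ_surjective _ n
    rfl)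

end Quot
end NCQuadric

open NCQuadric

/-! An object of `QGr` only sees components of high bidegree, and for the sheaves in question the
affine restriction sees them too. The quotient M/(M(z-1)+M(w-1)) is the direct limit of the
components M_p along multiplication by z and w. If z and w act injectively in high degrees, then M_p
embeds in this limit for large p (`GrMod.eventually_mk_injective`). A quotient W ⊗ 𝒪 → F,
represented by maps W ⊗ Q_p → M_p that are surjective for large p, is then recovered from ψ : W ⊗ B
→ j^*F, because M_p is the image ψ(W ⊗ B_p). This gives j_{!*} j^* F = F. The identity j^* j_{!*} 𝓜
= 𝓜 holds because every element of W ⊗ B comes from W ⊗ Q_p for all large p.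

The conditions on both sides have to be matched. The normally ordered monomials form a basis of Q,
so z and w are not zero divisors. The first derived functor of M ↦ M/Mc is therefore the c-torsion
of M up to a shift of degree. Its vanishing in the quotient category means that c is injective on M
in high degrees (`GrMod.eventually_regular_of_tor_leftDerived`), and the vanishing of i_z^* means
that z is surjective in high degrees (`GrMod.isZero_iStar_iff`).

If z is surjective in high degrees, then M_p x ⊂ M_{p+(1,0)} = M_p z. The image of M_p in the affine
module is thus a finite-dimensional space stable under x, and the Cayley–Hamilton theorem makes
every element torsion over ℂ[x] (`GrMod.JQuot.exists_polynomial`). Over a principal ideal domain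
that is not a field this is the same as zero-dimensional support. Conversely, a polynomial P that
kills the image of γ ⊗ v in 𝓜 is made homogeneous by powers of z. The homogeneous relation shows
that the class of γ ⊗ v times x^{deg P} is divisible by z (`x_pow_smul_mem_zDiv`), so z is
surjective in high degrees on ⨁ ψ(W ⊗ B_p).

Morphisms under a fixed object out of an epimorphism are unique, so both categories are thin. The
equivalence then needs only isomorphisms of objects. -/

namespace NCQuadric

/-! ### The basis of normally ordered monomials of `Q` -/

section PBW

variable {Γ : Type} [CommGroup Γ] (ε : Γ →* ℂˣ) (τ : MonoidAlgebra ℂ Γ)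

/-- The vector space with basis the symbols `γ xᵃ yᵇ zᶜ wᵈ`. -/
abbrev NormalSpace (Γ : Type) : Type := (ℕ × ℕ × ℕ × ℕ × Γ) →₀ ℂ

/-- The basis vector `γ xᵃ yᵇ zᶜ wᵈ`. -/
noncomputable def normalVec (a b c d : ℕ) (γ : Γ) : NormalSpace Γ := Finsupp.single (a, b, c, d, γ) 1

/-- The right multiplication by a generator on normally ordered monomials. -/
noncomputable def normalMul : QGen Γ → ℕ × ℕ × ℕ × ℕ × Γ → NormalSpace Γ
  -- Moving x to the left through yᵇ leaves the terms yⁱ τ yʲ zw with i + j = b - 1. Moving δ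
  -- through yᵏ gives the factor ε(δ)ᵏ, and through xᵃ the factor ε(δ)⁻ᵃ. For b = 0 the inner sum is
  -- empty, so the truncated exponent b - 1 does no harm.
  | .x, (a, b, c, d, γ) => normalVec (a + 1) b c d γ +
      ∑ δ ∈ τ.coeff.support, (τ.coeff δ * ((ε δ : ℂ)⁻¹ ^ a * ∑ k ∈ Finset.range b, (ε δ : ℂ) ^ k)) •
        normalVec a (b - 1) (c + 1) (d + 1) (γ * δ)
  | .z, (a, b, c, d, γ) => normalVec a b (c + 1) d γ
  | .y, (a, b, c, d, γ) => normalVec a (b + 1) c d γ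
  | .w, (a, b, c, d, γ) => normalVec a b c (d + 1) γ
  | .g δ, (a, b, c, d, γ) => ((ε δ : ℂ)⁻¹ ^ a * (ε δ : ℂ) ^ b) • normalVec a b c d (γ * δ)

/-- The right multiplication by a generator as an endomorphism. -/
noncomputable def normalEnd (s : QGen Γ) : Module.End ℂ (NormalSpace Γ) :=
  Finsupp.linearCombination ℂ (normalMul ε τ s)

theorem normalEnd_vec (s : QGen Γ) (a b c d : ℕ) (γ : Γ) :
    normalEnd ε τ s (normalVec a b c d γ) = normalMul ε τ s (a, b, c, d, γ) := by
  rw [normalEnd, normalVec, Finsupp.linearCombination_single, one_smul]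

theorem normalSpace_ext {f g : Module.End ℂ (NormalSpace Γ)}
    (h : ∀ a b c d γ, f (normalVec a b c d γ) = g (normalVec a b c d γ)) : f = g := by
  refine Finsupp.lhom_ext' fun i => LinearMap.ext_ring ?_
  obtain ⟨a, b, c, d, γ⟩ := i
  exact h a b c d γ

/-- This check replaces a confluence argument: once the operators satisfy the relations, Q acts on
the space of symbols, and linear independence of the monomials follows by acting on the symbol of 1.
The opposite ring appears because right multiplications compose in reverse order. -/
theorem normalEnd_rel {a b : FreeAlgebra ℂ (QGen Γ)} (h : QRel ε τ a b) :
    FreeAlgebra.lift ℂ (fun s => op (normalEnd ε τ s)) a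
      = FreeAlgebra.lift ℂ (fun s => op (normalEnd ε τ s)) b := by
  apply unop_injective
  induction h with
  | one =>
    refine normalSpace_ext fun a b c d γ => ?_
    simp [normalEnd_vec, normalMul]
  | mul γ δ =>
    refine normalSpace_ext fun a b c d γ => ?_
    simp only [map_mul, FreeAlgebra.lift_ι_apply, unop_mul, unop_op, Module.End.mul_apply,
      normalEnd_vec, normalMul, map_smul, smul_smul, Units.val_mul]
    rw [mul_assoc γ]
    congr 1
    rw [mul_inv, mul_pow, mul_pow]; ring
  | gx δ =>
    refine normalSpace_ext fun a b c d γ => ?_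
    have h0 : (ε δ : ℂ) ≠ 0 := Units.ne_zero _
    simp only [map_mul, map_smul, FreeAlgebra.lift_ι_apply, unop_mul, unop_op, unop_smul,
      Module.End.mul_apply, LinearMap.smul_apply,
      normalEnd_vec, normalMul, smul_smul, map_add, map_sum, smul_add, Finset.smul_sum]
    congr 1
    · congr 1
      rw [pow_succ]
      linear_combination (-(ε δ : ℂ)⁻¹ ^ a * (ε δ : ℂ) ^ b) * mul_inv_cancel₀ h0
    · refine Finset.sum_congr rfl fun η _ => ?_
      rw [mul_right_comm γ δ η]
      congr 1
      cases b with
      | zero => simp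
      | succ b =>
        simp only [Nat.add_sub_cancel]
        ring
  | gy δ =>
    refine normalSpace_ext fun a b c d γ => ?_
    have h0 : (ε δ : ℂ) ≠ 0 := Units.ne_zero _
    simp only [map_mul, map_smul, FreeAlgebra.lift_ι_apply, unop_mul, unop_op, unop_smul,
      Module.End.mul_apply, LinearMap.smul_apply, normalEnd_vec, normalMul, smul_smul]
    congr 1
    rw [pow_succ]
    linear_combination (-(ε δ : ℂ)⁻¹ ^ a * (ε δ : ℂ) ^ b) * inv_mul_cancel₀ h0
  | gz δ =>
    refine normalSpace_ext fun a b c d γ => ?_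
    simp [normalEnd_vec, normalMul]
  | gw δ =>
    refine normalSpace_ext fun a b c d γ => ?_
    simp [normalEnd_vec, normalMul]
  | xz =>
    refine normalSpace_ext fun a b c d γ => ?_
    simp [normalEnd_vec, normalMul]
  | yz =>
    refine normalSpace_ext fun a b c d γ => ?_
    simp [normalEnd_vec, normalMul]
  | zw =>
    refine normalSpace_ext fun a b c d γ => ?_
    simp [normalEnd_vec, normalMul]
  | yw =>
    refine normalSpace_ext fun a b c d γ => ?_
    simp [normalEnd_vec, normalMul]
  | xw =>
    refine normalSpace_ext fun a b c d γ => ?_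
    simp [normalEnd_vec, normalMul]
  | yx =>
    refine normalSpace_ext fun a b c d γ => ?_
    simp only [map_mul, map_add, Finsupp.sum, map_sum, map_smul, FreeAlgebra.lift_ι_apply, unop_mul,
      MulOpposite.unop_add, unop_op, Finset.unop_sum, unop_smul,
      Module.End.mul_apply, LinearMap.smul_apply, LinearMap.add_apply, LinearMap.sum_apply,
      normalEnd_vec, normalMul, smul_smul, Nat.add_sub_cancel, add_assoc, add_right_inj]
    rw [← Finset.sum_add_distrib]
    refine Finset.sum_congr rfl fun δ _ => ?_
    cases b with
    | zero => simp
    | succ b =>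
      -- The last term of the geometric sum is what acting by τzw contributes; the remaining terms
      -- come from x followed by y.
      rw [Nat.add_sub_cancel, ← add_smul, Finset.sum_range_succ _ (b + 1)]
      congr 1
      ring

/-- The right regular representation of `Q` on normally ordered monomials. -/
noncomputable def normalRep : Q ε τ →ₐ[ℂ] (Module.End ℂ (NormalSpace Γ))ᵐᵒᵖ :=
  Q.lift ε τ (fun s => op (normalEnd ε τ s)) fun _ _ h => normalEnd_rel ε τ h

theorem normalRep_gen (s : QGen Γ) : (normalRep ε τ (Q.gen ε τ s)).unop = normalEnd ε τ s :=
  congrArg unop (Q.lift_gen ε τ _ _ s)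

/-- The normally ordered monomial `γ xᵃ yᵇ zᶜ wᵈ`. -/
noncomputable def normalMon (i : ℕ × ℕ × ℕ × ℕ × Γ) : Q ε τ :=
  Q.grp ε τ i.2.2.2.2 * Q.gen ε τ .x ^ i.1 * Q.gen ε τ .y ^ i.2.1 * Q.gen ε τ .z ^ i.2.2.1 *
    Q.gen ε τ .w ^ i.2.2.2.1

/-- The coordinates of an element of `Q` in the basis of normally ordered monomials. -/
noncomputable def normalCoord : Q ε τ →ₗ[ℂ] NormalSpace Γ where
  toFun q := (normalRep ε τ q).unop (normalVec 0 0 0 0 1)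
  map_add' a b := by simp
  map_smul' c a := by simp

theorem normalCoord_mul_gen (q : Q ε τ) (s : QGen Γ) :
    normalCoord ε τ (q * Q.gen ε τ s) = normalEnd ε τ s (normalCoord ε τ q) := by
  change (normalRep ε τ (q * Q.gen ε τ s)).unop _ = _
  rw [map_mul, unop_mul, normalRep_gen]
  rfl

/-- The monomial is built up from the left, so the inductions strip the factors in the order w, z,
y, x. When the powers of x are multiplied on, the exponent of y is still 0 and the correction term
of `normalMul` vanishes. -/
theorem normalCoord_mon (a b c d : ℕ) (γ : Γ) :
    normalCoord ε τ (normalMon ε τ (a, b, c, d, γ)) = normalVec a b c d γ := by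
  induction d with
  | succ d ih =>
    rw [normalMon, pow_succ, ← mul_assoc, normalCoord_mul_gen]
    erw [ih]
    rw [normalEnd_vec]; rfl
  | zero =>
  induction c with
  | succ c ih =>
    rw [normalMon, pow_zero, mul_one, pow_succ, ← mul_assoc, normalCoord_mul_gen]
    rw [normalMon, pow_zero, mul_one] at ih
    erw [ih]
    rw [normalEnd_vec]; rfl
  | zero =>
  induction b with
  | succ b ih =>
    rw [normalMon, pow_zero, mul_one, pow_zero, mul_one, pow_succ, ← mul_assoc, normalCoord_mul_gen]
    rw [normalMon, pow_zero, mul_one, pow_zero, mul_one] at ih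
    erw [ih]
    rw [normalEnd_vec]; rfl
  | zero =>
  simp only [normalMon, pow_zero, mul_one]
  induction a with
  | succ a ih =>
    rw [pow_succ, ← mul_assoc, normalCoord_mul_gen, ih, normalEnd_vec]
    simp [normalMul]
  | zero =>
    change (normalRep ε τ (Q.gen ε τ (.g γ) * _)).unop _ = _
    rw [pow_zero, mul_one, normalRep_gen, normalEnd_vec]
    simp [normalMul]

/-! ### Normally ordered monomials span Q. -/

theorem y_pow_grp (b : ℕ) (γ : Γ) : Q.gen ε τ .y ^ b * Q.grp ε τ γ
    = (ε γ : ℂ) ^ b • (Q.grp ε τ γ * Q.gen ε τ .y ^ b) := by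
  induction b with
  | zero => simp
  | succ b ih =>
    rw [pow_succ, mul_assoc, Q.y_grp, mul_smul_comm, ← mul_assoc, ih, smul_mul_assoc, smul_smul,
      mul_assoc, ← pow_succ, ← pow_succ']

theorem x_pow_grp (b : ℕ) (γ : Γ) : Q.gen ε τ .x ^ b * Q.grp ε τ γ
    = (ε γ : ℂ)⁻¹ ^ b • (Q.grp ε τ γ * Q.gen ε τ .x ^ b) := by
  induction b with
  | zero => simp
  | succ b ih =>
    rw [pow_succ, mul_assoc, Q.x_grp, mul_smul_comm, ← mul_assoc, ih, smul_mul_assoc, smul_smul,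
      mul_assoc, ← pow_succ, ← pow_succ']

theorem z_pow_comm (n : ℕ) (q : Q ε τ) :
    q * Q.gen ε τ .z ^ n = Q.gen ε τ .z ^ n * q :=
  (Commute.pow_right (show Commute q (Q.gen ε τ .z) from Q.z_comm ε τ q) n).eq

theorem w_pow_comm (n : ℕ) (q : Q ε τ) :
    q * Q.gen ε τ .w ^ n = Q.gen ε τ .w ^ n * q :=
  (Commute.pow_right (show Commute q (Q.gen ε τ .w) from Q.w_comm ε τ q) n).eq

theorem normalMon_zw (a b c d : ℕ) (γ : Γ) : normalMon ε τ (a, b, c, d, γ)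
    = normalMon ε τ (a, b, 0, 0, γ) * (Q.gen ε τ .z ^ c * Q.gen ε τ .w ^ d) := by
  simp only [normalMon, pow_zero, mul_one, mul_assoc]

theorem mul_zw_pow_comm (q s : Q ε τ) (c d : ℕ) :
    q * (Q.gen ε τ .z ^ c * Q.gen ε τ .w ^ d) * s
      = q * s * (Q.gen ε τ .z ^ c * Q.gen ε τ .w ^ d) := by
  rw [mul_assoc, mul_assoc q s, ← mul_assoc s, z_pow_comm, mul_assoc, ← w_pow_comm, mul_assoc]

theorem span_mul_z {q : Q ε τ} (hq : q ∈ Submodule.span ℂ (Set.range (normalMon ε τ))) (c d : ℕ) :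
    q * (Q.gen ε τ .z ^ c * Q.gen ε τ .w ^ d) ∈ Submodule.span ℂ (Set.range (normalMon ε τ)) := by
  induction hq using Submodule.span_induction with
  | mem q hq =>
    obtain ⟨⟨a, b, c', d', γ⟩, rfl⟩ := hq
    refine Submodule.subset_span ⟨(a, b, c' + c, d' + d, γ), ?_⟩
    rw [normalMon_zw, normalMon_zw ε τ a b c' d', pow_add, pow_add]
    simp only [mul_assoc]
    rw [← mul_assoc (Q.gen ε τ .w ^ d'), z_pow_comm]
    simp only [mul_assoc]
  | zero => rw [zero_mul]; exact zero_mem _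
  | add a b _ _ ha hb => rw [add_mul]; exact add_mem ha hb
  | smul r a _ ha => rw [smul_mul_assoc]; exact Submodule.smul_mem _ _ ha

theorem mon_mul_grp (a b c d : ℕ) (γ δ : Γ) : normalMon ε τ (a, b, c, d, γ) * Q.grp ε τ δ
    = ((ε δ : ℂ)⁻¹ ^ a * (ε δ : ℂ) ^ b) • normalMon ε τ (a, b, c, d, γ * δ) := by
  rw [normalMon_zw, mul_zw_pow_comm, normalMon_zw ε τ _ _ _ _ (γ * δ), ← smul_mul_assoc]
  congr 1
  simp only [normalMon, pow_zero, mul_one]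
  rw [mul_assoc, y_pow_grp, mul_smul_comm, mul_assoc _ _ (Q.grp ε τ δ * _),
    ← mul_assoc _ (Q.grp ε τ δ), x_pow_grp, smul_mul_assoc, mul_smul_comm, smul_smul, mul_comm (_ ^ b),
    map_mul]
  simp only [mul_assoc]

/-- Only x is not already in place: it is carried to the left past one y at a time by the relation
for [y, x], and the correction τzw is harmless because z and w are central and the span is stable
under Γ. -/
theorem span_mul_gen {q : Q ε τ} (hq : q ∈ Submodule.span ℂ (Set.range (normalMon ε τ)))
    (s : QGen Γ) : q * Q.gen ε τ s ∈ Submodule.span ℂ (Set.range (normalMon ε τ)) := by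
  -- Powers of z and w are central, so they can be split off; it suffices to multiply monomials in
  -- γ, x and y.
  have ext : ∀ s : Q ε τ, (∀ a b γ, normalMon ε τ (a, b, 0, 0, γ) * s
      ∈ Submodule.span ℂ (Set.range (normalMon ε τ))) → ∀ q ∈
      Submodule.span ℂ (Set.range (normalMon ε τ)),
      q * s ∈ Submodule.span ℂ (Set.range (normalMon ε τ)) := by
    intro s h q hq
    induction hq using Submodule.span_induction with
    | mem q hq =>
      obtain ⟨⟨a, b, c', d', γ⟩, rfl⟩ := hq
      rw [normalMon_zw, mul_zw_pow_comm]
      exact span_mul_z ε τ (h a b γ) _ _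
    | zero => rw [zero_mul]; exact zero_mem _
    | add a b _ _ ha hb => rw [add_mul]; exact add_mem ha hb
    | smul r a _ ha => rw [smul_mul_assoc]; exact Submodule.smul_mem _ _ ha
  have hy : ∀ q ∈ Submodule.span ℂ (Set.range (normalMon ε τ)), q * Q.gen ε τ .y ∈
      Submodule.span ℂ (Set.range (normalMon ε τ)) := by
    refine ext _ fun a b γ => Submodule.subset_span ⟨(a, b + 1, 0, 0, γ), ?_⟩
    simp only [normalMon, pow_zero, mul_one, pow_succ, mul_assoc]
  have hg : ∀ δ, ∀ q ∈ Submodule.span ℂ (Set.range (normalMon ε τ)), q * Q.grp ε τ δ ∈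
      Submodule.span ℂ (Set.range (normalMon ε τ)) := by
    refine fun δ => ext _ fun a b γ => ?_
    rw [mon_mul_grp]
    exact Submodule.smul_mem _ _ (Submodule.subset_span ⟨_, rfl⟩)
  cases s with
  | z => simpa using span_mul_z ε τ hq 1 0
  | w => simpa using span_mul_z ε τ hq 0 1
  | y => exact hy q hq
  | g γ => exact hg γ q hq
  | x =>
    refine ext _ (fun a b γ => ?_) q hq
    induction b with
    | zero =>
      refine Submodule.subset_span ⟨(a + 1, 0, 0, 0, γ), ?_⟩
      simp only [normalMon, pow_zero, mul_one, pow_succ, mul_assoc]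
    | succ b ih =>
      have e : normalMon ε τ (a, b + 1, 0, 0, γ) * Q.gen ε τ .x
          = normalMon ε τ (a, b, 0, 0, γ) * Q.gen ε τ .x * Q.gen ε τ .y
            + normalMon ε τ (a, b, 0, 0, γ) * Q.incl ε τ τ
              * (Q.gen ε τ .z ^ 1 * Q.gen ε τ .w ^ 1) := by
        simp only [normalMon, pow_zero, mul_one, pow_succ, one_mul]
        rw [mul_assoc, mul_assoc _ (Q.gen ε τ .y), Q.y_x]
        noncomm_ring
      rw [e]
      refine add_mem (hy _ ih) (span_mul_z ε τ ?_ 1 1)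
      rw [Q.incl, MonoidAlgebra.lift_apply, Finsupp.sum, Finset.mul_sum]
      refine sum_mem fun δ _ => ?_
      rw [mul_smul_comm]
      exact Submodule.smul_mem _ _ (hg δ _ (Submodule.subset_span ⟨_, rfl⟩))

theorem mem_span_normalMon (q : Q ε τ) : q ∈ Submodule.span ℂ (Set.range (normalMon ε τ)) := by
  have key : ∀ q : Q ε τ, ∀ s ∈ Submodule.span ℂ (Set.range (normalMon ε τ)),
      s * q ∈ Submodule.span ℂ (Set.range (normalMon ε τ)) := by
    intro q
    refine Q.induction ε τ (C := fun q => ∀ s ∈ Submodule.span ℂ (Set.range (normalMon ε τ)),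
      s * q ∈ Submodule.span ℂ (Set.range (normalMon ε τ))) ?_ ?_ ?_ ?_ q
    · intro c s hs
      rw [← Algebra.commutes, ← Algebra.smul_def]
      exact Submodule.smul_mem _ _ hs
    · exact fun a s hs => span_mul_gen ε τ hs a
    · exact fun a b ha hb s hs => by rw [mul_add]; exact add_mem (ha s hs) (hb s hs)
    · exact fun a b ha hb s hs => by rw [← mul_assoc]; exact hb _ (ha s hs)
  have h1 : (1 : Q ε τ) ∈ Submodule.span ℂ (Set.range (normalMon ε τ)) :=
    Submodule.subset_span ⟨(0, 0, 0, 0, 1), by simp [normalMon]⟩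
  have := key q 1 h1
  rwa [one_mul] at this

/-- The element with given coordinates. -/
noncomputable def ofNormal : NormalSpace Γ →ₗ[ℂ] Q ε τ :=
  Finsupp.linearCombination ℂ (normalMon ε τ)

/-- Spanning reduces this to monomials, whose coordinates are known. It makes `normalCoord`
injective, so that cancellation questions in Q become questions about basis vectors. -/
theorem ofNormal_coord (q : Q ε τ) : ofNormal ε τ (normalCoord ε τ q) = q := by
  induction mem_span_normalMon ε τ q using Submodule.span_induction with
  | mem q hq =>
    obtain ⟨⟨a, b, c, d, γ⟩, rfl⟩ := hq
    rw [normalCoord_mon, ofNormal, normalVec, Finsupp.linearCombination_single, one_smul]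
  | zero => rw [map_zero, map_zero]
  | add a b _ _ ha hb => rw [map_add, map_add, ha, hb]
  | smul r a _ ha => rw [map_smul, map_smul, ha]

theorem normalCoord_injective : Function.Injective (normalCoord ε τ) :=
  Function.LeftInverse.injective (ofNormal_coord ε τ)

/-- Meant for z and w: multiplication by either merely raises one exponent, hence carries the basis
injectively into itself. -/
theorem normalEnd_injective (s : QGen Γ) (f : ℕ × ℕ × ℕ × ℕ × Γ → ℕ × ℕ × ℕ × ℕ × Γ)
    (hf : Function.Injective f) (h : ∀ i, normalMul ε τ s i = Finsupp.single (f i) 1) :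
    Function.Injective (normalEnd ε τ s) := by
  have e : normalEnd ε τ s = Finsupp.lmapDomain ℂ ℂ f := by
    refine normalSpace_ext fun a b c d γ => ?_
    rw [normalEnd_vec, h, normalVec, Finsupp.lmapDomain_apply, Finsupp.mapDomain_single]
  rw [e]
  exact Finsupp.mapDomain_injective hf

theorem mul_z_eq_zero {q : Q ε τ} (h : q * Q.gen ε τ .z = 0) : q = 0 := by
  have hi : Function.Injective (normalEnd ε τ (.z : QGen Γ)) :=
    normalEnd_injective ε τ .z (fun i => (i.1, i.2.1, i.2.2.1 + 1, i.2.2.2.1, i.2.2.2.2))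
      (by rintro ⟨a, b, c, d, γ⟩ ⟨a', b', c', d', γ'⟩ h; simpa using h) fun _ => rfl
  refine normalCoord_injective ε τ (hi ?_)
  rw [← normalCoord_mul_gen, h, map_zero, map_zero]

theorem mul_w_eq_zero {q : Q ε τ} (h : q * Q.gen ε τ .w = 0) : q = 0 := by
  have hi : Function.Injective (normalEnd ε τ (.w : QGen Γ)) :=
    normalEnd_injective ε τ .w (fun i => (i.1, i.2.1, i.2.2.1, i.2.2.2.1 + 1, i.2.2.2.2))
      (by rintro ⟨a, b, c, d, γ⟩ ⟨a', b', c', d', γ'⟩ h; simpa using h) fun _ => rfl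
  refine normalCoord_injective ε τ (hi ?_)
  rw [← normalCoord_mul_gen, h, map_zero, map_zero]

/-! ### Bigraded components of Q and their finite dimension. -/

theorem gen_pow_mem (s : QGen Γ) (n : ℕ) : Q.gen ε τ s ^ n ∈ Q.gr ε τ (n • s.deg) := by
  induction n with
  | zero => rw [pow_zero, zero_smul]; exact Q.one_mem_gr ε τ
  | succ n ih => rw [pow_succ, succ_nsmul]; exact Q.mul_mem_gr ε τ ih (Q.gen_mem ε τ s)

/-- The bidegree of a normally ordered monomial. -/
def normalDeg (i : ℕ × ℕ × ℕ × ℕ × Γ) : ℤ × ℤ := (i.1 + i.2.2.1, i.2.1 + i.2.2.2.1)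

theorem normalMon_mem (i : ℕ × ℕ × ℕ × ℕ × Γ) : normalMon ε τ i ∈ Q.gr ε τ (normalDeg i) := by
  have := Q.mul_mem_gr ε τ (Q.mul_mem_gr ε τ (Q.mul_mem_gr ε τ (Q.mul_mem_gr ε τ
    (Q.gen_mem ε τ (.g i.2.2.2.2)) (gen_pow_mem ε τ .x i.1)) (gen_pow_mem ε τ .y i.2.1))
    (gen_pow_mem ε τ .z i.2.2.1)) (gen_pow_mem ε τ .w i.2.2.2.1)
  have e : normalDeg i = (QGen.g i.2.2.2.2).deg + i.1 • (QGen.x : QGen Γ).deg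
      + i.2.1 • (QGen.y : QGen Γ).deg + i.2.2.1 • (QGen.z : QGen Γ).deg
      + i.2.2.2.1 • (QGen.w : QGen Γ).deg := by
    simp [normalDeg, QGen.deg]
  rw [e]
  exact this

/-- The component of bidegree `p` is spanned by the normally ordered monomials of bidegree `p`. -/
theorem mem_span_of_mem_gr {p : ℤ × ℤ} {q : Q ε τ} (hq : q ∈ Q.gr ε τ p) :
    q ∈ Submodule.span ℂ (normalMon ε τ '' {i | normalDeg i = p}) := by
  have key : ∀ q : Q ε τ, grProj (Q.gr ε τ) (Q.isInternal ε τ) p q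
      ∈ Submodule.span ℂ (normalMon ε τ '' {i | normalDeg i = p}) := by
    intro q
    induction mem_span_normalMon ε τ q using Submodule.span_induction with
    | mem q hq =>
      obtain ⟨i, rfl⟩ := hq
      by_cases h : p = normalDeg i
      · subst h
        rw [grProj_of_mem _ _ (normalMon_mem ε τ i)]
        exact Submodule.subset_span ⟨i, rfl, rfl⟩
      · rw [grProj_of_mem_ne _ _ h (normalMon_mem ε τ i)]
        exact zero_mem _
    | zero => rw [map_zero]; exact zero_mem _
    | add a b _ _ ha hb => rw [map_add]; exact add_mem ha hb
    | smul r a _ ha =>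
      -- The projection is known to be linear over ℂΓ; complex scalars are fed in through ℂ → ℂΓ.
      have h := Q.proj_smul ε τ p (algebraMap ℂ _ r) a
      rw [Q.smul_def, Q.smul_def, AlgHom.commutes, ← Algebra.smul_def, ← Algebra.smul_def] at h
      rw [h]
      exact Submodule.smul_mem _ _ ha
  have := key q
  rwa [grProj_of_mem _ _ hq] at this

/-- All exponents are nonnegative and those of x, z (respectively y, w) add up to a coordinate of p.
-/
theorem finite_normalDeg [Finite Γ] (p : ℤ × ℤ) :
    {i : ℕ × ℕ × ℕ × ℕ × Γ | normalDeg i = p}.Finite := by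
  refine (((Set.finite_Iic p.1.toNat).prod ((Set.finite_Iic p.2.toNat).prod
    ((Set.finite_Iic p.1.toNat).prod ((Set.finite_Iic p.2.toNat).prod
      (Set.finite_univ (α := Γ))))))).subset ?_
  rintro ⟨a, b, c, d, γ⟩ rfl
  simp only [normalDeg, Set.mem_prod, Set.mem_Iic, Set.mem_univ, and_true]
  omega

end PBW

end NCQuadric

namespace NCQuadric

/-! ### Torsion and the derived functor of restriction -/

section Torsion

open Filter

/-- Torsion conditions become statements along `atTop` for the product order on ℤ², which lets
finitely many bounds be combined by filter reasoning. Replacing (a, b) by (a + 1, b + 1) reconciles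
strict with weak inequalities. -/
theorem eventually_iff_exists {P : ℤ × ℤ → Prop} : (∀ᶠ p in atTop, P p) ↔
    ∃ i₀ j₀ : ℤ, ∀ i j : ℤ, i₀ < i → j₀ < j → P (i, j) := by
  rw [eventually_atTop]
  constructor
  · rintro ⟨⟨a, b⟩, h⟩
    exact ⟨a, b, fun i j hi hj => h _ ⟨hi.le, hj.le⟩⟩
  · rintro ⟨a, b, h⟩
    exact ⟨(a + 1, b + 1), fun p hp => h p.1 p.2 (Int.lt_of_add_one_le hp.1)
      (Int.lt_of_add_one_le hp.2)⟩

theorem eventually_add {P : ℤ × ℤ → Prop} (h : ∀ᶠ p in atTop, P p) (d : ℤ × ℤ) :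
    ∀ᶠ p in atTop, P (p + d) :=
  (tendsto_atTop_add_const_right atTop d tendsto_id).eventually h

variable {A : Type} [Ring A] {𝒜 : ℤ × ℤ → AddSubgroup A}

namespace GrMod

theorem tor_iff_eventually (M : GrMod 𝒜) : tor M ↔ ∀ᶠ p in atTop, ∀ m ∈ M.gr p, m = 0 := by
  rw [tor_iff, eventually_iff_exists]

theorem exists_homogeneous {M N : GrMod 𝒜} (f : M ⟶ N) {p : ℤ × ℤ} {n : N.carrier} (hn : n ∈ N.gr p)
    (h : ∃ m, lin f m = n) : ∃ m ∈ M.gr p, lin f m = n := by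
  obtain ⟨m, rfl⟩ := h
  refine ⟨M.proj p m, grProj_mem _ _ _ _, ?_⟩
  rw [lin_proj]
  exact grProj_of_mem _ _ hn

variable [IsNoetherianRing Aᵐᵒᵖ]

theorem isoModTor_iff_eventually {M N : GrMod 𝒜} (f : M ⟶ N) : (tor (𝒜 := 𝒜)).isoModSerre f ↔
    (∀ᶠ p in atTop, ∀ m ∈ M.gr p, lin f m = 0 → m = 0) ∧
    (∀ᶠ p in atTop, ∀ n ∈ N.gr p, ∃ m, lin f m = n) := by
  rw [isoModTor_iff, eventually_iff_exists, eventually_iff_exists]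

theorem epiModTor_iff_eventually {M N : GrMod 𝒜} (f : M ⟶ N) : (tor (𝒜 := 𝒜)).epiModSerre f ↔
    ∀ᶠ p in atTop, ∀ n ∈ N.gr p, ∃ m, lin f m = n := by
  have e : cokernel f ≅ coker f := colimit.isoColimitCocone ⟨_, isColimitOfSurjective f (cokerπ f)
    (comp_cokerπ f) (cokerπ_surjective f) fun n h => (cokerπ_eq_zero f n).1 h⟩
  rw [ObjectProperty.epiModSerre_iff, tor.prop_iff_of_iso e, tor_iff_eventually]
  refine eventually_congr (Eventually.of_forall fun p => ⟨fun h n hn => ?_, ?_⟩)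
  · exact (cokerπ_eq_zero f n).1 (h _ (lin_mem (cokerπ f) hn))
  · rintro h _ ⟨n, hn, rfl⟩
    exact (cokerπ_eq_zero f n).2 (h n hn)

theorem isZero_π_iff (M : GrMod 𝒜) : IsZero ((QGr.π 𝒜).obj M) ↔ tor M :=
  ObjectProperty.SerreClassLocalization.isZero_obj_iff (QGr.π 𝒜) tor M

/-- This and the next two lemmas give access to the abstract homology object through elements. -/
theorem exists_cycle (S : ShortComplex (GrMod 𝒜)) (n : S.X₂.carrier) (hn : lin S.g n = 0) :
    ∃ k, lin S.iCycles k = n :=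
  exact_elem (ShortComplex.exact_of_f_is_kernel (ShortComplex.mk S.iCycles S.g S.iCycles_g)
    S.cyclesIsKernel) n hn

theorem exists_toCycles (S : ShortComplex (GrMod 𝒜)) (k : S.cycles.carrier)
    (hk : lin S.homologyπ k = 0) : ∃ x, lin S.toCycles x = k :=
  exact_elem (ShortComplex.exact_of_g_is_cokernel
    (ShortComplex.mk S.toCycles S.homologyπ S.toCycles_comp_homologyπ) S.homologyIsCokernel) k hk

theorem lin_iCycles_toCycles (S : ShortComplex (GrMod 𝒜)) (x : S.X₁.carrier) :
    lin S.iCycles (lin S.toCycles x) = lin S.f x :=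
  congrArg (fun φ => lin φ x) S.toCycles_i

/-- A homogeneous cycle lifts to a homogeneous element of the cycle module, whose homology class has
the same degree and so vanishes in high degrees. -/
theorem eventually_exact_of_tor_homology (S : ShortComplex (GrMod 𝒜)) (h : tor S.homology) :
    ∀ᶠ p in atTop, ∀ n ∈ S.X₂.gr p, lin S.g n = 0 → ∃ x, lin S.f x = n := by
  rw [tor_iff_eventually] at h
  filter_upwards [h] with p hp n hn h0
  obtain ⟨k, hk, rfl⟩ := exists_homogeneous S.iCycles hn (exists_cycle S n h0)
  obtain ⟨x, rfl⟩ := exists_toCycles S k (hp _ (lin_mem S.homologyπ hk))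
  exact ⟨x, (lin_iCycles_toCycles S x).symm⟩

theorem isZero_homology_of_exact (S : ShortComplex (GrMod 𝒜))
    (h : ∀ n, lin S.g n = 0 → ∃ x, lin S.f x = n) : IsZero S.homology := by
  rw [isZero_iff]
  intro m
  obtain ⟨k, rfl⟩ := (epi_iff S.homologyπ).1 inferInstance m
  obtain ⟨x, hx⟩ := h (lin S.iCycles k) (congrArg (fun φ => lin φ k) S.iCycles_g)
  have : lin S.toCycles x = k := (mono_iff S.iCycles).1 inferInstance (by
    rw [lin_iCycles_toCycles, hx])
  rw [← this]
  exact congrArg (fun φ => lin φ x) S.toCycles_comp_homologyπ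

variable [IsBigraded 𝒜] (c : CentralElt 𝒜)

theorem free_regular (hc : ∀ a : A, a * c.elt = 0 → a = 0) {n : ℕ} (d : Fin n → ℤ × ℤ)
    (v : (free 𝒜 d).carrier) (hv : op c.elt • v = 0) : v = 0 :=
  funext fun k => hc _ (congrFun hv k)

theorem exists_homogeneous_generators (M : GrMod 𝒜) : ∃ (n : ℕ) (d : Fin n → ℤ × ℤ)
    (x : Fin n → M.carrier), (∀ k, x k ∈ M.gr (d k)) ∧
      Submodule.span Aᵐᵒᵖ (Set.range x) = ⊤ := by
  classical
  obtain ⟨S, hS⟩ := M.finite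
  choose t ht _ using fun m => eq_sum_grProj M.gr M.isInternal m
  let T : Finset (M.carrier × (ℤ × ℤ)) := S.biUnion fun m => (t m).image fun p => (m, p)
  let e := T.equivFin.symm
  refine ⟨T.card, fun k => (e k).1.2, fun k => M.proj (e k).1.2 (e k).1.1,
    fun k => grProj_mem _ _ _ _, ?_⟩
  rw [eq_top_iff, ← hS, Submodule.span_le]
  intro m hm
  rw [ht m]
  refine sum_mem fun p hp => ?_
  have hT : (m, p) ∈ T := Finset.mem_biUnion.2 ⟨m, hm, Finset.mem_image.2 ⟨p, hp, rfl⟩⟩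
  refine Submodule.subset_span ⟨T.equivFin ⟨_, hT⟩, ?_⟩
  change M.proj (e _).1.2 (e _).1.1 = _
  simp [e]

theorem exists_free_cover (M : GrMod 𝒜) :
    ∃ (n : ℕ) (d : Fin n → ℤ × ℤ) (f : free 𝒜 d ⟶ M), Epi f := by
  obtain ⟨n, d, x, hx, hS⟩ := exists_homogeneous_generators M
  refine ⟨n, d, freeDesc x hx, (epi_iff _).2 (LinearMap.range_eq_top.1 ?_)⟩
  rw [eq_top_iff, ← hS, Submodule.span_le]
  rintro _ ⟨k, rfl⟩
  exact ⟨freeGen d k, freeDesc_gen x hx k⟩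

/-- A projective module is a retract of a free one, and regularity passes from A to free modules and
then to retracts. -/
theorem projective_regular (hc : ∀ a : A, a * c.elt = 0 → a = 0) (P : GrMod 𝒜) [Projective P]
    (m : P.carrier) (hm : op c.elt • m = 0) : m = 0 := by
  obtain ⟨n, d, f, hf⟩ := exists_free_cover P
  have e : Projective.factorThru (𝟙 P) f ≫ f = 𝟙 P := Projective.factorThru_comp _ _
  have h : lin (Projective.factorThru (𝟙 P) f) m = 0 :=
    free_regular c hc d _ (by rw [← map_smul, hm, map_zero])
  have := congrArg (fun φ => lin φ m) e
  rw [lin_comp, LinearMap.comp_apply, h, map_zero] at this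
  exact this.symm

variable (M : GrMod 𝒜)

/-- The short complex computing the first derived functor of restriction. -/
noncomputable def restrComplex (P : ProjectiveResolution M) : ShortComplex (GrMod (QuotBy.gr c)) :=
  (((restr c).mapHomologicalComplex _).obj P.complex).sc' 2 1 0

/-- The first derived functor of restriction as a homology module. -/
noncomputable def restrComplexIso (P : ProjectiveResolution M) :
    ((restr c).leftDerived 1).obj M ≅ (restrComplex c M P).homology :=
  P.isoLeftDerivedObj (restr c) 1 ≪≫ ShortComplex.homologyMapIso
    (HomologicalComplex.isoSc' _ 2 1 0 (ChainComplex.prev ℕ 1) (ChainComplex.next_nat_succ 0))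

theorem resolution_exact₀ {M : GrMod 𝒜} (P : ProjectiveResolution M) (p : (P.complex.X 0).carrier)
    (hp : lin (show P.complex.X 0 ⟶ M from P.π.f 0) p = 0) : ∃ q, lin (P.complex.d 1 0) q = p :=
  exact_elem P.exact₀ p hp

theorem resolution_exact₁ {M : GrMod 𝒜} (P : ProjectiveResolution M) (p : (P.complex.X 1).carrier)
    (hp : lin (P.complex.d 1 0) p = 0) : ∃ q, lin (P.complex.d 2 1) q = p :=
  exact_elem (P.exact_succ 0) p hp

theorem resolution_comp {M : GrMod 𝒜} (P : ProjectiveResolution M) (p : (P.complex.X 1).carrier) :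
    lin (show P.complex.X 0 ⟶ M from P.π.f 0) (lin (P.complex.d 1 0) p) = 0 :=
  congrArg (fun φ => lin φ p) P.complex_d_comp_π_f_zero

theorem resolution_surjective {M : GrMod 𝒜} (P : ProjectiveResolution M) :
    Function.Surjective (lin (show P.complex.X 0 ⟶ M from P.π.f 0)) :=
  (epi_iff _).1 (inferInstanceAs (Epi (P.π.f 0)))

/-- The first derived functor of `M ↦ M / Mc` vanishes on modules without `c`-torsion. -/
theorem isZero_leftDerived_of_regular (hM : ∀ m : M.carrier, op c.elt • m = 0 → m = 0) :
    IsZero (((restr c).leftDerived 1).obj M) := by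
  let P := projectiveResolution M
  refine IsZero.of_iso ?_ (restrComplexIso c M P)
  refine isZero_homology_of_exact _ fun n hn => ?_
  obtain ⟨p, rfl⟩ := modCπ_surjective c (P.complex.X 1) n
  have h1 : lin (modCπ c (P.complex.X 0)) (lin (P.complex.d 1 0) p) = 0 := hn
  -- A cycle modulo c is an element p with dp = cq. The image of q in M is killed by c, hence is 0,
  -- so q = dr. Then p - cr is an honest cycle, equal to some ds, and the class of p modulo c is a
  -- boundary.
  obtain ⟨q, hq⟩ := (modCπ_eq_zero c _ _).1 h1
  have h2 : lin (show P.complex.X 0 ⟶ M from P.π.f 0) q = 0 := by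
    refine hM _ ?_
    rw [← map_smul, hq, resolution_comp]
  obtain ⟨r, rfl⟩ := resolution_exact₀ P q h2
  obtain ⟨s, hs⟩ := resolution_exact₁ P (p - op c.elt • r) (by
    rw [map_sub, map_smul, hq, sub_self])
  refine ⟨lin (modCπ c (P.complex.X 2)) s, ?_⟩
  change lin (modCπ c (P.complex.X 1)) (lin (P.complex.d 2 1) s) = lin (modCπ c (P.complex.X 1)) p
  rw [hs, map_sub, sub_eq_self]
  exact (modCπ_eq_zero c _ _).2 ⟨r, rfl⟩

/-- If the first derived functor of `M ↦ M / Mc` is torsion at `M`, then `c` acts injectively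
on the components of `M` of high degree. -/
theorem eventually_regular_of_tor_leftDerived (hc : ∀ a : A, a * c.elt = 0 → a = 0)
    (hM : tor (((restr c).leftDerived 1).obj M)) :
    ∀ᶠ p in Filter.atTop, ∀ m ∈ M.gr p, op c.elt • m = 0 → m = 0 := by
  let P := projectiveResolution M
  rw [tor.prop_iff_of_iso (restrComplexIso c M P)] at hM
  -- The shift by the degree of c is needed because the homology class attached to an element m of
  -- degree p lives in degree p + deg c: lift m to q and write cq = dr, so that r is a cycle modulo
  -- c of that degree.
  filter_upwards [eventually_add (eventually_exact_of_tor_homology _ hM) c.deg] with p hp m hm h0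
  obtain ⟨q, hq, rfl⟩ := exists_homogeneous _ hm (resolution_surjective P m)
  obtain ⟨r, hr, hr'⟩ := exists_homogeneous (P.complex.d 1 0)
    ((P.complex.X 0).smul_mem c.mem hq) (resolution_exact₀ P _ (by rw [map_smul, h0]))
  obtain ⟨s, hs⟩ := hp (lin (modCπ c (P.complex.X 1)) r) (lin_mem (modCπ c _) hr) (by
    change lin (modCπ c (P.complex.X 0)) (lin (P.complex.d 1 0) r) = 0
    rw [hr']
    exact (modCπ_eq_zero c _ _).2 ⟨q, rfl⟩)
  obtain ⟨s, rfl⟩ := modCπ_surjective c (P.complex.X 2) s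
  have h1 : lin (modCπ c (P.complex.X 1)) (r - lin (P.complex.d 2 1) s) = 0 := by
    rw [map_sub, sub_eq_zero]
    exact hs.symm
  obtain ⟨t, ht⟩ := (modCπ_eq_zero c _ _).1 h1
  have h2 : lin (P.complex.d 1 0) (lin (P.complex.d 2 1) s) = 0 :=
    congrArg (fun φ => lin φ s) (P.complex.d_comp_d 2 1 0)
  -- From r - ds = ct follows c·dt = dr = cq. Regularity on the projective module cancels c, so q =
  -- dt is a boundary and its image m is 0.
  have h3 : op c.elt • (lin (P.complex.d 1 0) t - q) = 0 := by
    rw [smul_sub, ← map_smul, ht, map_sub, hr', h2, sub_zero, sub_self]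
  have := P.projective 0
  have h4 := projective_regular c hc _ _ h3
  rw [sub_eq_zero] at h4
  rw [← h4, resolution_comp]

theorem isZero_derivedIStar_iff (F : QGr 𝒜) :
    IsZero (derivedIStar c F) ↔ tor (((restr c).leftDerived 1).obj (repr F)) :=
  isZero_π_iff _

/-- By the factorization of `iStar` through the localization, the object is the image of M/Mc for
the chosen representative M; it vanishes exactly when M/Mc is torsion. -/
theorem isZero_iStar_iff (F : QGr 𝒜) : IsZero ((iStar c).obj F) ↔
    ∀ᶠ p in Filter.atTop, ∀ m ∈ (repr F).gr p, ∃ n, op c.elt • n = m := by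
  have e : (iStar c).obj F ≅ (QGr.π (QuotBy.gr c)).obj ((restr c).obj (repr F)) :=
    (iStar c).mapIso (eqToIso (π_repr F).symm) ≪≫
      (Localization.fac (restr c ⋙ QGr.π (QuotBy.gr c)) _ (QGr.π 𝒜)).app (repr F)
  rw [e.isZero_iff, isZero_π_iff, tor_iff_eventually]
  refine Filter.eventually_congr (Filter.Eventually.of_forall fun p => ⟨fun h m hm => ?_, ?_⟩)
  · exact (modCπ_eq_zero c _ _).1 (h _ ⟨m, hm, rfl⟩)
  · rintro h _ ⟨m, hm, rfl⟩
    exact (modCπ_eq_zero c _ _).2 (h m hm)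

end GrMod
end Torsion
end NCQuadric

namespace NCQuadric

/-! ### High components and the restriction to the affine part -/

section Affine

open Filter

namespace GrMod

variable {Γ : Type} [CommGroup Γ] {ε : Γ →* ℂˣ} {τ : MonoidAlgebra ℂ Γ} (M : GrMod (Q.gr ε τ))

variable (ε τ) in
/-- The central element `zᵏ wˡ` of bidegree `(k, l)`, acting from the right. -/
noncomputable def zwElt (p : ℤ × ℤ) : (Q ε τ)ᵐᵒᵖ :=
  op (Q.gen ε τ .z ^ p.1.toNat * Q.gen ε τ .w ^ p.2.toNat)

/-- The order relation makes both coordinates of q - p nonnegative, so `toNat` truncates nothing. -/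
theorem zwElt_mem {p q : ℤ × ℤ} (h : p ≤ q) {m : M.carrier} (hm : m ∈ M.gr p) :
    zwElt ε τ (q - p) • m ∈ M.gr q := by
  have := M.smul_mem (Q.mul_mem_gr ε τ (gen_pow_mem ε τ .z (q - p).1.toNat)
    (gen_pow_mem ε τ .w (q - p).2.toNat)) hm
  have e : p + ((q - p).1.toNat • (QGen.z : QGen Γ).deg + (q - p).2.toNat • (QGen.w : QGen Γ).deg)
      = q := by
    obtain ⟨h1, h2⟩ := h
    ext <;> simp [QGen.deg] <;> omega
  rwa [e] at this

theorem zwElt_smul (p : ℤ × ℤ) (n : JQuot M) : zwElt ε τ p • n = n := by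
  have hz : ∀ k : ℕ, op (Q.gen ε τ .z ^ k) • n = n := by
    intro k
    induction k with
    | zero => rw [pow_zero, op_one, one_smul]
    | succ k ih => rw [pow_succ, op_mul, mul_smul, ih, JQuot.z_smul]
  have hw : ∀ k : ℕ, op (Q.gen ε τ .w ^ k) • n = n := by
    intro k
    induction k with
    | zero => rw [pow_zero, op_one, one_smul]
    | succ k ih => rw [pow_succ, op_mul, mul_smul, ih, JQuot.w_smul]
  rw [zwElt, op_mul, mul_smul, hz, hw]

theorem mk_zwElt_smul (p : ℤ × ℤ) (m : M.carrier) :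
    JQuot.mk M (zwElt ε τ p • m) = JQuot.mk M m := by
  rw [map_smul, zwElt_smul]

theorem zwElt_smul_z (N p : ℤ × ℤ) (h : p + (1, 0) ≤ N) (m : M.carrier) :
    zwElt ε τ (N - (p + (1, 0))) • op (Q.gen ε τ .z) • m = zwElt ε τ (N - p) • m := by
  rw [zwElt, smul_smul, ← op_mul, ← mul_assoc, ← pow_succ']
  congr 5
  · have := h.1
    simp at this ⊢
    omega
  · simp

theorem zwElt_smul_w (N p : ℤ × ℤ) (h : p + (0, 1) ≤ N) (m : M.carrier) :
    zwElt ε τ (N - (p + (0, 1))) • op (Q.gen ε τ .w) • m = zwElt ε τ (N - p) • m := by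
  rw [zwElt, smul_smul, ← op_mul, ← mul_assoc, z_pow_comm ε τ _ (Q.gen ε τ .w), mul_assoc,
    ← pow_succ', zwElt]
  congr 4
  · simp
  · have := h.2
    simp at this ⊢
    omega

/-- The map `∑ m_p ↦ ∑ m_p zᵏ wˡ`, `(k, l) = N - p`. -/
noncomputable def level (N : ℤ × ℤ) : M.carrier →+ M.carrier :=
  (DirectSum.toAddMonoid fun p =>
    (DistribSMul.toAddMonoidHom M.carrier (zwElt ε τ (N - p))).comp (M.gr p).subtype).comp
    (grEquiv M.gr M.isInternal).symm.toAddMonoidHom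

theorem level_of_mem (N : ℤ × ℤ) {p : ℤ × ℤ} {m : M.carrier} (hm : m ∈ M.gr p) :
    level M N m = zwElt ε τ (N - p) • m := by
  change DirectSum.toAddMonoid _ ((grEquiv M.gr M.isInternal).symm m) = _
  rw [grProj_aux M.gr M.isInternal p m hm, DirectSum.toAddMonoid_of]
  rfl

theorem level_z (m : M.carrier) :
    ∀ᶠ N in atTop, level M N (op (Q.gen ε τ .z) • m) = level M N m := by
  refine gr_induction M.gr M.isInternal
    (C := fun m => ∀ᶠ N in atTop, level M N (op (Q.gen ε τ .z) • m) = level M N m) m ?_ ?_ ?_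
  · simp
  · intro a b ha hb
    filter_upwards [ha, hb] with N h1 h2
    rw [smul_add, map_add, map_add, h1, h2]
  · intro p m hm
    filter_upwards [eventually_ge_atTop (p + (1, 0))] with N hN
    rw [level_of_mem M N hm, level_of_mem M N (M.smul_mem (Q.gen_mem ε τ .z) hm)]
    exact zwElt_smul_z M N p hN m

theorem level_w (m : M.carrier) :
    ∀ᶠ N in atTop, level M N (op (Q.gen ε τ .w) • m) = level M N m := by
  refine gr_induction M.gr M.isInternal
    (C := fun m => ∀ᶠ N in atTop, level M N (op (Q.gen ε τ .w) • m) = level M N m) m ?_ ?_ ?_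
  · simp
  · intro a b ha hb
    filter_upwards [ha, hb] with N h1 h2
    rw [smul_add, map_add, map_add, h1, h2]
  · intro p m hm
    filter_upwards [eventually_ge_atTop (p + (0, 1))] with N hN
    rw [level_of_mem M N hm, level_of_mem M N (M.smul_mem (Q.gen_mem ε τ .w) hm)]
    exact zwElt_smul_w M N p hN m

/-- For large N the map `level` identifies m with mz and with mw, so it kills M(z-1) + M(w-1). This
is the statement that an element vanishing in the direct limit already vanishes at a finite stage.
-/
theorem level_eq_zero {m : M.carrier} (hm : JQuot.mk M m = 0) : ∀ᶠ N in atTop, level M N m = 0 := by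
  rw [JQuot.mk_eq_zero, mem_jSub] at hm
  obtain ⟨a, b, rfl⟩ := hm
  filter_upwards [level_z M a, level_w M b] with N ha hb
  rw [map_add, map_sub, map_sub, ha, hb, sub_self, sub_self, add_zero]

/-- If `z` and `w` act injectively in high degrees, then the components of high degree embed
into the affine restriction. -/
theorem eventually_mk_injective
    (hz : ∀ᶠ p in atTop, ∀ m ∈ M.gr p, op (Q.gen ε τ .z) • m = 0 → m = 0)
    (hw : ∀ᶠ p in atTop, ∀ m ∈ M.gr p, op (Q.gen ε τ .w) • m = 0 → m = 0) :
    ∀ᶠ p in atTop, ∀ m ∈ M.gr p, JQuot.mk M m = 0 → m = 0 := by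
  obtain ⟨p₀, h₀⟩ := eventually_atTop.1 (hz.and hw)
  -- The factors of zᵏwˡ are cancelled one at a time. The bidegree only grows under multiplication
  -- by z or w, so it never leaves the region where both act injectively.
  have key : ∀ k l : ℕ, ∀ p ≥ p₀, ∀ m ∈ M.gr p,
      op (Q.gen ε τ .z ^ k * Q.gen ε τ .w ^ l) • m = 0 → m = 0 := by
    intro k
    induction k with
    | zero =>
      intro l
      induction l with
      | zero => intro p _ m _ h; simpa using h
      | succ l ih =>
        intro p hp m hm h
        refine (h₀ p hp).2 m hm (ih (p + (0, 1)) (hp.trans ?_) _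
          (M.smul_mem (Q.gen_mem ε τ .w) hm) ?_)
        · exact le_add_of_nonneg_right ⟨le_rfl, zero_le_one⟩
        · rwa [pow_succ', pow_zero, one_mul, op_mul, mul_smul, ← one_mul (_ ^ l),
            ← pow_zero (Q.gen ε τ .z)] at h
    | succ k ih =>
      intro l p hp m hm h
      refine (h₀ p hp).1 m hm (ih l (p + (1, 0)) (hp.trans ?_) _
        (M.smul_mem (Q.gen_mem ε τ .z) hm) ?_)
      · exact le_add_of_nonneg_right ⟨zero_le_one, le_rfl⟩
      · rwa [pow_succ', mul_assoc, op_mul, mul_smul] at h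
  filter_upwards [eventually_ge_atTop p₀] with p hp m hm h
  -- Any N will do, even one not above p, since `key` covers all exponents, truncated ones included.
  obtain ⟨N, hN⟩ := (level_eq_zero M h).exists
  rw [level_of_mem M N hm] at hN
  exact key _ _ p hp m hm hN

/-- Each homogeneous component of a representative can be multiplied by powers of z and w into any
larger degree without changing its class, so finitely many components can be put in one common
degree. -/
theorem eventually_exists_mk (n : JQuot M) : ∀ᶠ p in atTop, ∃ m ∈ M.gr p, JQuot.mk M m = n := by
  obtain ⟨m, rfl⟩ := JQuot.mk_surjective M n
  refine gr_induction M.gr M.isInternal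
    (C := fun n => ∀ᶠ p in atTop, ∃ m ∈ M.gr p, JQuot.mk M m = JQuot.mk M n) m ?_ ?_ ?_
  · exact Eventually.of_forall fun p => ⟨0, zero_mem _, rfl⟩
  · intro a b ha hb
    filter_upwards [ha, hb] with p ⟨m, hm, e⟩ ⟨m', hm', e'⟩
    exact ⟨m + m', add_mem hm hm', by rw [map_add, map_add, e, e']⟩
  · intro q m hm
    filter_upwards [eventually_ge_atTop q] with p hp
    exact ⟨_, zwElt_mem M hp hm, mk_zwElt_smul M _ m⟩

theorem JQuot.map_surjective {M N : GrMod (Q.gr ε τ)} (f : M ⟶ N)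
    (h : ∀ᶠ p in atTop, ∀ n ∈ N.gr p, ∃ m, lin f m = n) : Function.Surjective (JQuot.map f) := by
  intro n
  obtain ⟨p, ⟨n, hn, rfl⟩, hp⟩ := ((eventually_exists_mk N n).and h).exists
  obtain ⟨m, rfl⟩ := hp n hn
  exact ⟨JQuot.mk M m, rfl⟩

end GrMod

/-! ### Zero-dimensional support -/

/-- An element without annihilator puts the generic point in the support, and any maximal ideal then
gives a chain of length one. Conversely, the smaller prime of a strict chain must be zero since
nonzero primes are maximal, and torsion excludes the zero prime. No finiteness of the module enters.
-/
theorem supportDim_le_zero_iff {R N : Type} [CommRing R] [IsDomain R] [IsPrincipalIdealRing R]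
    (hR : ¬ IsField R) [AddCommGroup N] [Module R N] :
    Module.supportDim R N ≤ 0 ↔ ∀ n : N, ∃ r : R, r ≠ 0 ∧ r • n = 0 := by
  rw [Module.supportDim, Order.krullDim_nonpos_iff_forall_isMax]
  constructor
  · intro h n
    by_contra! hn
    have h0 : (⊥ : PrimeSpectrum R) ∈ Module.support R N := by
      rw [Module.mem_support_iff']
      exact ⟨n, fun r hr => hn r fun e => hr (by rw [e]; exact zero_mem _)⟩
    obtain ⟨I, hI⟩ := Ideal.exists_maximal R
    let P : PrimeSpectrum R := ⟨I, hI.isPrime⟩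
    have hP : P ∈ Module.support R N := Module.mem_support_mono bot_le h0
    have h1 := h ⟨⊥, h0⟩ (b := ⟨P, hP⟩) (bot_le (a := P))
    have h2 : I ≤ ⊥ := h1
    exact Ring.ne_bot_of_isMaximal_of_not_isField hI hR (le_bot_iff.1 h2)
  · rintro h ⟨x, hx⟩ ⟨y, hy⟩ hxy
    by_contra hyx
    have hlt : x.asIdeal < y.asIdeal := lt_of_le_not_ge hxy hyx
    have hx0 : x.asIdeal = ⊥ := by
      by_contra hne
      have := x.isPrime.isMaximal hne
      exact hlt.ne (this.eq_of_le y.isPrime.ne_top hlt.le)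
    obtain ⟨n, hn⟩ := Module.mem_support_iff'.1 hx
    obtain ⟨r, hr, e⟩ := h n
    exact hn r (by rw [hx0]; exact hr) e

open Polynomial in
-- Cayley–Hamilton for the restriction of x to V; the characteristic polynomial is monic, hence
-- nonzero.
theorem exists_polynomial_smul_eq_zero {R N : Type} [Ring R] [Algebra ℂ R] [AddCommGroup N]
    [Module R N] [Module ℂ N] [IsScalarTower ℂ R N] (x : R) (V : Submodule ℂ N)
    [FiniteDimensional ℂ V] (hV : ∀ v ∈ V, x • v ∈ V) (v : N) (hv : v ∈ V) :
    ∃ p : ℂ[X], p ≠ 0 ∧ aeval x p • v = 0 := by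
  have : SMulCommClass R ℂ N := IsScalarTower.to_smulCommClass' 
  let T : V →ₗ[ℂ] V := (Algebra.lsmul ℂ ℂ N x).restrict hV
  have key : ∀ (p : ℂ[X]) (v : V), ((aeval T p v : V) : N) = aeval x p • (v : N) := by
    intro p v
    induction p using Polynomial.induction_on' generalizing v with
    | add p q hp hq =>
      rw [map_add, map_add, LinearMap.add_apply, add_smul, Submodule.coe_add, hp, hq]
    | monomial n a =>
      rw [aeval_monomial, aeval_monomial, Module.End.mul_apply, mul_smul]
      change a • ((T ^ n) v : N) = _
      rw [algebraMap_smul]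
      congr 1
      induction n with
      | zero => simp
      | succ n ih =>
        rw [pow_succ', pow_succ', Module.End.mul_apply, mul_smul, ← ih]
        rfl
  refine ⟨T.charpoly, T.charpoly_monic.ne_zero, ?_⟩
  have := key T.charpoly ⟨v, hv⟩
  rw [LinearMap.aeval_self_charpoly] at this
  exact this.symm

end Affine
end NCQuadric

namespace NCQuadric

/-! ### Torsion over ℂ[x] of the affine restriction. -/

section Support

open Filter Polynomial

namespace GrMod

variable {Γ : Type} [CommGroup Γ] {ε : Γ →* ℂˣ} {τ : MonoidAlgebra ℂ Γ} (M : GrMod (Q.gr ε τ))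

noncomputable instance : Module ℂ (JQuot M) := Module.compHom _ (algebraMap ℂ (B ε τ)ᵐᵒᵖ)

instance : IsScalarTower ℂ (B ε τ)ᵐᵒᵖ (JQuot M) :=
  ⟨fun c b n => by
    rw [Algebra.smul_def, mul_smul]
    rfl⟩

theorem JQuot.complex_smul (c : ℂ) (q : Q ε τ) (n : JQuot M) : op (c • q) • n = c • op q • n := by
  rw [← JQuot.ofQ_smul, map_smul, op_smul, smul_assoc, JQuot.ofQ_smul]

/-- The components of a finitely generated bigraded module are finite-dimensional, because those of
Q are. This is phrased inside the affine restriction, which carries the complex scalars. -/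
theorem exists_finite_mk_mem_span [Finite Γ] (p : ℤ × ℤ) : ∃ S : Set (JQuot M), S.Finite ∧
    ∀ m ∈ M.gr p, JQuot.mk M m ∈ Submodule.span ℂ S := by
  obtain ⟨n, d, f, hf⟩ := exists_free_cover M
  let S : Set (JQuot M) := ⋃ k, (fun i => op (normalMon ε τ i) • JQuot.mk M (lin f (freeGen d k))) ''
    {i | normalDeg i = p - d k}
  refine ⟨S, Set.finite_iUnion fun k => (finite_normalDeg _).image _, fun m hm => ?_⟩
  obtain ⟨v, hv, rfl⟩ := exists_homogeneous f hm ((epi_iff f).1 hf m)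
  have hv' : v = ∑ k, op ((v : Fin n → Q ε τ) k) • freeGen (𝒜 := Q.gr ε τ) d k := by
    change (v : Fin n → Q ε τ) = ∑ k, op ((v : Fin n → Q ε τ) k) • (Pi.single k 1 : Fin n → Q ε τ)
    conv_lhs => rw [← Finset.univ_sum_single (v : Fin n → Q ε τ)]
    refine Finset.sum_congr rfl fun k _ => ?_
    rw [← Pi.single_smul', op_smul_eq_mul, one_mul]
  rw [hv', map_sum, map_sum]
  refine sum_mem fun k _ => ?_
  rw [map_smul, map_smul]
  have hk := mem_span_of_mem_gr ε τ (hv k)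
  revert hk
  generalize (v : Fin n → Q ε τ) k = q
  intro hk
  induction hk using Submodule.span_induction with
  | mem q hq =>
    obtain ⟨i, hi, rfl⟩ := hq
    exact Submodule.subset_span (Set.mem_iUnion.2 ⟨k, i, hi, rfl⟩)
  | zero => rw [MulOpposite.op_zero, zero_smul]; exact zero_mem _
  | add a b _ _ ha hb => rw [MulOpposite.op_add, add_smul]; exact add_mem ha hb
  | smul c a _ ha => rw [JQuot.complex_smul]; exact Submodule.smul_mem _ _ ha

/-- If `z` is surjective in high degrees, then the affine restriction is a torsion module over
the polynomial ring in `x`. -/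
theorem JQuot.exists_polynomial [Finite Γ]
    (hz : ∀ᶠ p in atTop, ∀ m ∈ M.gr p, ∃ n, op (Q.gen ε τ .z) • n = m) (n : JQuot M) :
    ∃ P : ℂ[X], P ≠ 0 ∧ aeval (op (B.gen ε τ .x)) P • n = 0 := by
  obtain ⟨p, ⟨m, hm, rfl⟩, hp⟩ := ((eventually_exists_mk M n).and (eventually_add hz (1, 0))).exists
  obtain ⟨S, hS, hmem⟩ := exists_finite_mk_mem_span M p
  let V : Submodule ℂ (JQuot M) := Submodule.span ℂ (JQuot.mk M '' (M.gr p : Set M.carrier))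
  have hV : V ≤ Submodule.span ℂ S := Submodule.span_le.2 (by
    rintro _ ⟨m, hm, rfl⟩
    exact hmem m hm)
  have : FiniteDimensional ℂ (Submodule.span ℂ S) := FiniteDimensional.span_of_finite ℂ hS
  have : FiniteDimensional ℂ V := Submodule.finiteDimensional_of_le hV
  refine exists_polynomial_smul_eq_zero (op (B.gen ε τ .x)) V (fun v hv => ?_) _
    (Submodule.subset_span ⟨m, hm, rfl⟩)
  have hx : ∀ n : JQuot M, op (B.gen ε τ .x) • n = op (Q.gen ε τ .x) • n := fun n => by
    rw [← JQuot.ofQ_smul, B.ofQ_gen]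
    rfl
  have : SMulCommClass (B ε τ)ᵐᵒᵖ ℂ (JQuot M) := IsScalarTower.to_smulCommClass'
  induction hv using Submodule.span_induction with
  | mem v hv =>
    obtain ⟨m, hm, rfl⟩ := hv
    -- The shifted hypothesis writes mx as nz, and n may be replaced by its component of degree p.
    -- As z acts by 1 on the affine restriction, the class of mx is that of an element of M_p; this
    -- is the stability of V under x.
    obtain ⟨n, hn⟩ := hp _ (M.smul_mem (Q.gen_mem ε τ .x) hm)
    have hn' : op (Q.gen ε τ .z) • M.proj p n = op (Q.gen ε τ .x) • m := by
      have h := proj_mulC (Q.zElt ε τ) M (p + (1, 0)) n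
      change M.proj (p + (1, 0)) (op (Q.gen ε τ .z) • n)
        = op (Q.gen ε τ .z) • M.proj (p + (1, 0) - (1, 0)) n at h
      rw [add_sub_cancel_right] at h
      rw [← h, hn]
      exact grProj_of_mem _ _ (M.smul_mem (Q.gen_mem ε τ .x) hm)
    rw [hx, ← map_smul, ← hn', map_smul, JQuot.z_smul]
    exact Submodule.subset_span ⟨_, grProj_mem _ _ _ _, rfl⟩
  | zero => rw [smul_zero]; exact zero_mem _
  | add a b _ _ ha hb => rw [smul_add]; exact add_mem ha hb
  | smul c a _ ha => rw [smul_comm]; exact Submodule.smul_mem _ _ ha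

end GrMod

end Support

/-! ### The module W ⊗ B as the affine restriction of W ⊗ Q. -/

section Tensor

open Filter Polynomial

variable {Γ : Type} [CommGroup Γ] (ε : Γ →* ℂˣ) (τ : MonoidAlgebra ℂ Γ)
variable (W : Type) [AddCommGroup W] [Module (MonoidAlgebra ℂ Γ) W]

theorem isBQuot_iff (Y : Under (tensorB ε τ W)) : IsBQuot ε τ W Y ↔
    Function.Surjective Y.hom.hom ∧
      ∀ n : Y.right, ∃ P : ℂ[X], P ≠ 0 ∧ aeval (op (B.gen ε τ .x)) P • n = 0 :=
  and_congr_right fun _ => supportDim_le_zero_iff (Polynomial.not_isField ℂ)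

theorem isBQuot_of_iso {Y Y' : Under (tensorB ε τ W)} (e : Y ≅ Y') (h : IsBQuot ε τ W Y) :
    IsBQuot ε τ W Y' := by
  rw [isBQuot_iff] at h ⊢
  have hs : Function.Surjective e.hom.right.hom :=
    ((ConcreteCategory.isIso_iff_bijective e.hom.right).1
      (inferInstanceAs (IsIso ((Under.forget _).mapIso e).hom))).2
  refine ⟨?_, fun n => ?_⟩
  · rw [← Under.w e.hom]
    exact hs.comp h.1
  · obtain ⟨n, rfl⟩ := hs n
    obtain ⟨P, hP, h0⟩ := h.2 n
    exact ⟨P, hP, by rw [← map_smul, h0, map_zero]⟩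

theorem tensorMap_surjective : Function.Surjective (tensorMap ε τ W) :=
  LinearMap.rTensor_surjective _ (B.ofQ_surjective ε τ)

theorem ofQ_z : B.ofQ ε τ (Q.gen ε τ .z) = 1 := B.ofQ_gen ε τ .z
theorem ofQ_w : B.ofQ ε τ (Q.gen ε τ .w) = 1 := B.ofQ_gen ε τ .w

variable [Module.Finite (MonoidAlgebra ℂ Γ) W]

/-- The element `q ⊗ v` of `W ⊗ Q`. -/
noncomputable def qTmul (q : Q ε τ) (v : W) : (tensorQ ε τ W).carrier :=
  q ⊗ₜ[MonoidAlgebra ℂ Γ] v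

theorem smul_qTmul (q s : Q ε τ) (v : W) :
    op s • qTmul ε τ W q v = qTmul ε τ W (q * s) v := rfl

theorem zero_qTmul (v : W) : qTmul ε τ W 0 v = 0 := TensorProduct.zero_tmul _ _

theorem qTmul_zero (q : Q ε τ) : qTmul ε τ W q 0 = 0 := TensorProduct.tmul_zero _ _

theorem add_qTmul (a b : Q ε τ) (v : W) :
    qTmul ε τ W (a + b) v = qTmul ε τ W a v + qTmul ε τ W b v := TensorProduct.add_tmul _ _ _

theorem qTmul_add (q : Q ε τ) (a b : W) :
    qTmul ε τ W q (a + b) = qTmul ε τ W q a + qTmul ε τ W q b := TensorProduct.tmul_add _ _ _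

theorem incl_mul_qTmul (r : MonoidAlgebra ℂ Γ) (q : Q ε τ) (v : W) :
    qTmul ε τ W (Q.incl ε τ r * q) v = qTmul ε τ W q (r • v) := TensorProduct.smul_tmul r q v

theorem qTmul_mem {p : ℤ × ℤ} {q : Q ε τ} (hq : q ∈ Q.gr ε τ p) (v : W) :
    qTmul ε τ W q v ∈ (tensorQ ε τ W).gr p :=
  AddSubgroup.subset_closure ⟨q, hq, v, rfl⟩

/-- Since z and w go to 1 in B, the map W ⊗ Q → W ⊗ B factors through the affine restriction. -/
theorem tensorMap_eq {u u' : (tensorQ ε τ W).carrier}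
    (h : GrMod.JQuot.mk (tensorQ ε τ W) u = GrMod.JQuot.mk (tensorQ ε τ W) u') :
    tensorMap ε τ W u = tensorMap ε τ W u' := by
  rw [← sub_eq_zero, ← map_sub, GrMod.JQuot.mk_eq_zero, GrMod.mem_jSub] at h
  obtain ⟨a, b, h⟩ := h
  refine sub_eq_zero.1 ((map_sub (tensorMap ε τ W) u u').symm.trans ?_)
  refine (congrArg (tensorMap ε τ W) h.symm).trans ?_
  refine (map_add (tensorMap ε τ W) _ _).trans ?_
  have hz : tensorMap ε τ W (op (Q.gen ε τ .z) • a - a) = 0 := by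
    refine (map_sub (tensorMap ε τ W) _ _).trans (sub_eq_zero.2 ?_)
    refine (tensorMap_smul ε τ W _ a).trans ?_
    rw [ofQ_z, op_one, one_smul]
  have hw : tensorMap ε τ W (op (Q.gen ε τ .w) • b - b) = 0 := by
    refine (map_sub (tensorMap ε τ W) _ _).trans (sub_eq_zero.2 ?_)
    refine (tensorMap_smul ε τ W _ b).trans ?_
    rw [ofQ_w, op_one, one_smul]
  rw [hz, hw, add_zero]

/-- The subspaces W ⊗ B_p exhaust W ⊗ B: elements are moved to a high degree in the affine
restriction of W ⊗ Q and then carried over by `tensorMap_eq`. -/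
theorem eventually_exists_tensorMap (b : B ε τ ⊗[MonoidAlgebra ℂ Γ] W) :
    ∀ᶠ p in atTop, ∃ u ∈ (tensorQ ε τ W).gr p, tensorMap ε τ W u = b := by
  obtain ⟨u, rfl⟩ := tensorMap_surjective ε τ W b
  filter_upwards [GrMod.eventually_exists_mk (tensorQ ε τ W) (GrMod.JQuot.mk (tensorQ ε τ W) u)]
    with p ⟨m, hm, e⟩
  exact ⟨m, hm, tensorMap_eq ε τ W e⟩

/-- This computes the canonical map on representatives in W ⊗ Q, and yields its surjectivity. -/
theorem tensorLin_tensorMap (u : (tensorQ ε τ W).carrier) :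
    tensorLin ε τ W (tensorMap ε τ W u) = GrMod.JQuot.mk (tensorQ ε τ W) u := by
  induction u using TensorProduct.induction_on with
  | zero => exact map_zero _
  | add a b ha hb =>
    refine (congrArg (tensorLin ε τ W) (map_add (tensorMap ε τ W) a b)).trans ?_
    rw [map_add, ha, hb]
    exact (map_add (GrMod.JQuot.mk (tensorQ ε τ W)) _ _).symm
  | tmul q v =>
    change op (B.ofQ ε τ q) • GrMod.JQuot.mk (tensorQ ε τ W) (qTmul ε τ W 1 v)
      = GrMod.JQuot.mk (tensorQ ε τ W) (qTmul ε τ W q v)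
    rw [GrMod.JQuot.ofQ_smul, ← map_smul, smul_qTmul, one_mul]

theorem tensorLin_surjective : Function.Surjective (tensorLin ε τ W) := by
  intro n
  obtain ⟨u, rfl⟩ := GrMod.JQuot.mk_surjective _ n
  exact ⟨_, tensorLin_tensorMap ε τ W u⟩

/-! ### The bigraded module of a quotient of `W ⊗ B` -/

variable (Y : Under (tensorB ε τ W))

/-- The projection `W ⊗ Q → ⨁_p ψ(W ⊗ B_p)`. -/
noncomputable def jModπ : tensorQ ε τ W ⟶ jMod ε τ W Y :=
  (tensorQ ε τ W).quotπ (jKer ε τ W Y) (proj_mem_jKer ε τ W Y)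

theorem jModπ_surjective : Function.Surjective (GrMod.lin (jModπ ε τ W Y)) :=
  Submodule.mkQ_surjective _

theorem jModπ_eq_zero {p : ℤ × ℤ} {u : (tensorQ ε τ W).carrier} (hu : u ∈ (tensorQ ε τ W).gr p) :
    GrMod.lin (jModπ ε τ W Y) u = 0 ↔ evalQ ε τ W Y u = 0 :=
  jMod_eq_zero_iff ε τ W Y p u hu

/-- Central elements that become 1 in B act on ⨁ ψ(W ⊗ B_p) by the inclusions between subspaces of
𝓜, which are injective. It will be applied to z and w. -/
theorem jMod_regular (c : CentralElt (Q.gr ε τ)) (hc : B.ofQ ε τ c.elt = 1)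
    (m : (jMod ε τ W Y).carrier) (hm : op c.elt • m = 0) : m = 0 := by
  obtain ⟨u, rfl⟩ := jModπ_surjective ε τ W Y m
  rw [← map_smul] at hm
  have hm' : op c.elt • u ∈ jKer ε τ W Y := (Submodule.Quotient.mk_eq_zero _).1 hm
  refine (Submodule.Quotient.mk_eq_zero _).2 fun p => ?_
  have h := hm' (p + c.deg)
  have e := GrMod.proj_mulC c (tensorQ ε τ W) (p + c.deg) u
  rw [add_sub_cancel_right] at e
  rw [show (tensorQ ε τ W).proj (p + c.deg) (op c.elt • u)
    = op c.elt • (tensorQ ε τ W).proj p u from e, evalQ_smul, hc, op_one, one_smul] at h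
  exact h

/-- The elements of `W ⊗ Q` whose class in `⨁_p ψ(W ⊗ B_p)` is divisible by `z`. -/
noncomputable def zDiv : Submodule (Q ε τ)ᵐᵒᵖ (tensorQ ε τ W).carrier :=
  (LinearMap.range (GrMod.mulC (c := Q.zElt ε τ) (jMod ε τ W Y))).comap
    (GrMod.lin (jModπ ε τ W Y))

theorem mem_zDiv_of_eq_zero {u : (tensorQ ε τ W).carrier}
    (h : GrMod.lin (jModπ ε τ W Y) u = 0) : u ∈ zDiv ε τ W Y :=
  Submodule.mem_comap.2 (by rw [h]; exact zero_mem _)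

theorem z_smul_mem_zDiv (u : (tensorQ ε τ W).carrier) :
    op (Q.gen ε τ .z) • u ∈ zDiv ε τ W Y :=
  ⟨GrMod.lin (jModπ ε τ W Y) u, (map_smul (GrMod.lin (jModπ ε τ W Y)) _ _).symm⟩

/-- If `n₀ P(x) = 0` for the image `n₀` of `v ∈ W`, then `v xᵏ` is divisible by `z` for
`k = deg P`. -/
theorem x_pow_smul_mem_zDiv {u : (tensorQ ε τ W).carrier} (hu : u ∈ (tensorQ ε τ W).gr 0)
    {P : ℂ[X]} (hP : P ≠ 0) (h : aeval (op (B.gen ε τ .x)) P • evalQ ε τ W Y u = 0) :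
    op (Q.gen ε τ .x ^ P.natDegree) • u ∈ zDiv ε τ W Y := by
  set k := P.natDegree with hk
  -- The homogenization of P by z: it has bidegree (k, 0) and maps to P(x) in B, so uH vanishes in ⨁
  -- ψ(W ⊗ B_p).
  let H : Q ε τ := ∑ l ∈ Finset.range (k + 1),
    P.coeff l • (Q.gen ε τ .x ^ l * Q.gen ε τ .z ^ (k - l))
  have hH : H ∈ Q.gr ε τ (k, 0) := by
    refine sum_mem fun l hl => Q.gr_smul ε τ _ ?_
    have h1 := Q.mul_mem_gr ε τ (gen_pow_mem ε τ .x l) (gen_pow_mem ε τ .z (k - l))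
    have e : l • (QGen.x : QGen Γ).deg + (k - l) • (QGen.z : QGen Γ).deg = ((k : ℤ), 0) := by
      rw [Finset.mem_range] at hl
      ext <;> simp [QGen.deg]
      omega
    rwa [e] at h1
  have hB : op (B.ofQ ε τ H) = aeval (op (B.gen ε τ .x)) P := by
    rw [aeval_eq_sum_range, map_sum, Finset.op_sum]
    refine Finset.sum_congr rfl fun l _ => ?_
    rw [map_smul, map_mul, map_pow, map_pow, ofQ_z, one_pow, mul_one, B.ofQ_gen, op_smul, op_pow]
    rfl
  have h1 : op H • u ∈ zDiv ε τ W Y := by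
    refine mem_zDiv_of_eq_zero ε τ W Y ((jModπ_eq_zero ε τ W Y
      ((tensorQ ε τ W).smul_mem hH hu)).2 ?_)
    rw [evalQ_smul, hB, h]
  let r : Q ε τ := ∑ l ∈ Finset.range k,
    P.coeff l • (Q.gen ε τ .x ^ l * Q.gen ε τ .z ^ (k - l - 1))
  -- All terms of H but the leading one contain z. Hence the leading coefficient times u xᵏ is
  -- divisible by z modulo the kernel, and the coefficient is invertible.
  have hr : H = r * Q.gen ε τ .z + P.leadingCoeff • Q.gen ε τ .x ^ k := by
    simp only [H, r]
    rw [Finset.sum_range_succ, Nat.sub_self, pow_zero, mul_one, Finset.sum_mul]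
    congr 1
    refine Finset.sum_congr rfl fun l hl => ?_
    rw [Finset.mem_range] at hl
    rw [smul_mul_assoc, mul_assoc, ← pow_succ, Nat.sub_add_cancel (by omega)]
  have h2 : op (P.leadingCoeff • Q.gen ε τ .x ^ k) • u ∈ zDiv ε τ W Y := by
    have : op (P.leadingCoeff • Q.gen ε τ .x ^ k) • u
        = op H • u - op (Q.gen ε τ .z) • op r • u := by
      rw [hr, MulOpposite.op_add, add_smul, op_mul, mul_smul, add_sub_cancel_left]
    rw [this]
    exact sub_mem h1 (z_smul_mem_zDiv ε τ W Y _)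
  have h3 := Submodule.smul_mem _ (op (algebraMap ℂ (Q ε τ) P.leadingCoeff⁻¹)) h2
  rwa [smul_smul, ← op_mul, ← Algebra.commutes, ← Algebra.smul_def, smul_smul,
    inv_mul_cancel₀ (leadingCoeff_ne_zero.2 hP), one_smul] at h3

/-- With γ on the far left, γ ⊗ v has degree 0 and the previous lemma applies to it; the rest of the
monomial acts on the right. A monomial with a factor z is divisible outright. The bound depends only
on γ and v. -/
theorem normalMon_tmul_mem_zDiv (hY : IsBQuot ε τ W Y) (γ : Γ) (v : W) : ∃ k : ℕ,
    ∀ a b c d, k ≤ a ∨ 0 < c →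
      qTmul ε τ W (normalMon ε τ (a, b, c, d, γ)) v ∈ zDiv ε τ W Y := by
  obtain ⟨P, hP, h⟩ := ((isBQuot_iff ε τ W Y).1 hY).2
    (evalQ ε τ W Y (qTmul ε τ W (Q.grp ε τ γ) v))
  refine ⟨P.natDegree, fun a b c d hac => ?_⟩
  rcases hac with ha | hc
  · have h1 := x_pow_smul_mem_zDiv ε τ W Y (qTmul_mem ε τ W (Q.gen_mem ε τ (.g γ)) v) hP h
    have h2 := Submodule.smul_mem _ (op (Q.gen ε τ .x ^ (a - P.natDegree) * Q.gen ε τ .y ^ b *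
      Q.gen ε τ .z ^ c * Q.gen ε τ .w ^ d)) h1
    rw [smul_qTmul, smul_qTmul] at h2
    have e : Q.gen ε τ (.g γ) * Q.gen ε τ .x ^ P.natDegree * (Q.gen ε τ .x ^ (a - P.natDegree) *
        Q.gen ε τ .y ^ b * Q.gen ε τ .z ^ c * Q.gen ε τ .w ^ d) = normalMon ε τ (a, b, c, d, γ) := by
      simp only [normalMon]
      conv_rhs => rw [← Nat.add_sub_cancel' ha, pow_add]
      simp only [mul_assoc]
      rfl
    rwa [e] at h2
  · have h1 := z_smul_mem_zDiv ε τ W Y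
      (qTmul ε τ W (normalMon ε τ (a, b, c - 1, d, γ)) v)
    rw [smul_qTmul] at h1
    have e : normalMon ε τ (a, b, c - 1, d, γ) * Q.gen ε τ .z = normalMon ε τ (a, b, c, d, γ) := by
      rw [normalMon_zw, normalMon_zw ε τ a b c, mul_assoc, mul_assoc (_ ^ (c - 1)), Q.z_comm ε τ (_ ^ d),
        ← mul_assoc (_ ^ (c - 1)), ← pow_succ, Nat.sub_add_cancel hc]
    rwa [e] at h1

variable [Finite Γ]

theorem eventually_tmul_mem_zDiv (hY : IsBQuot ε τ W Y) (v : W) : ∀ᶠ p in atTop,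
    ∀ q ∈ Q.gr ε τ p, qTmul ε τ W q v ∈ zDiv ε τ W Y := by
  choose k hk using fun γ => normalMon_tmul_mem_zDiv ε τ W Y hY γ v
  -- Only the first coordinate needs a bound: if the exponents of x and z add up to at least k(γ),
  -- then z occurs or the exponent of x is at least k(γ). Finiteness of Γ makes the bound uniform.
  have := eventually_all.2 fun γ => eventually_ge_atTop (((k γ : ℤ), 0) : ℤ × ℤ)
  filter_upwards [this] with p hp q hq
  have hq' := mem_span_of_mem_gr ε τ hq
  clear hq
  induction hq' using Submodule.span_induction with
  | mem q hq =>
    obtain ⟨⟨a, b, c, d, γ⟩, rfl, rfl⟩ := hq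
    refine hk γ a b c d ?_
    have := (hp γ).1
    simp only [normalDeg] at this
    omega
  | zero => rw [zero_qTmul]; exact zero_mem _
  | add a b _ _ ha hb => rw [add_qTmul]; exact add_mem ha hb
  | smul r a _ ha =>
    have h := Submodule.smul_mem _ (op (algebraMap ℂ (Q ε τ) r)) ha
    rwa [smul_qTmul, ← Algebra.commutes, ← Algebra.smul_def] at h

/-- Finitely many generators of W give a common bound. Scalars from ℂΓ move across the tensor
product into Q, where they have degree 0 and keep the bidegree. -/
theorem eventually_z_surjective_jMod (hY : IsBQuot ε τ W Y) : ∀ᶠ p in atTop,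
    ∀ m ∈ (jMod ε τ W Y).gr p, ∃ n, op (Q.gen ε τ .z) • n = m := by
  obtain ⟨S, hS⟩ := (inferInstance : Module.Finite (MonoidAlgebra ℂ Γ) W)
  have := (Finset.eventually_all S).2 fun v _ => eventually_tmul_mem_zDiv ε τ W Y hY v
  filter_upwards [this] with p hp
  have key : ∀ v : W, ∀ q ∈ Q.gr ε τ p, qTmul ε τ W q v ∈ zDiv ε τ W Y := by
    intro v
    have hv : v ∈ Submodule.span (MonoidAlgebra ℂ Γ) (S : Set W) := by rw [hS]; trivial
    induction hv using Submodule.span_induction with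
    | mem v hv => exact hp v hv
    | zero => intro q _; rw [qTmul_zero]; exact zero_mem _
    | add a b _ _ ha hb =>
      intro q hq
      rw [qTmul_add]
      exact add_mem (ha q hq) (hb q hq)
    | smul r a _ ha =>
      intro q hq
      rw [← incl_mul_qTmul]
      refine ha _ ?_
      have := Q.mul_mem_gr ε τ (Q.incl_mem_gr ε τ r) hq
      rwa [zero_add] at this
  rintro _ ⟨u, hu, rfl⟩
  suffices u ∈ zDiv ε τ W Y from this
  induction hu using AddSubgroup.closure_induction with
  | mem x hx =>
    obtain ⟨q, hq, v, rfl⟩ := hx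
    exact key v q hq
  | zero => exact zero_mem _
  | add x y _ _ hx hy => exact add_mem hx hy
  | neg x _ hx => exact neg_mem hx

end Tensor
end NCQuadric

namespace NCQuadric

/-! ### Objects under a fixed object -/

section Thin

variable {C : Type*} [Category C] {T : C}

/-- Thinness: a map compatible with the structure maps is determined on the image of an epimorphism.
-/
theorem under_hom_subsingleton (X X' : Under T) [Epi X.hom] : Subsingleton (X ⟶ X') :=
  ⟨fun f g => Under.UnderMorphism.ext (by
    rw [← cancel_epi X.hom]
    exact (Under.w f).trans (Under.w g).symm)⟩

/-- Isolates the naturality needed to compare `jStar` on a localized object with the concrete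
quotient `jFun`. -/
theorem comp_inv_app_map_hom_app {D : Type*} [Category D] {F G : C ⥤ D} (e : F ≅ G) {M N : C} {a : D}
    (g : a ⟶ G.obj M) (f : M ⟶ N) :
    ((g ≫ e.inv.app M) ≫ F.map f) ≫ e.hom.app N = g ≫ G.map f := by
  simp

/-- Two surjective linear maps with the same kernel have isomorphic targets. -/
noncomputable def quotientEquiv {R M N N' : Type*} [Ring R] [AddCommGroup M] [AddCommGroup N]
    [AddCommGroup N'] [Module R M] [Module R N] [Module R N'] (f : M →ₗ[R] N) (g : M →ₗ[R] N')
    (hf : Function.Surjective f) (hg : Function.Surjective g)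
    (h : LinearMap.ker f = LinearMap.ker g) : N ≃ₗ[R] N' :=
  (f.quotKerEquivOfSurjective hf).symm ≪≫ₗ Submodule.quotEquivOfEq _ _ h ≪≫ₗ
    g.quotKerEquivOfSurjective hg

theorem quotientEquiv_apply {R M N N' : Type*} [Ring R] [AddCommGroup M] [AddCommGroup N]
    [AddCommGroup N'] [Module R M] [Module R N] [Module R N'] (f : M →ₗ[R] N) (g : M →ₗ[R] N')
    (hf : Function.Surjective f) (hg : Function.Surjective g)
    (h : LinearMap.ker f = LinearMap.ker g) (m : M) : quotientEquiv f g hf hg h (f m) = g m := by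
  have : (f.quotKerEquivOfSurjective hf).symm (f m) = Submodule.Quotient.mk m := by
    rw [LinearEquiv.symm_apply_eq]
    rfl
  rw [quotientEquiv, LinearEquiv.trans_apply, LinearEquiv.trans_apply, this]
  rfl

theorem nonempty_iso_of_ker_eq {R : Type} [Ring R] {T : ModuleCat.{0} R} (Y Y' : Under T)
    (hY : Function.Surjective Y.hom.hom) (hY' : Function.Surjective Y'.hom.hom)
    (h : ∀ t, Y.hom.hom t = 0 ↔ Y'.hom.hom t = 0) : Nonempty (Y ≅ Y') :=
  ⟨Under.isoMk (quotientEquiv Y.hom.hom Y'.hom.hom hY hY' (Submodule.ext h)).toModuleIso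
    (ModuleCat.hom_ext (LinearMap.ext fun t => quotientEquiv_apply _ _ hY hY' _ t))⟩

end Thin

/-! ### Quotients in the quotient category -/

section QuotCat

open Filter

namespace GrMod

variable {A : Type} [Ring A] {𝒜 : ℤ × ℤ → AddSubgroup A} [IsNoetherianRing Aᵐᵒᵖ]

theorem isIso_π_map {M N : GrMod 𝒜} (f : M ⟶ N)
    (h1 : ∀ᶠ p in atTop, ∀ m ∈ M.gr p, lin f m = 0 → m = 0)
    (h2 : ∀ᶠ p in atTop, ∀ n ∈ N.gr p, ∃ m, lin f m = n) : IsIso ((QGr.π 𝒜).map f) :=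
  Localization.inverts (QGr.π 𝒜) tor.isoModSerre f ((isoModTor_iff_eventually f).2 ⟨h1, h2⟩)

theorem epi_π_map_iff {M N : GrMod 𝒜} (f : M ⟶ N) : Epi ((QGr.π 𝒜).map f) ↔
    ∀ᶠ p in atTop, ∀ n ∈ N.gr p, ∃ m, lin f m = n := by
  rw [ObjectProperty.SerreClassLocalization.epi_map_iff (QGr.π 𝒜) tor f, epiModTor_iff_eventually]

theorem nonempty_iso_of_surjective {T N N' : GrMod 𝒜} (f : T ⟶ N) (g : N ⟶ N')
    (h1 : ∀ᶠ p in atTop, ∀ m ∈ N.gr p, lin g m = 0 → m = 0)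
    (h2 : ∀ᶠ p in atTop, ∀ n ∈ N'.gr p, ∃ m, lin g m = n) :
    Nonempty (Under.mk ((QGr.π 𝒜).map f) ≅ Under.mk ((QGr.π 𝒜).map (f ≫ g))) := by
  have := isIso_π_map g h1 h2
  exact ⟨Under.isoMk (asIso ((QGr.π 𝒜).map g)) ((QGr.π 𝒜).map_comp f g).symm⟩

/-- Two morphisms that are surjective and have the same kernel in high degrees define isomorphic
quotients in the quotient category. -/
theorem nonempty_iso_of_eventually {T N N' : GrMod 𝒜} (f : T ⟶ N) (q : T ⟶ N')
    (hf : ∀ᶠ p in atTop, ∀ n ∈ N.gr p, ∃ u, lin f u = n)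
    (hq : ∀ᶠ p in atTop, ∀ n ∈ N'.gr p, ∃ u, lin q u = n)
    (h : ∀ᶠ p in atTop, ∀ u ∈ T.gr p, lin f u = 0 ↔ lin q u = 0) :
    Nonempty (Under.mk ((QGr.π 𝒜).map f) ≅ Under.mk ((QGr.π 𝒜).map q)) := by
  let K : Submodule Aᵐᵒᵖ T.carrier := LinearMap.ker (lin f) ⊓ LinearMap.ker (lin q)
  have hK : ∀ p, ∀ m ∈ K, T.proj p m ∈ K := by
    rintro p m ⟨h1, h2⟩
    rw [SetLike.mem_coe, LinearMap.mem_ker] at h1 h2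
    refine ⟨?_, ?_⟩
    · rw [SetLike.mem_coe, LinearMap.mem_ker, lin_proj, h1, map_zero]
    · rw [SetLike.mem_coe, LinearMap.mem_ker, lin_proj, h2, map_zero]
  let k : T ⟶ T.quot K hK := T.quotπ K hK
  let a : T.quot K hK ⟶ N := quotDesc K hK f fun m hm => hm.1
  let b : T.quot K hK ⟶ N' := quotDesc K hK q fun m hm => hm.2
  have ha : k ≫ a = f := hom_ext fun _ => rfl
  have hb : k ≫ b = q := hom_ext fun _ => rfl
  have e1 : Nonempty (Under.mk ((QGr.π 𝒜).map k) ≅ Under.mk ((QGr.π 𝒜).map (k ≫ a))) := by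
    refine nonempty_iso_of_surjective k a ?_ ?_
    · filter_upwards [h] with p hp
      rintro _ ⟨u, hu, rfl⟩ h0
      exact (Submodule.Quotient.mk_eq_zero K).2 ⟨h0, (hp u hu).1 h0⟩
    · filter_upwards [hf] with p hp n hn
      obtain ⟨u, rfl⟩ := hp n hn
      exact ⟨lin k u, rfl⟩
  have e2 : Nonempty (Under.mk ((QGr.π 𝒜).map k) ≅ Under.mk ((QGr.π 𝒜).map (k ≫ b))) := by
    refine nonempty_iso_of_surjective k b ?_ ?_
    · filter_upwards [h] with p hp
      rintro _ ⟨u, hu, rfl⟩ h0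
      exact (Submodule.Quotient.mk_eq_zero K).2 ⟨(hp u hu).2 h0, h0⟩
    · filter_upwards [hq] with p hp n hn
      obtain ⟨u, rfl⟩ := hp n hn
      exact ⟨lin k u, rfl⟩
  rw [ha] at e1
  rw [hb] at e2
  exact ⟨e1.some.symm ≪≫ e2.some⟩

variable (c : CentralElt 𝒜)

/-- Injectivity in high degrees is invariant under isomorphisms modulo torsion. -/
theorem eventually_regular_of_isoModTor {M N : GrMod 𝒜} (s : M ⟶ N)
    (hs : (tor (𝒜 := 𝒜)).isoModSerre s)
    (h : ∀ᶠ p in atTop, ∀ m ∈ M.gr p, op c.elt • m = 0 → m = 0) :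
    ∀ᶠ p in atTop, ∀ n ∈ N.gr p, op c.elt • n = 0 → n = 0 := by
  rw [isoModTor_iff_eventually] at hs
  -- Injectivity of s is used on cm, which lies in degree p + deg c.
  filter_upwards [h, hs.2, eventually_add hs.1 c.deg] with p h1 h2 h3 n hn h0
  obtain ⟨m, hm, rfl⟩ := exists_homogeneous s hn (h2 n hn)
  rw [h1 m hm (h3 _ (M.smul_mem c.mem hm) (by rw [map_smul, h0])), map_zero]

/-- Surjectivity in high degrees is invariant under isomorphisms modulo torsion. -/
theorem eventually_surjective_of_isoModTor {M N : GrMod 𝒜} (s : M ⟶ N)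
    (hs : (tor (𝒜 := 𝒜)).isoModSerre s)
    (h : ∀ᶠ p in atTop, ∀ m ∈ M.gr p, ∃ n, op c.elt • n = m) :
    ∀ᶠ p in atTop, ∀ m ∈ N.gr p, ∃ n, op c.elt • n = m := by
  rw [isoModTor_iff_eventually] at hs
  filter_upwards [h, hs.2] with p h1 h2 n hn
  obtain ⟨m, hm, rfl⟩ := exists_homogeneous s hn (h2 n hn)
  obtain ⟨m', rfl⟩ := h1 m hm
  exact ⟨lin s m', (map_smul (lin s) _ _).symm⟩

end GrMod

/-! ### The two functors exchange the two classes of quotients and are mutually inverse on objects.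
-/

variable {Γ : Type} [CommGroup Γ] [Finite Γ] (ε : Γ →* ℂˣ) (τ : MonoidAlgebra ℂ Γ)
variable (W : Type) [AddCommGroup W] [Module (MonoidAlgebra ℂ Γ) W]
  [Module.Finite (MonoidAlgebra ℂ Γ) W]

/-- The object of `Under (W ⊗ 𝒪)` represented by a morphism of bigraded modules. -/
noncomputable abbrev underπ {N : GrMod (Q.gr ε τ)} (f : tensorQ ε τ W ⟶ N) :
    Under (tensorO ε τ W) := Under.mk (Y := (QGr.π (Q.gr ε τ)).obj N) ((QGr.π (Q.gr ε τ)).map f)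

/-- The structure map of X lives in the localization. A left fraction replaces the target by an
isomorphic object for which the map is an actual morphism of bigraded modules, and the conditions on
z and w travel along the denominator. -/
theorem exists_representative (X : Under (tensorO ε τ W)) (hX : IsQuot ε τ W X) :
    ∃ (N : GrMod (Q.gr ε τ)) (f : tensorQ ε τ W ⟶ N), Nonempty (X ≅ underπ ε τ W f) ∧
      (∀ᶠ p in atTop, ∀ n ∈ N.gr p, ∃ u, GrMod.lin f u = n) ∧
      (∀ᶠ p in atTop, ∀ m ∈ N.gr p, ∃ n, op (Q.gen ε τ .z) • n = m) ∧
      (∀ᶠ p in atTop, ∀ m ∈ N.gr p, op (Q.gen ε τ .z) • m = 0 → m = 0) ∧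
      (∀ᶠ p in atTop, ∀ m ∈ N.gr p, op (Q.gen ε τ .w) • m = 0 → m = 0) := by
  obtain ⟨hepi, hz, hz1, hw1⟩ := hX
  rw [GrMod.isZero_iStar_iff] at hz
  have hz1 := GrMod.eventually_regular_of_tor_leftDerived (Q.zElt ε τ) _
    (fun a => mul_z_eq_zero ε τ) ((GrMod.isZero_derivedIStar_iff _ _).1 hz1)
  have hw1 := GrMod.eventually_regular_of_tor_leftDerived (Q.wElt ε τ) _
    (fun a => mul_w_eq_zero ε τ) ((GrMod.isZero_derivedIStar_iff _ _).1 hw1)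
  let M : GrMod (Q.gr ε τ) := GrMod.repr X.right
  let g : (QGr.π (Q.gr ε τ)).obj (tensorQ ε τ W) ⟶ (QGr.π (Q.gr ε τ)).obj M := X.hom
  obtain ⟨φ, hφ⟩ := Localization.exists_leftFraction (QGr.π (Q.gr ε τ))
    (GrMod.tor (𝒜 := Q.gr ε τ)).isoModSerre g
  have hs : g ≫ (QGr.π (Q.gr ε τ)).map φ.s = (QGr.π (Q.gr ε τ)).map φ.f := by
    rw [hφ, MorphismProperty.LeftFraction.map_comp_map_s]
  have hi : IsIso ((QGr.π (Q.gr ε τ)).map φ.s) := Localization.inverts (QGr.π (Q.gr ε τ))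
    (GrMod.tor (𝒜 := Q.gr ε τ)).isoModSerre φ.s φ.hs
  have hg : Epi g := hepi
  let e : (QGr.π (Q.gr ε τ)).obj M ≅ (QGr.π (Q.gr ε τ)).obj φ.Y' :=
    asIso ((QGr.π (Q.gr ε τ)).map φ.s)
  refine ⟨φ.Y', φ.f, ⟨Under.isoMk e hs⟩, ?_,
    GrMod.eventually_surjective_of_isoModTor (Q.zElt ε τ) φ.s φ.hs hz,
    GrMod.eventually_regular_of_isoModTor (Q.zElt ε τ) φ.s φ.hs hz1,
    GrMod.eventually_regular_of_isoModTor (Q.wElt ε τ) φ.s φ.hs hw1⟩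
  rw [← GrMod.epi_π_map_iff, ← hs]
  infer_instance

/-- Through the identification `jStarπ`, kernels and images of j^* applied to a quotient can be
computed in the concrete module `JQuot`. -/
theorem jUnder_hom_apply {N : GrMod (Q.gr ε τ)} (f : tensorQ ε τ W ⟶ N)
    (b : B ε τ ⊗[MonoidAlgebra ℂ Γ] W) :
    ((jStarπ ε τ).hom.app N).hom (((jUnder ε τ W).obj (underπ ε τ W f)).hom.hom b)
      = GrMod.JQuot.map f (tensorLin ε τ W b) := by
  have h : ((jUnder ε τ W).obj (underπ ε τ W f)).hom ≫ (jStarπ ε τ).hom.app N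
      = ModuleCat.ofHom (tensorLin ε τ W) ≫ (GrMod.jFun ε τ).map f := by
    exact comp_inv_app_map_hom_app (jStarπ ε τ) (ModuleCat.ofHom (tensorLin ε τ W)) f
  exact congrArg (fun φ => φ.hom b) h

theorem jStarπ_bijective (N : GrMod (Q.gr ε τ)) :
    Function.Bijective ((jStarπ ε τ).hom.app N).hom :=
  (ConcreteCategory.isIso_iff_bijective ((jStarπ ε τ).hom.app N)).1 inferInstance

theorem jUnder_hom_eq_zero {N : GrMod (Q.gr ε τ)} (f : tensorQ ε τ W ⟶ N)
    (b : B ε τ ⊗[MonoidAlgebra ℂ Γ] W) :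
    ((jUnder ε τ W).obj (underπ ε τ W f)).hom.hom b = 0
      ↔ GrMod.JQuot.map f (tensorLin ε τ W b) = 0 := by
  rw [← jUnder_hom_apply]
  exact (map_eq_zero_iff _ (jStarπ_bijective ε τ N).1).symm

theorem jUnder_hom_surjective {N : GrMod (Q.gr ε τ)} (f : tensorQ ε τ W ⟶ N)
    (h : ∀ᶠ p in atTop, ∀ n ∈ N.gr p, ∃ u, GrMod.lin f u = n) :
    Function.Surjective ((jUnder ε τ W).obj (underπ ε τ W f)).hom.hom := by
  intro n
  obtain ⟨t, ht⟩ := GrMod.JQuot.map_surjective f h (((jStarπ ε τ).hom.app N).hom n)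
  obtain ⟨b, rfl⟩ := tensorLin_surjective ε τ W t
  exact ⟨b, (jStarπ_bijective ε τ N).1 ((jUnder_hom_apply ε τ W f b).trans ht)⟩

/-- Surjectivity in high degrees gives surjectivity on the affine part, and surjectivity of z gives
torsion over ℂ[x]; both pass back to X by isomorphism invariance. -/
theorem isBQuot_jUnder (X : Under (tensorO ε τ W)) (hX : IsQuot ε τ W X) :
    IsBQuot ε τ W ((jUnder ε τ W).obj X) := by
  obtain ⟨N, f, ⟨e⟩, hf, hz, -, -⟩ := exists_representative ε τ W X hX
  refine isBQuot_of_iso ε τ W ((jUnder ε τ W).mapIso e).symm ((isBQuot_iff ε τ W _).2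
    ⟨jUnder_hom_surjective ε τ W f hf, fun n => ?_⟩)
  obtain ⟨P, hP, h0⟩ := GrMod.JQuot.exists_polynomial N hz (((jStarπ ε τ).hom.app N).hom n)
  refine ⟨P, hP, (jStarπ_bijective ε τ N).1 ?_⟩
  exact (map_smul ((jStarπ ε τ).hom.app N).hom _ _).trans (h0.trans (map_zero _).symm)

/-- Regularity of z and w on `jMod` holds in all degrees, so both derived functors vanish before
localization; only the condition on i_z^* needs high degrees and the support hypothesis. -/
theorem isQuot_jInv (Y : Under (tensorB ε τ W)) (hY : IsBQuot ε τ W Y) :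
    IsQuot ε τ W ((jInv ε τ W).obj Y) := by
  refine ⟨(GrMod.epi_π_map_iff (jModπ ε τ W Y)).2
    (Eventually.of_forall fun p n _ => jModπ_surjective ε τ W Y n), ?_, ?_, ?_⟩
  -- The representative chosen by `repr` for the image of a module is that module by definition, so
  -- the statement about `jMod` applies as it stands.
  · exact (GrMod.isZero_iStar_iff _ _).2 (eventually_z_surjective_jMod ε τ W Y hY)
  · exact (QGr.π _).map_isZero
      (GrMod.isZero_leftDerived_of_regular _ (jMod ε τ W Y)
        (jMod_regular ε τ W Y (Q.zElt ε τ) (ofQ_z ε τ)))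
  · exact (QGr.π _).map_isZero
      (GrMod.isZero_leftDerived_of_regular _ (jMod ε τ W Y)
        (jMod_regular ε τ W Y (Q.wElt ε τ) (ofQ_w ε τ)))

/-- `j^* j_{!*} 𝓜 = 𝓜`. -/
theorem nonempty_jUnder_jInv_iso (Y : Under (tensorB ε τ W)) (hY : IsBQuot ε τ W Y) :
    Nonempty ((jUnder ε τ W).obj ((jInv ε τ W).obj Y) ≅ Y) := by
  -- Both objects are surjective images of W ⊗ B, so it is enough to compare kernels.
  refine nonempty_iso_of_ker_eq _ Y (jUnder_hom_surjective ε τ W (jModπ ε τ W Y)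
    (Eventually.of_forall fun p n _ => jModπ_surjective ε τ W Y n)) hY.1 fun b => ?_
  refine (jUnder_hom_eq_zero ε τ W (jModπ ε τ W Y) b).trans ?_
  have hinj := GrMod.eventually_mk_injective (jMod ε τ W Y)
    (Eventually.of_forall fun p m _ => jMod_regular ε τ W Y (Q.zElt ε τ) (ofQ_z ε τ) m)
    (Eventually.of_forall fun p m _ => jMod_regular ε τ W Y (Q.wElt ε τ) (ofQ_w ε τ) m)
  -- One degree p serves two purposes: b lifts to W ⊗ Q_p, and the component of degree p of `jMod`
  -- embeds in its affine restriction. The class of u then vanishes there exactly when ψ(b) = 0.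
  obtain ⟨p, ⟨u, hu, rfl⟩, hp⟩ := ((eventually_exists_tensorMap ε τ W b).and hinj).exists
  rw [tensorLin_tensorMap, GrMod.JQuot.map_mk]
  refine Iff.trans ⟨fun h => hp _ (GrMod.lin_mem _ hu) h, fun h => by rw [h, map_zero]⟩
    (jModπ_eq_zero ε τ W Y hu)

/-- `j_{!*} j^* F = F`. -/
theorem nonempty_jInv_jUnder_iso (X : Under (tensorO ε τ W)) (hX : IsQuot ε τ W X) :
    Nonempty (X ≅ (jInv ε τ W).obj ((jUnder ε τ W).obj X)) := by
  obtain ⟨N, f, ⟨e⟩, hf, -, hz, hw⟩ := exists_representative ε τ W X hX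
  let Y := (jUnder ε τ W).obj (underπ ε τ W f)
  have h : Nonempty (underπ ε τ W f ≅ underπ ε τ W (jModπ ε τ W Y)) := by
    refine GrMod.nonempty_iso_of_eventually f (jModπ ε τ W Y) hf
      (Eventually.of_forall fun p n _ => jModπ_surjective ε τ W Y n) ?_
    -- For large p the component N_p embeds in the affine restriction, so f and W ⊗ Q_p → j^*F have
    -- the same kernel. The latter is by construction the kernel of the map to `jMod`.
    filter_upwards [GrMod.eventually_mk_injective N hz hw] with p hp u hu
    rw [jModπ_eq_zero ε τ W Y hu]
    refine Iff.trans ?_ (jUnder_hom_eq_zero ε τ W f (tensorMap ε τ W u)).symm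
    rw [tensorLin_tensorMap, GrMod.JQuot.map_mk]
    exact ⟨fun h => by rw [h, map_zero], hp _ (GrMod.lin_mem f hu)⟩
  exact ⟨e ≪≫ h.some ≪≫ (jInv ε τ W).mapIso ((jUnder ε τ W).mapIso e.symm)⟩

end QuotCat

/-- Two functors between thin categories are quasi-inverse as soon as they are so on objects. -/
theorem exists_equivalence_of_subsingleton {C D : Type*} [Category C] [Category D]
    (F : C ⥤ D) (G : D ⥤ C) (hC : ∀ X X' : C, Subsingleton (X ⟶ X'))
    (hD : ∀ Y Y' : D, Subsingleton (Y ⟶ Y')) (η : ∀ X, Nonempty (X ≅ G.obj (F.obj X)))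
    (θ : ∀ Y, Nonempty (F.obj (G.obj Y) ≅ Y)) : ∃ e : C ≌ D, e.functor = F ∧ e.inverse = G :=
  ⟨CategoryTheory.Equivalence.mk F G
    (NatIso.ofComponents (fun X => (η X).some) fun _ => Subsingleton.elim _ _)
    (NatIso.ofComponents (fun Y => (θ Y).some) fun _ => Subsingleton.elim _ _), rfl, rfl⟩

end NCQuadric

/-! ### The equivalence, assembled from uniqueness of morphisms and the isomorphisms on objects. -/

theorem theorem4p1 (m : ℕ) [NeZero m] (ε : rootsOfUnity m ℂ →* ℂˣ) (hε : Function.Injective ε)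
    (τ : MonoidAlgebra ℂ (rootsOfUnity m ℂ)) (W : Type) [AddCommGroup W]
    [Module (MonoidAlgebra ℂ (rootsOfUnity m ℂ)) W]
    [Module.Finite (MonoidAlgebra ℂ (rootsOfUnity m ℂ)) W] :
    ∃ (h : ∀ X, IsQuot ε τ W X → IsBQuot ε τ W ((jUnder ε τ W).obj X))
      (h' : ∀ Y, IsBQuot ε τ W Y → IsQuot ε τ W ((jInv ε τ W).obj Y))
      (e : (IsQuot ε τ W).FullSubcategory ≌ (IsBQuot ε τ W).FullSubcategory),
      e.functor = (IsBQuot ε τ W).lift ((IsQuot ε τ W).ι ⋙ jUnder ε τ W)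
        (fun X => h X.obj X.property) ∧
      e.inverse = (IsQuot ε τ W).lift ((IsBQuot ε τ W).ι ⋙ jInv ε τ W)
        (fun Y => h' Y.obj Y.property) := by
  refine ⟨isBQuot_jUnder ε τ W, isQuot_jInv ε τ W,
    exists_equivalence_of_subsingleton _ _ (fun X X' => ?_) (fun Y Y' => ?_) (fun X => ?_)
      fun Y => ?_⟩
  · have := X.property.1
    have h := (under_hom_subsingleton X.obj X'.obj).elim
    exact ⟨fun f g => (IsQuot ε τ W).ι.map_injective (h _ _)⟩
  · have : Epi Y.obj.hom := (ModuleCat.epi_iff_surjective _).2 Y.property.1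
    have h := (under_hom_subsingleton Y.obj Y'.obj).elim
    exact ⟨fun f g => (IsBQuot ε τ W).ι.map_injective (h _ _)⟩
  · obtain ⟨e⟩ := nonempty_jInv_jUnder_iso ε τ W X.obj X.property
    exact ⟨(IsQuot ε τ W).fullyFaithfulι.preimageIso e⟩
  · obtain ⟨e⟩ := nonempty_jUnder_jInv_iso ε τ W Y.obj Y.property
    exact ⟨(IsBQuot ε τ W).fullyFaithfulι.preimageIso e⟩
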